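/- For a simple undirected graph $G=(V,E)$, where by convention every vertex is regarded as carrying a self-loop (so it is tied to itself as well as to its neighbours), an $(\alpha,\beta)$-community is a nonempty set $S\subseteq V$ such that every $v\in S$ is tied to at least $\alpha|S|$ vertices of $S$ and every $u\notin S$ is tied to at most $\beta|S|$ vertices of $S$. Let #ETH be the hypothesis that counting the satisfying assignments of a 3SAT formula $\varphi$ with $n$ variables requires time $2^{\Omega(n)}$, i.e. that for some $\delta_0>0$ no deterministic algorithm does this in time $2^{\delta_0 n}\cdot\mathrm{poly}(|\varphi|)$, where $|\varphi|$ is the length of the formula. Theorem. There is a function $\varepsilon(n)=o(1)$, of the form $\varepsilon(n)=1/k(n)$ for a function $k:\mathbb N\to\mathbb N_{>0}$ computable in time polynomial in $n$, such that the following holds. Assuming #ETH, counting the $(1,\varepsilon(n))$-communities of an $n$-vertex graph requires time $n^{\log^{1-o(1)}n}$. That is, assuming #ETH, there is a function $\delta(n)=o(1)$ such that no deterministic algorithm (Turing machine) computes, for every $n$ and every $n$-vertex graph $G$, the number of $(1,\varepsilon(n))$-communities of $G$ in time $O\bigl(n^{(\log n)^{1-\delta(n)}}\bigr)$. -/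

import Mathlib

open Filter Topology

/-! ### Computation with a time bound -/

/-- `SolvableInTime enc f T`: some deterministic (multi-stack) Turing machine, given the bit string
`enc a` as its input, halts with the binary expansion of the number `f a` as its output after at
most `T a` steps, for every instance `a`. -/
def SolvableInTime {α : Type} (enc : α → List Bool) (f : α → ℕ) (T : α → ℝ) : Prop :=
  ∃ M : Turing.TM2ComputableAux Bool Bool, ∀ a : α, ∃ t : ℕ, (t : ℝ) ≤ T a ∧
    Nonempty (Turing.TM2OutputsInTime M.tm
      ((enc a).map M.inputAlphabet.symm)
      (some ((Computability.encodeNat (f a)).map M.outputAlphabet.symm)) t)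

/-- The function `k` on the natural numbers is computable in time polynomial in the value of its
argument (the argument is given in unary, the result is returned in binary). -/
def PolyTimeInValue (k : ℕ → ℕ) : Prop :=
  Nonempty (Turing.TM2ComputableInPolyTime Computability.unaryEncodeNat Computability.encodeNat k)

/-! ### Counting satisfying assignments of 3-CNF formulas -/

/-- A literal on `n` variables: the variable and the truth value that makes the literal true. -/
abbrev Literal (n : ℕ) : Type := Fin n × Bool

/-- A 3-CNF formula on `n` variables: a list of clauses, each the disjunction of three literals
(literals may be repeated, so shorter nonempty clauses are covered). -/
abbrev ThreeCNF (n : ℕ) : Type := List (Fin 3 → Literal n)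

/-- The assignment `x` satisfies the formula `φ`. -/
def ThreeCNF.Sat {n : ℕ} (φ : ThreeCNF n) (x : Fin n → Bool) : Prop :=
  ∀ C ∈ φ, ∃ i : Fin 3, x (C i).1 = (C i).2

/-- The number of satisfying assignments. -/
noncomputable def ThreeCNF.satCount {n : ℕ} (φ : ThreeCNF n) : ℕ :=
  {x : Fin n → Bool | φ.Sat x}.ncard

/-- A literal as a bit string: the index of the variable in unary, a separator, the sign. -/
def encodeLiteral {n : ℕ} (l : Literal n) : List Bool :=
  List.replicate (l.1 : ℕ) true ++ [false, l.2]

/-- A formula as a bit string: the number of variables in unary, a separator, and the literals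
of the clauses one after the other. -/
def encodeCNF (φ : Σ n : ℕ, ThreeCNF n) : List Bool :=
  List.replicate φ.1 true ++ false ::
    φ.2.flatMap fun C => encodeLiteral (C 0) ++ encodeLiteral (C 1) ++ encodeLiteral (C 2)

/-- The counting exponential time hypothesis: for some `δ > 0`, no algorithm counts the satisfying
assignments of 3-CNF formulas `φ` on `n` variables in time `2 ^ (δ n) * poly(|φ|)`. -/
def SharpETH : Prop :=
  ∃ δ : ℝ, 0 < δ ∧ ∀ c : ℕ, ¬ SolvableInTime encodeCNF (fun φ => φ.2.satCount)
    (fun φ => (c : ℝ) * (2 : ℝ) ^ (δ * (φ.1 : ℝ)) * ((encodeCNF φ).length : ℝ) ^ c)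

/-! ### Communities -/

/-- The number of ties of the vertex `v` to the set `S`: every vertex is tied to its neighbours and
to itself (each vertex carries a self-loop). -/
noncomputable def ties {V : Type*} (G : SimpleGraph V) (v : V) (S : Finset V) : ℕ :=
  {w : V | w ∈ S ∧ (w = v ∨ G.Adj v w)}.ncard

/-- `S` is an `(α, β)`-community of the graph `G`. -/
def IsCommunity {V : Type*} (G : SimpleGraph V) (α β : ℝ) (S : Finset V) : Prop :=
  S.Nonempty ∧
  (∀ v ∈ S, α * (S.card : ℝ) ≤ (ties G v S : ℝ)) ∧
  (∀ u, u ∉ S → (ties G u S : ℝ) ≤ β * (S.card : ℝ))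

/-- The number of `(α, β)`-communities of a graph with vertices `0, …, n - 1`. -/
noncomputable def communityCount {n : ℕ} (G : SimpleGraph (Fin n)) (α β : ℝ) : ℕ :=
  {S : Finset (Fin n) | IsCommunity G α β S}.ncard

open Classical in
/-- A graph as a bit string: the rows of its adjacency matrix, one after the other. -/
noncomputable def encodeGraph (G : Σ n : ℕ, SimpleGraph (Fin n)) : List Bool :=
  (List.finRange G.1).flatMap fun i => (List.finRange G.1).map fun j => decide (G.2.Adj i j)

/-! A 3-CNF formula on n variables is turned into a graph on N vertices, with log N = O(√n log n),
whose communities correspond one to one to the satisfying assignments. Then (log N)^(2-o(1)) = o(n),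
so counting communities in time N^(log^(1-o(1)) N) = exp((log N)^(2-o(1))) would count satisfying
assignments in time 2^(o(n)) poly(|φ|), against #ETH.

An assignment is written as a Boolean m × m matrix with m about √n. This is put off the diagonal of
a symmetric 2m × 2m matrix, which is interpolated by a symmetric polynomial in two variables, of
degree less than d = 2m in each, over a prime field of order q = poly(m). Such a polynomial is
represented by its restrictions to lines: a crosswise family of univariate polynomials φ_s with
φ_s(t) = φ_t(s) (`exists_crosswise_of_grid`, `Crosswise.eq_of_grid`). A vertex is a triple of
mutually compatible lines, which accounts for q^O(m) vertices. Two vertices are adjacent if all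
their lines are compatible and their triples of points differ.

With α = 1 a community is a clique, so its lines belong to one crosswise family
(`Crosswise.exists_extension`). It has a vertex at every triple of points, since otherwise the
family's vertex there would be outside and tied to everything. Conversely, a vertex outside the set
of triples of a family has a line off the family; that line agrees with fewer than d of the q
members, so the vertex is tied to a fraction of at most (d-1)/q ≤ ε of the set. The three variables
of a clause lie on three lines, so a single triple sees the whole clause. A triple that violates a
clause, or has inadmissible values on the grid, is bad and occurs as two twin vertices. If a family
has a bad triple, one twin is outside and tied to all but one of the members, so there is no
community. Hence communities are exactly satisfying assignments (`TripleGraph.ncard_communities`,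
`ncard_good_families`, `communityCount_reduction`).

For the running time, the adjacency matrix must be written by a stack machine in time poly(|φ| + N).
Functions of a word and of unary numbers that are computable in polynomial time are closed under
composition and polynomially bounded primitive recursion, and predicates under bounded quantifiers.
Adjacency is expressed within this calculus; a machine then writes the matrix letter by letter and
passes it to the counting machine (`exists_machine_comp_wordOf`). The number 1/ε is a power of two
of order log N: it tends to infinity, is easy to compute, and stays below q/(2m). -/

/-! ### Structured programs on Boolean stacks -/

/-- While-programs on stacks of bits, with an additional write-only output stack. -/
inductive Prog : Type
  | nop : Prog
  | push (r : ℕ) (b : Bool) : Prog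
  | pop (r : ℕ) : Prog
  | emit (b : Bool) : Prog
  | seq (p q : Prog) : Prog
  | ite (r : ℕ) (c : Option Bool → Bool) (p q : Prog) : Prog
  | while (r : ℕ) (c : Option Bool → Bool) (p : Prog) : Prog

/-- The stacks of a program: the registers and the output. -/
@[ext] structure PState : Type where
  reg : ℕ → List Bool
  out : List Bool

/-- Replace the contents of a register. -/
def PState.set (s : PState) (r : ℕ) (l : List Bool) : PState :=
  ⟨Function.update s.reg r l, s.out⟩

/-- Big-step semantics: `Ev p s s' t` says that `p` takes the state `s` to `s'` in `t` steps. -/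
inductive Ev : Prog → PState → PState → ℕ → Prop
  | nop (s) : Ev .nop s s 1
  | push (s r b) : Ev (.push r b) s (s.set r (b :: s.reg r)) 1
  | pop (s r) : Ev (.pop r) s (s.set r (s.reg r).tail) 1
  | emit (s b) : Ev (.emit b) s ⟨s.reg, b :: s.out⟩ 1
  | seq {p q s s' s'' t t'} : Ev p s s' t → Ev q s' s'' t' → Ev (.seq p q) s s'' (t + t')
  | ite_true {r c p q s s' t} : c (s.reg r).head? = true → Ev p s s' t →
      Ev (.ite r c p q) s s' (t + 1)
  | ite_false {r c p q s s' t} : c (s.reg r).head? = false → Ev q s s' t →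
      Ev (.ite r c p q) s s' (t + 1)
  | while_false {r c p s} : c (s.reg r).head? = false → Ev (.while r c p) s s 1
  | while_true {r c p s s' s'' t t'} : c (s.reg r).head? = true → Ev p s s' t →
      Ev (.while r c p) s' s'' t' → Ev (.while r c p) s s'' (t + t' + 1)

/-- All registers of the program are at most `R`. -/
def Prog.Within (R : ℕ) : Prog → Prop
  | .nop => True
  | .push r _ => r ≤ R
  | .pop r => r ≤ R
  | .emit _ => True
  | .seq p q => p.Within R ∧ q.Within R
  | .ite r _ p q => r ≤ R ∧ p.Within R ∧ q.Within R
  | .while r _ p => r ≤ R ∧ p.Within R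

theorem Prog.Within.mono {R R' : ℕ} (h : R ≤ R') : ∀ {p : Prog}, p.Within R → p.Within R'
  | .nop, _ => trivial
  | .push _ _, hp => le_trans hp h
  | .pop _, hp => le_trans hp h
  | .emit _, _ => trivial
  | .seq _ _, hp => ⟨hp.1.mono h, hp.2.mono h⟩
  | .ite _ _ _ _, hp => ⟨hp.1.trans h, hp.2.1.mono h, hp.2.2.mono h⟩
  | .while _ _ _, hp => ⟨hp.1.trans h, hp.2.mono h⟩

/-- The control points of a program. -/
def Prog.Label : Prog → Type
  | .nop => Unit
  | .push _ _ => Unit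
  | .pop _ => Unit
  | .emit _ => Unit
  | .seq p q => p.Label ⊕ q.Label
  | .ite _ _ p q => Option (p.Label ⊕ q.Label)
  | .while _ _ p => Option p.Label

/-- The initial control point. -/
def Prog.entry : (p : Prog) → p.Label
  | .nop => ()
  | .push _ _ => ()
  | .pop _ => ()
  | .emit _ => ()
  | .seq p _ => Sum.inl p.entry
  | .ite _ _ _ _ => none
  | .while _ _ _ => none

/-- There are finitely many control points. -/
@[reducible]
def Prog.labelFintype : (p : Prog) → Fintype p.Label
  | .nop => inferInstanceAs (Fintype Unit)
  | .push _ _ => inferInstanceAs (Fintype Unit)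
  | .pop _ => inferInstanceAs (Fintype Unit)
  | .emit _ => inferInstanceAs (Fintype Unit)
  | .seq p q =>
    letI := p.labelFintype; letI := q.labelFintype
    inferInstanceAs (Fintype (p.Label ⊕ q.Label))
  | .ite _ _ p q =>
    letI := p.labelFintype; letI := q.labelFintype
    inferInstanceAs (Fintype (Option (p.Label ⊕ q.Label)))
  | .while _ _ p =>
    letI := p.labelFintype
    inferInstanceAs (Fintype (Option p.Label))

/-! ### Compilation of programs to stack machines, and composition with a given machine. -/

namespace Prefixed

open Turing

variable (M : FinTM2) (e : M.Γ M.k₀ ≃ Bool) (R : ℕ)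

/-- The stack alphabets of the composed machine. -/
abbrev Alph : M.K ⊕ Fin (R + 1) → Type := Sum.elim M.Γ fun _ => Bool

/-- The statement executed at a control point. -/
def code {Λ : Type} : (p : Prog) → (p.Label → Λ) → Λ → p.Label →
    TM2.Stmt (Alph M R) Λ (M.σ × Bool)
  | .nop, _, exit => fun _ => .goto fun _ => exit
  | .push r b, _, exit => fun _ =>
      .push (Sum.inr (Fin.ofNat (R + 1) r)) (fun _ => b) (.goto fun _ => exit)
  | .pop r, _, exit => fun _ =>
      .pop (Sum.inr (Fin.ofNat (R + 1) r)) (fun v _ => v) (.goto fun _ => exit)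
  | .emit b, _, exit => fun _ => .push (Sum.inl M.k₀) (fun _ => e.symm b) (.goto fun _ => exit)
  | .seq p q, emb, exit => fun
      | Sum.inl x => code p (emb ∘ Sum.inl) (emb (Sum.inr q.entry)) x
      | Sum.inr y => code q (emb ∘ Sum.inr) exit y
  | .ite r c p q, emb, exit => fun
      -- The Boolean added to the internal state only carries the outcome of the test to the branch.
      -- It is reset afterwards, so every control point is entered with `false`.
      | none => .peek (Sum.inr (Fin.ofNat (R + 1) r)) (fun v o => (v.1, c o))
          (.branch (fun v => v.2)
            (.load (fun v => (v.1, false)) (.goto fun _ => emb (some (Sum.inl p.entry))))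
            (.load (fun v => (v.1, false)) (.goto fun _ => emb (some (Sum.inr q.entry)))))
      | some (Sum.inl x) => code p (fun z => emb (some (Sum.inl z))) exit x
      | some (Sum.inr y) => code q (fun z => emb (some (Sum.inr z))) exit y
  | .while r c p, emb, exit => fun
      | none => .peek (Sum.inr (Fin.ofNat (R + 1) r)) (fun v o => (v.1, c o))
          (.branch (fun v => v.2)
            (.load (fun v => (v.1, false)) (.goto fun _ => emb (some p.entry)))
            (.load (fun v => (v.1, false)) (.goto fun _ => exit)))
      | some x => code p (fun z => emb (some z)) (emb none) x

/-- A statement of `M` as a statement of the composed machine. -/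
def lift {Λ : Type} (emb : M.Λ → Λ) : TM2.Stmt M.Γ M.Λ M.σ → TM2.Stmt (Alph M R) Λ (M.σ × Bool)
  | .push k f q => .push (Sum.inl k) (fun v => f v.1) (lift emb q)
  | .peek k f q => .peek (Sum.inl k) (fun v o => (f v.1 o, v.2)) (lift emb q)
  | .pop k f q => .pop (Sum.inl k) (fun v o => (f v.1 o, v.2)) (lift emb q)
  | .load f q => .load (fun v => (f v.1, v.2)) (lift emb q)
  | .branch f q₁ q₂ => .branch (fun v => f v.1) (lift emb q₁) (lift emb q₂)
  | .goto f => .goto fun v => emb (f v.1)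
  | .halt => .halt

/-- The machine that runs the program `p` and then `M` on the output of `p`. -/
def machine (p : Prog) : FinTM2 where
  K := M.K ⊕ Fin (R + 1)
  kDecidableEq := letI := M.kDecidableEq; inferInstance
  kFin := letI := M.kFin; inferInstance
  -- The composed machine reads register 0, whereas `emit` pushes on the input stack of `M`. Once
  -- the registers are empty, jumping to `M.main` therefore starts `M` on the emitted word.
  k₀ := Sum.inr 0
  k₁ := Sum.inl M.k₁
  Γ := Alph M R
  Λ := M.Λ ⊕ p.Label
  main := Sum.inr p.entry
  ΛFin := letI := M.ΛFin; letI := p.labelFintype; inferInstance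
  σ := M.σ × Bool
  initialState := (M.initialState, false)
  σFin := letI := M.σFin; inferInstance
  Γk₀Fin := inferInstanceAs (Fintype Bool)
  m := Sum.elim (fun x => lift M R Sum.inl (M.m x))
    (code M e R p Sum.inr (Sum.inl M.main))

variable {M R}

/-- The stacks of the composed machine while the program is running. -/
def stkOf (s : PState) : ∀ k, List (Alph M R k)
  | Sum.inl k => (initList M (s.out.map e.symm)).stk k
  | Sum.inr i => s.reg i

/-- The stacks of the composed machine while `M` is running. -/
def liftStk (S : ∀ k, List (M.Γ k)) : ∀ k, List (Alph M R k)
  | Sum.inl k => S k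
  | Sum.inr _ => []

variable {e}

theorem stkOf_set {s : PState} {r : ℕ} (hr : r ≤ R) (l : List Bool) :
    Function.update (β := fun k => List (Alph M R k)) (stkOf e s)
      (Sum.inr (Fin.ofNat (R + 1) r)) l = stkOf (M := M) (R := R) e (s.set r l) := by
  have key : ∀ i : Fin (R + 1), i = Fin.ofNat (R + 1) r ↔ (i : ℕ) = r := by
    intro i
    rw [Fin.ext_iff]
    simp [Nat.mod_eq_of_lt (Nat.lt_succ_of_le hr)]
  funext k
  rcases k with k | i
  · exact Function.update_of_ne (β := fun k => List (Alph M R k)) (by simp) _ _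
  · by_cases h : (i : ℕ) = r
    · have h' := (key i).2 h
      subst h'
      refine (Function.update_self (β := fun k => List (Alph M R k)) _ _ _).trans ?_
      simp only [stkOf, PState.set]
      rw [h]; simp
    · have h' := fun h' => h ((key i).1 h')
      refine (Function.update_of_ne (β := fun k => List (Alph M R k))
        (by simpa using h') _ _).trans ?_
      simp [stkOf, PState.set, h]

theorem stkOf_reg {s : PState} {r : ℕ} (hr : r ≤ R) :
    stkOf (M := M) (R := R) e s (Sum.inr (Fin.ofNat (R + 1) r)) = s.reg r := by
  simp [stkOf, Nat.mod_eq_of_lt (Nat.lt_succ_of_le hr)]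

theorem stkOf_emit (s : PState) (b : Bool) :
    Function.update (β := fun k => List (Alph M R k)) (stkOf e s) (Sum.inl M.k₀)
      (e.symm b :: stkOf (M := M) (R := R) e s (Sum.inl M.k₀))
      = stkOf (M := M) (R := R) e ⟨s.reg, b :: s.out⟩ := by
  funext k
  rcases k with k | i
  · by_cases h : k = M.k₀
    · subst h
      refine (Function.update_self (β := fun k => List (Alph M R k)) _ _ _).trans ?_
      simp [stkOf, initList]
    · refine (Function.update_of_ne (β := fun k => List (Alph M R k))
        (by simpa using h) _ _).trans ?_
      simp [stkOf, initList, h]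
  · exact Function.update_of_ne (β := fun k => List (Alph M R k)) (by simp) _ _

theorem stepAux_test {Λ : Type} {s : PState} {r : ℕ} (hr : r ≤ R) {c : Option Bool → Bool}
    {b : Bool} (hb : c (s.reg r).head? = b) (v : M.σ) (x y : Λ) :
    TM2.stepAux (.peek (Sum.inr (Fin.ofNat (R + 1) r)) (fun v o => (v.1, c o))
      (.branch (fun v => v.2) (.load (fun v => (v.1, false)) (.goto fun _ => x))
        (.load (fun v => (v.1, false)) (.goto fun _ => y)))) (v, false) (stkOf e s)
      = (⟨some (cond b x y), (v, false), stkOf e s⟩ :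
          TM2.Cfg (Alph M R) Λ (M.σ × Bool)) := by
  have hb' : c (List.head? (α := Bool) (stkOf (M := M) (R := R) e s
      (Sum.inr (Fin.ofNat (R + 1) r)))) = b := by
    rw [stkOf_reg hr]; exact hb
  refine (congrArg (fun b' : Bool => cond b'
    (⟨some x, (v, false), stkOf e s⟩ : TM2.Cfg (Alph M R) Λ (M.σ × Bool))
    ⟨some y, (v, false), stkOf e s⟩) hb').trans ?_
  cases b <;> rfl

/-- `n` steps of the machine with transition function `f` lead from `a` to `b`. -/
def Steps {σ : Type} (f : σ → Option σ) (n : ℕ) (a b : σ) : Prop :=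
  (flip Bind.bind f)^[n] (some a) = some b

theorem Steps.trans {σ : Type} {f : σ → Option σ} {n m : ℕ} {a b c : σ}
    (h : Steps f n a b) (h' : Steps f m b c) : Steps f (n + m) a c := by
  unfold Steps at *
  rw [add_comm, Function.iterate_add_apply, h, h']

theorem Steps.single {σ : Type} {f : σ → Option σ} {a b : σ} (h : f a = some b) :
    Steps f 1 a b := by
  simpa [Steps, flip] using h

theorem Steps.of_eq {σ : Type} {f : σ → Option σ} {n m : ℕ} {a b : σ}
    (h : Steps f n a b) (e : n = m) : Steps f m a b := e ▸ h

variable {Λ : Type} (m : Λ → TM2.Stmt (Alph M R) Λ (M.σ × Bool))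

/-- Induction on the evaluation: each basic instruction and each test costs exactly one machine
step, so big-step times are machine times. The embedding of control points and the exit vary because
subprograms run inside the code of larger ones. -/
theorem steps_code {p : Prog} {s s' : PState} {t : ℕ} (h : Ev p s s' t) (hR : p.Within R)
    (emb : p.Label → Λ) (exit : Λ) (hm : ∀ x, m (emb x) = code M e R p emb exit x) (v : M.σ) :
    Steps (TM2.step m) t ⟨some (emb p.entry), (v, false), stkOf e s⟩
      ⟨some exit, (v, false), stkOf e s'⟩ := by
  have step : ∀ {p : Prog} {emb : p.Label → Λ} {exit : Λ}
      (_ : ∀ x, m (emb x) = code M e R p emb exit x) (x : p.Label) (s : PState)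
      {c : TM2.Cfg (Alph M R) Λ (M.σ × Bool)}
      (_ : TM2.stepAux (code M e R p emb exit x) (v, false) (stkOf e s) = c),
      Steps (TM2.step m) 1 ⟨some (emb x), (v, false), stkOf e s⟩ c := by
    intro p emb exit hm x s c hc
    refine .single ?_
    rw [TM2.step, hm, hc]
  induction h generalizing exit with
  | nop s => exact step hm () s rfl
  | push s r b =>
    refine step hm () s ?_
    rw [← stkOf_set hR, ← stkOf_reg (M := M) (e := e) hR]; rfl
  | pop s r =>
    refine step hm () s ?_
    rw [← stkOf_set hR, ← stkOf_reg (M := M) (e := e) hR]; rfl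
  | emit s b =>
    refine step hm () s ?_
    rw [← stkOf_emit]; rfl
  | seq h₁ h₂ ih₁ ih₂ =>
    exact (ih₁ hR.1 _ _ fun x => hm (Sum.inl x)).trans (ih₂ hR.2 _ _ fun x => hm (Sum.inr x))
  | ite_true hc h₁ ih =>
    exact (Steps.trans (step hm none _ (stepAux_test hR.1 hc _ _ _))
      (ih hR.2.1 _ _ fun x => hm (some (Sum.inl x)))).of_eq (by omega)
  | ite_false hc h₁ ih =>
    exact (Steps.trans (step hm none _ (stepAux_test hR.1 hc _ _ _))
      (ih hR.2.2 _ _ fun x => hm (some (Sum.inr x)))).of_eq (by omega)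
  | while_false hc =>
    exact step hm none _ (stepAux_test hR.1 hc _ _ _)
  | while_true hc h₁ h₂ ih₁ ih₂ =>
    exact (Steps.trans (step hm none _ (stepAux_test hR.1 hc _ _ _))
      ((ih₁ hR.2 _ _ fun x => hm (some x)).trans (ih₂ hR _ _ hm))).of_eq (by omega)

theorem liftStk_update (S : ∀ k, List (M.Γ k)) (k : M.K) (l : List (M.Γ k)) :
    Function.update (liftStk S) (Sum.inl k) l
      = liftStk (R := R) (Function.update S k l) := by
  funext k'
  rcases k' with k' | i
  · by_cases h : k' = k
    · subst h
      exact (Function.update_self (β := fun k => List (Alph M R k)) _ _ _).trans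
        (Function.update_self (β := fun k => List (M.Γ k)) _ _ _).symm
    · exact (Function.update_of_ne (β := fun k => List (Alph M R k)) (by simpa using h) _ _).trans
        (Function.update_of_ne (β := fun k => List (M.Γ k)) h _ _).symm
  · exact Function.update_of_ne (β := fun k => List (Alph M R k)) (by simp) _ _

/-- A configuration of `M` as a configuration of the composed machine. -/
def liftCfg (emb : M.Λ → Λ) (c : M.Cfg) : TM2.Cfg (Alph M R) Λ (M.σ × Bool) :=
  ⟨c.l.map emb, (c.var, false), liftStk c.stk⟩

theorem stepAux_lift (emb : M.Λ → Λ) (q : TM2.Stmt M.Γ M.Λ M.σ) (v : M.σ)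
    (S : ∀ k, List (M.Γ k)) :
    TM2.stepAux (lift M R emb q) (v, false) (liftStk S)
      = liftCfg (R := R) emb (TM2.stepAux q v S) := by
  induction q generalizing v S with
  | push k f q ih =>
    simp only [lift, TM2.stepAux]
    rw [← ih, ← liftStk_update]; rfl
  | peek k f q ih => exact ih _ _
  | pop k f q ih =>
    simp only [lift, TM2.stepAux]
    rw [← ih, ← liftStk_update]; rfl
  | load f q ih => exact ih _ _
  | branch f q₁ q₂ ih₁ ih₂ =>
    simp only [lift, TM2.stepAux]
    cases f v
    · exact ih₂ _ _
    · exact ih₁ _ _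
  | goto f => rfl
  | halt => rfl

theorem steps_lift (emb : M.Λ → Λ) (hm : ∀ x, m (emb x) = lift M R emb (M.m x))
    {n : ℕ} {c c' : M.Cfg} (h : Steps M.step n c c') :
    Steps (TM2.step m) n (liftCfg emb c) (liftCfg emb c') := by
  have one : ∀ c : M.Cfg, TM2.step m (liftCfg emb c) = (M.step c).map (liftCfg emb) := by
    rintro ⟨l, v, S⟩
    cases l with
    | none => rfl
    | some l =>
      change some (TM2.stepAux (m (emb l)) (v, false) (liftStk S)) = _
      rw [hm, stepAux_lift]; rfl
  have gen : ∀ (n : ℕ) (o : Option M.Cfg),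
      (flip Bind.bind (TM2.step m))^[n] (o.map (liftCfg emb))
        = ((flip Bind.bind M.step)^[n] o).map (liftCfg emb) := by
    intro n
    induction n with
    | zero => intro o; rfl
    | succ n ih =>
      intro o
      rw [Function.iterate_succ_apply, Function.iterate_succ_apply, ← ih]
      congr 1
      cases o with
      | none => rfl
      | some c => exact one c
  unfold Steps at *
  have := gen n (some c)
  rw [h] at this
  exact this

/-- A program that computes a word, followed by a machine that processes this word. -/
theorem machine_outputs {p : Prog} (hR : p.Within R) {l w : List Bool} {t : ℕ}
    (h : Ev p ⟨fun r => if r = 0 then l else [], []⟩ ⟨fun _ => [], w⟩ t)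
    {o : List (M.Γ M.k₁)} {t' : ℕ}
    (h' : Nonempty (TM2OutputsInTime M (w.map e.symm) (some o) t')) :
    Nonempty (TM2OutputsInTime (machine M e R p) (id l : List Bool) (some o) (t + t')) := by
  obtain ⟨⟨⟨n, hn⟩, hle⟩⟩ := h'
  have hn' : Steps M.step n (initList M (w.map e.symm)) (haltList M o) := hn
  have h₂ := steps_lift (R := R) (machine M e R p).m Sum.inl (fun x => rfl) hn'
  have h₁ := steps_code (machine M e R p).m h hR Sum.inr (Sum.inl M.main) (fun x => rfl)
    M.initialState
  have h₃ := Steps.trans h₁ h₂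
  refine ⟨⟨⟨t + n, ?_⟩, by simp only at hle ⊢; omega⟩⟩
  have e₂ : initList (machine M e R p) (id l : List Bool)
      = (⟨some (Sum.inr p.entry), (M.initialState, false),
          stkOf e ⟨fun r => if r = 0 then l else [], []⟩⟩ :
        TM2.Cfg (Alph M R) (M.Λ ⊕ p.Label) (M.σ × Bool)) := by
    unfold initList
    congr 1
    funext k
    rcases k with k | i
    · have h₀ : ∀ k, (initList M []).stk k = [] := by
        intro k
        by_cases hk : k = M.k₀
        · subst hk; simp [initList]
        · simp [initList, hk]
      exact (dif_neg (by rintro ⟨⟩)).trans (h₀ k).symm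
    · by_cases hi : i = 0
      · subst hi
        exact dif_pos rfl
      · have h' : (i : ℕ) ≠ 0 := fun h => hi (Fin.ext h)
        refine (dif_neg (fun h => hi (Sum.inr_injective h))).trans ?_
        simp only [stkOf]
        rw [if_neg h']
        rfl
  have e₃ : haltList (machine M e R p) o = liftCfg Sum.inl (haltList M o) := by
    unfold liftCfg haltList
    congr 1
    funext k
    rcases k with k | i
    · by_cases hk : k = M.k₁
      · subst hk
        have h' : (haltList M o).stk M.k₁ = o := dif_pos rfl
        exact (dif_pos rfl).trans h'.symm
      · have h' : (haltList M o).stk k = [] := dif_neg hk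
        exact (dif_neg (fun h => hk (Sum.inl_injective h))).trans h'.symm
    · exact dif_neg (by rintro ⟨⟩)
  rw [e₂]
  change _ = some (haltList (machine M e R p) o)
  rw [e₃]
  exact h₃

end Prefixed

/-! ### Programs that compute numerical functions in unary -/

/-- The program runs from `s` to `s'` in at most `T` steps. -/
def Runs (p : Prog) (s s' : PState) (T : ℕ) : Prop := ∃ t ≤ T, Ev p s s' t

/-- The unary representation of a number. -/
abbrev un (n : ℕ) : List Bool := List.replicate n true

namespace PState

theorem ext_reg {s s' : PState} (h : ∀ r, s.reg r = s'.reg r) (h' : s.out = s'.out) : s = s' :=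
  PState.ext (funext h) h'

@[simp] theorem set_out (s : PState) (r : ℕ) (l : List Bool) : (s.set r l).out = s.out := rfl

theorem set_reg (s : PState) (r : ℕ) (l : List Bool) (r' : ℕ) :
    (s.set r l).reg r' = if r' = r then l else s.reg r' := by
  simp [PState.set, Function.update_apply]

@[simp] theorem set_reg_self (s : PState) (r : ℕ) (l : List Bool) : (s.set r l).reg r = l := by
  simp [set_reg]

theorem set_reg_ne (s : PState) {r r' : ℕ} (l : List Bool) (h : r' ≠ r) :
    (s.set r l).reg r' = s.reg r' := by
  simp [set_reg, h]

@[simp] theorem set_set (s : PState) (r : ℕ) (l l' : List Bool) :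
    (s.set r l).set r l' = s.set r l' :=
  ext_reg (fun r' => by simp only [set_reg]; split_ifs <;> rfl) rfl

theorem set_comm (s : PState) {r r' : ℕ} (l l' : List Bool) (h : r ≠ r') :
    (s.set r l).set r' l' = (s.set r' l').set r l :=
  ext_reg (fun x => by simp only [set_reg]; split_ifs <;> simp_all) rfl

theorem set_eq_self (s : PState) {r : ℕ} {l : List Bool} (h : s.reg r = l) : s.set r l = s :=
  ext_reg (fun x => by simp only [set_reg]; split_ifs <;> simp_all) rfl

end PState

namespace Runs

theorem mono {p s s' T T'} (h : Runs p s s' T) (hT : T ≤ T') : Runs p s s' T' :=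
  let ⟨t, ht, h⟩ := h
  ⟨t, ht.trans hT, h⟩

theorem nop (s) : Runs .nop s s 1 := ⟨1, le_rfl, .nop s⟩

theorem push (s r b) : Runs (.push r b) s (s.set r (b :: s.reg r)) 1 := ⟨1, le_rfl, .push s r b⟩

theorem pop (s r) : Runs (.pop r) s (s.set r (s.reg r).tail) 1 := ⟨1, le_rfl, .pop s r⟩

theorem seq {p q s s' s'' T T'} (h : Runs p s s' T) (h' : Runs q s' s'' T') :
    Runs (.seq p q) s s'' (T + T') :=
  let ⟨t, ht, h⟩ := h
  let ⟨t', ht', h'⟩ := h'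
  ⟨t + t', add_le_add ht ht', .seq h h'⟩

theorem ite_true {r c p q s s' T} (hc : c (s.reg r).head? = true) (h : Runs p s s' T) :
    Runs (.ite r c p q) s s' (T + 1) :=
  let ⟨t, ht, h⟩ := h
  ⟨t + 1, by omega, .ite_true hc h⟩

theorem ite_false {r c p q s s' T} (hc : c (s.reg r).head? = false) (h : Runs q s s' T) :
    Runs (.ite r c p q) s s' (T + 1) :=
  let ⟨t, ht, h⟩ := h
  ⟨t + 1, by omega, .ite_false hc h⟩

theorem while_false {r c p s} (hc : c (s.reg r).head? = false) :
    Runs (.while r c p) s s 1 := ⟨1, le_rfl, .while_false hc⟩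

theorem while_true {r c p s s' s'' T T'} (hc : c (s.reg r).head? = true) (h : Runs p s s' T)
    (h' : Runs (.while r c p) s' s'' T') : Runs (.while r c p) s s'' (T + T' + 1) :=
  let ⟨t, ht, h⟩ := h
  let ⟨t', ht', h'⟩ := h'
  ⟨t + t' + 1, by omega, .while_true hc h h'⟩

/-- A loop that runs until a register is empty. -/
theorem while_family {r : ℕ} {p : Prog} (n : ℕ) (S : ℕ → PState) (T : ℕ → ℕ)
    (hr : ∀ i < n, (S i).reg r ≠ []) (hn : (S n).reg r = [])
    (h : ∀ i < n, Runs p (S i) (S (i + 1)) (T i)) :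
    Runs (.while r Option.isSome p) (S 0) (S n) (∑ i ∈ Finset.range n, (T i + 1) + 1) := by
  induction n generalizing S T with
  | zero => exact while_false (by simp [hn])
  | succ n ih =>
    have h₁ := ih (fun i => S (i + 1)) (fun i => T (i + 1)) (fun i hi => hr _ (by omega)) hn
      (fun i hi => h _ (by omega))
    have h₀ : ((S 0).reg r).head?.isSome = true := by
      have := hr 0 (by omega)
      cases h : (S 0).reg r <;> simp_all
    refine (while_true h₀ (h 0 (by omega)) h₁).mono ?_
    rw [Finset.sum_range_succ']
    omega

end Runs

namespace Prog

/-- Empty a register. -/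
def clear (r : ℕ) : Prog := .while r Option.isSome (.pop r)

/-- Move a unary number. -/
def move (r d : ℕ) : Prog := .while r Option.isSome (.seq (.pop r) (.push d true))

/-- Repeat a program as often as the number in register `r` says; `b` and `b + 1` are auxiliary
registers, and `b` holds the number of remaining rounds. -/
def loop (r b : ℕ) (p : Prog) : Prog :=
  .seq (.while r Option.isSome (.seq (.pop r) (.seq (.push b true) (.push (b + 1) true))))
    (.seq (move (b + 1) r) (.while b Option.isSome (.seq (.pop b) p)))

/-- Run finitely many programs in turn. -/
def seqN : ℕ → (ℕ → Prog) → Prog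
  | 0, _ => .nop
  | n + 1, f => .seq (seqN n f) (f n)

end Prog

namespace Runs

open PState

theorem clear (s : PState) (r : ℕ) :
    Runs (.clear r) s (s.set r []) (2 * (s.reg r).length + 1) := by
  have h := while_family (r := r) (p := .pop r) (s.reg r).length
    (fun i => s.set r ((s.reg r).drop i)) (fun _ => 1)
    (fun i hi => by simpa using hi) (by simp)
    (fun i hi => by
      have := Runs.pop (s.set r ((s.reg r).drop i)) r
      simpa using this)
  simp only [List.drop_zero, List.drop_length] at h
  rw [set_eq_self s rfl] at h
  exact h.mono (by simp; omega)

theorem move (s : PState) {r d n m : ℕ} (hrd : r ≠ d) (hr : s.reg r = un n)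
    (hd : s.reg d = un m) :
    Runs (.move r d) s ((s.set r []).set d (un (m + n))) (3 * n + 1) := by
  have h := while_family (r := r) (p := .seq (.pop r) (.push d true)) n
    (fun i => (s.set r (un (n - i))).set d (un (m + i))) (fun _ => 2)
    (fun i hi => by
      rw [set_reg_ne _ _ hrd, set_reg_self]
      simp; omega) (by rw [set_reg_ne _ _ hrd, set_reg_self]; simp)
    (fun i hi => by
      have h₁ := Runs.pop ((s.set r (un (n - i))).set d (un (m + i))) r
      refine (h₁.seq (Runs.push _ d true)).mono le_rfl |> fun h => ?_
      convert h using 1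
      refine ext_reg (fun x => ?_) rfl
      simp only [set_reg]
      by_cases hx : x = d
      · subst hx; simp [hrd.symm, ← List.replicate_succ, add_assoc]
      · by_cases hx' : x = r
        · subst hx'; simp [hrd]; omega
        · simp [hx, hx'])
  simp only [Nat.sub_zero, add_zero, Nat.sub_self] at h
  rw [set_eq_self s hr, set_eq_self s hd] at h
  exact h.mono (by simp; omega)

/-- The counter is copied to `b` and `b + 1` and restored from `b + 1`, so that `r` survives while
`b` counts down. In round `i` the body finds `n - 1 - i` in `b` and has to preserve it. Copying,
restoring and looping cost `4n + 1`, `3n + 1` and `2n + 1` steps, apart from the bodies. -/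
theorem loop (s : PState) {r b n : ℕ} {p : Prog} (hr : s.reg r = un n) (hrb : r < b)
    (hb : s.reg b = []) (hb' : s.reg (b + 1) = []) (S : ℕ → PState) (T : ℕ → ℕ) (hS : S 0 = s)
    (hSn : (S n).reg b = [])
    (h : ∀ i < n, Runs p ((S i).set b (un (n - 1 - i))) ((S (i + 1)).set b (un (n - 1 - i))) (T i)) :
    Runs (.loop r b p) s (S n) (9 * n + 3 + ∑ i ∈ Finset.range n, T i) := by
  have h₁ := while_family (r := r)
    (p := .seq (.pop r) (.seq (.push b true) (.push (b + 1) true))) n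
    (fun i => ((s.set r (un (n - i))).set b (un i)).set (b + 1) (un i)) (fun _ => 3)
    (fun i hi => by
      rw [set_reg_ne _ _ (by omega), set_reg_ne _ _ (by omega), set_reg_self]
      simp; omega)
    (by rw [set_reg_ne _ _ (by omega), set_reg_ne _ _ (by omega), set_reg_self]; simp)
    (fun i hi => by
      have h₁ := (Runs.pop (((s.set r (un (n - i))).set b (un i)).set (b + 1) (un i)) r).seq
        ((Runs.push _ b true).seq (Runs.push _ (b + 1) true))
      convert h₁ using 1
      refine ext_reg (fun x => ?_) rfl
      have e1 : r ≠ b := by omega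
      have e2 : r ≠ b + 1 := by omega
      simp only [set_reg]
      by_cases hx : x = b + 1
      · subst hx; simp [e2.symm, ← List.replicate_succ]
      · by_cases hx' : x = b
        · subst hx'; simp [e1.symm, ← List.replicate_succ]
        · by_cases hx'' : x = r
          · subst hx''; simp [e1, e2]; omega
          · simp [hx, hx', hx''])
  simp only [Nat.sub_zero, Nat.sub_self] at h₁
  have e0 : ((s.set r (un n)).set b (un 0)).set (b + 1) (un 0) = s := by
    rw [set_eq_self s hr, set_eq_self (l := un 0) s hb, set_eq_self (l := un 0) s hb']
  rw [e0] at h₁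
  have h₂ := Runs.move (((s.set r (un 0)).set b (un n)).set (b + 1) (un n)) (r := b + 1)
    (d := r) (n := n) (m := 0) (by omega) (by simp)
    (by rw [set_reg_ne _ _ (by omega), set_reg_ne _ _ (by omega), set_reg_self])
  have e1 : (((((s.set r (un 0)).set b (un n)).set (b + 1) (un n)).set (b + 1) []).set r
      (un (0 + n))) = s.set b (un n) := by
    refine ext_reg (fun x => ?_) rfl
    simp only [set_reg]
    split_ifs <;> simp_all
  rw [e1] at h₂
  have h₃ := while_family (r := b) (p := .seq (.pop b) p) n
    (fun i => (S i).set b (un (n - i))) (fun i => T i + 1)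
    (fun i hi => by simp; omega) (by simp)
    (fun i hi => by
      have h₁ := Runs.pop ((S i).set b (un (n - i))) b
      have e : (((S i).set b (un (n - i))).set b
          (((S i).set b (un (n - i))).reg b).tail) = (S i).set b (un (n - 1 - i)) := by
        simp only [set_set, set_reg_self, List.tail_replicate]
        congr 2; omega
      rw [e] at h₁
      have h₂ := h₁.seq (h i hi)
      rw [show n - (i + 1) = n - 1 - i by omega]
      exact h₂.mono (by omega))
  simp only [Nat.sub_zero, Nat.sub_self, hS] at h₃
  rw [show (S n).set b (un 0) = S n from set_eq_self _ hSn] at h₃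
  refine (h₁.seq (h₂.seq h₃)).mono ?_
  simp [Finset.sum_add_distrib]
  omega

theorem seqN {n : ℕ} {f : ℕ → Prog} (S : ℕ → PState) (T : ℕ → ℕ)
    (h : ∀ i < n, Runs (f i) (S i) (S (i + 1)) (T i)) :
    Runs (.seqN n f) (S 0) (S n) (1 + ∑ i ∈ Finset.range n, T i) := by
  induction n with
  | zero => exact (Runs.nop _).mono (by simp)
  | succ n ih =>
    refine ((ih fun i hi => h i (by omega)).seq (h n (by omega))).mono ?_
    rw [Finset.sum_range_succ]; omega

end Runs

theorem Prog.Within.loop {R r b : ℕ} {p : Prog} (hr : r ≤ R) (hb : b + 1 ≤ R)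
    (hp : p.Within R) : (Prog.loop r b p).Within R := by
  simp only [Prog.loop, Prog.move, Prog.Within]
  refine ⟨⟨?_, ?_, ?_, ?_⟩, ⟨?_, ?_, ?_⟩, ?_, ?_, ?_⟩ <;> first | assumption | omega

theorem Prog.Within.seqN {R n : ℕ} {f : ℕ → Prog} (h : ∀ i < n, (f i).Within R) :
    (Prog.seqN n f).Within R := by
  induction n with
  | zero => trivial
  | succ n ih => exact ⟨ih fun i hi => h i (by omega), h n (by omega)⟩

theorem Ev.length_le {p s s' t} (h : Ev p s s' t) (r : ℕ) :
    (s'.reg r).length ≤ (s.reg r).length + t := by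
  induction h with
  | nop s => omega
  | push s r' b =>
    simp only [PState.set_reg]; split_ifs with h
    · subst h; simp
    · omega
  | pop s r' =>
    simp only [PState.set_reg]; split_ifs with h
    · subst h; simp; omega
    · omega
  | emit s b => simp
  | seq _ _ _ _ => omega
  | ite_true _ _ _ => omega
  | ite_false _ _ _ => omega
  | while_false _ => omega
  | while_true _ _ _ _ _ => omega

/-- The register conventions for computing a function: the input word is in register `0`, register
`1` is empty, the arguments are in the registers `a i`, and the result is to be put into the empty
register `d`; the registers from `b` on are free. -/
structure Frame {k : ℕ} (l : List Bool) (v : Fin k → ℕ) (a : Fin k → ℕ) (d b : ℕ) (s : PState) :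
    Prop where
  reg_zero : s.reg 0 = l
  reg_one : s.reg 1 = []
  two_le : ∀ i, 2 ≤ a i
  two_le_d : 2 ≤ d
  lt : ∀ i, a i < b
  d_lt : d < b
  ne : ∀ i, a i ≠ d
  reg_arg : ∀ i, s.reg (a i) = un (v i)
  reg_d : s.reg d = []
  reg_free : ∀ r, b ≤ r → s.reg r = []

/-- The function `f` of a word and `k` numbers is computed by a program in time `T`. -/
def Computes {k : ℕ} (f T : List Bool → (Fin k → ℕ) → ℕ) : Prop :=
  ∃ (code : (Fin k → ℕ) → ℕ → ℕ → Prog) (W : ℕ),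
    (∀ a d b, (∀ i, a i < b) → d < b → (code a d b).Within (b + W)) ∧
    ∀ l v a d b s, Frame l v a d b s → Runs (code a d b) s (s.set d (un (f l v))) (T l v)

namespace Computes

open PState

variable {k : ℕ} {f T : List Bool → (Fin k → ℕ) → ℕ}

theorem mono {T' : List Bool → (Fin k → ℕ) → ℕ} (h : Computes f T)
    (hT : ∀ l v, T l v ≤ T' l v) : Computes f T' := by
  obtain ⟨c, W, h₁, h₂⟩ := h
  exact ⟨c, W, h₁, fun l v a d b s h => (h₂ l v a d b s h).mono (hT l v)⟩

theorem exists_frame (l : List Bool) (v : Fin k → ℕ) : ∃ a d b s, Frame l v a d b s := by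
  classical
  refine ⟨fun i => 2 + i, 2 + k, 3 + k, ⟨fun r => if r = 0 then l else
    if h : 2 ≤ r ∧ r < 2 + k then un (v ⟨r - 2, by omega⟩) else [], []⟩, ?_⟩
  constructor
  · simp
  · simp
  · intro i; simp
  · omega
  · intro i; omega
  · omega
  · intro i; omega
  · intro i
    simp
  · simp
  · intro r hr
    exact (if_neg (by omega)).trans (dif_neg (by omega))

/-- The result is written in unary into an empty register, and a step lengthens a register by at
most one bit. Thus every time bound is also a bound on the value. -/
theorem le_time (h : Computes f T) (l : List Bool) (v : Fin k → ℕ) : f l v ≤ T l v := by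
  obtain ⟨c, W, -, h⟩ := h
  obtain ⟨a, d, b, s, hs⟩ := exists_frame l v
  obtain ⟨t, ht, h⟩ := h l v a d b s hs
  have := h.length_le d
  simp [hs.reg_d] at this
  omega

theorem zero : Computes (k := k) (fun _ _ => 0) (fun _ _ => 1) :=
  ⟨fun _ _ _ => .nop, 0, fun _ _ _ _ _ => trivial, fun l v a d b s h => by
    have e : s.set d (un 0) = s := set_eq_self s h.reg_d
    exact (congrArg (Runs .nop s · 1) e).mpr (Runs.nop s)⟩

theorem succ (h : Computes f T) : Computes (fun l v => f l v + 1) (fun l v => T l v + 1) := by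
  obtain ⟨c, W, h₁, h₂⟩ := h
  refine ⟨fun a d b => .seq (c a d b) (.push d true), W,
    fun a d b ha hd => ⟨h₁ a d b ha hd, by change d ≤ b + W; omega⟩, fun l v a d b s h => ?_⟩
  have := (h₂ l v a d b s h).seq (Runs.push _ d true)
  simpa [← List.replicate_succ] using this

theorem proj (i : Fin k) : Computes (fun _ v => v i) (fun _ v => 10 * v i + 3) := by
  refine ⟨fun a d b => .loop (a i) b (.push d true), 1, fun a d b ha hd =>
    Prog.Within.loop (by have := ha i; omega) le_rfl (by change d ≤ b + 1; omega),
    fun l v a d b s h => ?_⟩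
  have hd := h.d_lt
  refine (Runs.loop s (h.reg_arg i) (h.lt i) (h.reg_free _ le_rfl) (h.reg_free _ (by omega))
    (fun i => s.set d (un i)) (fun _ => 1) (set_eq_self s h.reg_d)
    ((set_reg_ne _ _ (by omega)).trans (h.reg_free _ le_rfl)) fun j hj => ?_).mono ?_
  · have := Runs.push ((s.set d (un j)).set b (un (v i - 1 - j))) d true
    convert this using 1
    refine ext_reg (fun x => ?_) rfl
    have hdb : d ≠ b := by omega
    simp only [set_reg]
    split_ifs <;> simp_all [List.replicate_succ]
  · simp; omega

/-- The inner values go to the registers `b, …, b + m - 1`, the outer function works on these with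
its free region starting at `b + m`, and finally they are emptied to restore the register
conventions. `S j` is the state after `j` inner values have been computed, `S' j` the state after
`j` of them have been erased. -/
theorem comp {m : ℕ} {f T : List Bool → (Fin m → ℕ) → ℕ}
    {g Tg : Fin m → List Bool → (Fin k → ℕ) → ℕ} (hf : Computes f T)
    (hg : ∀ j, Computes (g j) (Tg j)) :
    Computes (fun l v => f l (fun j => g j l v))
      (fun l v => T l (fun j => g j l v) + ∑ j, (Tg j l v + 2 * g j l v + 1) + 2) := by
  obtain ⟨cf, Wf, hf₁, hf₂⟩ := hf
  choose cg Wg hg₁ hg₂ using hg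
  refine ⟨fun a d b => .seq (.seqN m fun j => if h : j < m then cg ⟨j, h⟩ a (b + j) (b + m)
      else .nop) (.seq (cf (fun j => b + j) d (b + m)) (.seqN m fun j => .clear (b + j))),
    m + Wf + ∑ j, Wg j, fun a d b ha hd => ?_, fun l v a d b s h => ?_⟩
  · refine ⟨Prog.Within.seqN fun j hj => ?_, ?_, Prog.Within.seqN fun j hj => ?_⟩
    · rw [dif_pos hj]
      refine (hg₁ ⟨j, hj⟩ a (b + j) (b + m) (fun i => by have := ha i; omega) (by omega)).mono ?_
      have := Finset.single_le_sum (f := Wg) (fun _ _ => Nat.zero_le _)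
        (Finset.mem_univ (⟨j, hj⟩ : Fin m))
      omega
    · refine (hf₁ (fun j => b + j) d (b + m) (fun i => by omega) (by omega)).mono (by omega)
    · simp only [Prog.clear, Prog.Within]
      omega
  · have hd := h.d_lt
    have hd2 := h.two_le_d
    let G : ℕ → ℕ := fun j => if h : j < m then g ⟨j, h⟩ l v else 0
    let S : ℕ → PState := fun j => ⟨fun r => if b ≤ r ∧ r < b + j then un (G (r - b))
      else s.reg r, s.out⟩
    have hS0 : S 0 = s := ext_reg (fun r => if_neg (by omega)) rfl
    have h₁ := Runs.seqN (n := m)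
      (f := fun j => if h : j < m then cg ⟨j, h⟩ a (b + j) (b + m) else .nop) S
      (fun j => if h : j < m then Tg ⟨j, h⟩ l v else 0) (fun j hj => by
        rw [dif_pos hj, dif_pos hj]
        have hF : Frame l v a (b + j) (b + m) (S j) := by
          constructor
          · exact (if_neg (by omega)).trans h.reg_zero
          · exact (if_neg (by omega)).trans h.reg_one
          · exact h.two_le
          · omega
          · intro i; have := h.lt i; omega
          · omega
          · intro i; have := h.lt i; omega
          · intro i
            have := h.lt i
            exact (if_neg (by omega)).trans (h.reg_arg i)
          · exact (if_neg (by omega)).trans (h.reg_free _ (by omega))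
          · intro r hr
            exact (if_neg (by omega)).trans (h.reg_free _ (by omega))
        have := hg₂ ⟨j, hj⟩ l v a _ _ _ hF
        convert this using 1
        refine ext_reg (fun r => ?_) rfl
        rw [set_reg]
        by_cases hr : r = b + j
        · subst hr
          simp [S, G, hj]
        · rw [if_neg hr]
          simp only [S]
          congr 1
          apply propext
          constructor <;> intro <;> omega)
    rw [hS0] at h₁
    have hF : Frame l (fun j => g j l v) (fun j : Fin m => b + j) d (b + m) (S m) := by
      constructor
      · exact (if_neg (by omega)).trans h.reg_zero
      · exact (if_neg (by omega)).trans h.reg_one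
      · intro i; omega
      · omega
      · intro i; omega
      · omega
      · intro i; omega
      · intro i
        simp [S, G]
      · exact (if_neg (by omega)).trans h.reg_d
      · intro r hr
        exact (if_neg (by omega)).trans (h.reg_free _ (by omega))
    have h₂ := hf₂ l _ _ _ _ _ hF
    let S' : ℕ → PState := fun j => ⟨fun r => if b + j ≤ r ∧ r < b + m then un (G (r - b))
      else if r = d then un (f l fun j => g j l v) else s.reg r, s.out⟩
    have e₁ : (S m).set d (un (f l fun j => g j l v)) = S' 0 := by
      refine ext_reg (fun r => ?_) rfl
      rw [set_reg]
      simp only [S, S', add_zero]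
      by_cases hr : r = d
      · rw [if_pos hr, if_neg (by omega), if_pos hr]
      · simp [hr]
    have e₂ : S' m = s.set d (un (f l fun j => g j l v)) := by
      refine ext_reg (fun r => ?_) rfl
      rw [set_reg]
      exact if_neg (by omega)
    have h₃ := Runs.seqN (n := m) (f := fun j => .clear (b + j)) S'
      (fun j => if h : j < m then 2 * g ⟨j, h⟩ l v + 1 else 0) (fun j hj => by
        rw [dif_pos hj]
        have := Runs.clear (S' j) (b + j)
        have e : (S' j).reg (b + j) = un (g ⟨j, hj⟩ l v) := by
          simp [S', G, hj]
        rw [e] at this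
        simp only [List.length_replicate] at this
        convert this using 1
        refine ext_reg (fun r => ?_) rfl
        rw [set_reg]
        by_cases hr : r = b + j
        · subst hr
          rw [if_pos rfl]
          refine (if_neg (by omega)).trans ((if_neg (by omega)).trans (h.reg_free _ (by omega)))
        · rw [if_neg hr]
          simp only [S']
          congr 1
          apply propext
          constructor <;> intro <;> omega)
    rw [e₂, ← e₁] at h₃
    refine (h₁.seq (h₂.seq h₃)).mono ?_
    rw [Finset.sum_range, Finset.sum_range]
    simp only [Fin.is_lt, dite_true, Fin.eta, Finset.sum_add_distrib]
    omega

/-- Primitive recursion; the argument `0` is the recursion variable. -/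
theorem prec {g Tg : List Bool → (Fin k → ℕ) → ℕ} {h Th : List Bool → (Fin (k + 2) → ℕ) → ℕ}
    (hg : Computes g Tg) (hh : Computes h Th) (F : List Bool → ℕ → (Fin k → ℕ) → ℕ)
    (F0 : ∀ l v, F l 0 v = g l v)
    (Fs : ∀ l i v, F l (i + 1) v = h l (Fin.cons i (Fin.cons (F l i v) v))) :
    Computes (k := k + 1) (fun l v => F l (v 0) (Fin.tail v))
      (fun l v => Tg l (Fin.tail v) + (9 * v 0 + 3 + ∑ i ∈ Finset.range (v 0),
        (Th l (Fin.cons i (Fin.cons (F l i (Fin.tail v)) (Fin.tail v))) +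
          2 * F l i (Fin.tail v) + 3 * F l (i + 1) (Fin.tail v) + 3)) +
        3 * F l (v 0) (Fin.tail v) + 2 * v 0 + 2) := by
  obtain ⟨cg, Wg, hg₁, hg₂⟩ := hg
  obtain ⟨ch, Wh, hh₁, hh₂⟩ := hh
  -- Register `b` holds the current value of the recursion, `b + 1` the index of the round, and `b +
  -- 2` receives the next value. The loop uses `b + 3` and `b + 4`, so the free region starts at `b
  -- + 5`.
  refine ⟨fun a d b => .seq (cg (Fin.tail a) b (b + 5)) (.seq (.loop (a 0) (b + 3)
    (.seq (ch (Fin.cons (b + 1) (Fin.cons b (Fin.tail a))) (b + 2) (b + 5))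
      (.seq (.clear b) (.seq (.move (b + 2) b) (.push (b + 1) true)))))
    (.seq (.move b d) (.clear (b + 1)))), 5 + Wg + Wh, fun a d b ha hd => ?_,
    fun l v a d b s hF => ?_⟩
  · refine ⟨(hg₁ _ _ _ (fun i => ?_) (by omega)).mono (by omega), Prog.Within.loop ?_ (by omega)
      ⟨(hh₁ _ _ _ (fun i => ?_) (by omega)).mono (by omega), ?_⟩, ?_⟩
    · have := ha i.succ
      simp only [Fin.tail]; omega
    · have := ha 0; omega
    · refine Fin.cases ?_ (fun i => Fin.cases ?_ (fun i => ?_) i) i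
      · simp
      · simp
      · have := ha i.succ
        simp only [Fin.cons_succ, Fin.tail]; omega
    · simp only [Prog.clear, Prog.move, Prog.Within]; omega
    · simp only [Prog.clear, Prog.move, Prog.Within]; omega
  · have hd := hF.d_lt
    have hd2 := hF.two_le_d
    set w := Fin.tail v with hw
    set A : ℕ → ℕ := fun i => F l i w with hA
    let S : ℕ → PState := fun i => (s.set b (un (A i))).set (b + 1) (un i)
    have h₁ := hg₂ l w (Fin.tail a) b (b + 5) s (by
      constructor
      · exact hF.reg_zero
      · exact hF.reg_one
      · exact fun i => hF.two_le _
      · omega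
      · intro i; have := hF.lt i.succ; simp only [Fin.tail]; omega
      · omega
      · intro i; have := hF.lt i.succ; simp only [Fin.tail]; omega
      · intro i; exact hF.reg_arg _
      · exact hF.reg_free _ le_rfl
      · intro r hr; exact hF.reg_free _ (by omega))
    have hS0 : S 0 = s.set b (un (g l w)) := by
      have e : (s.set b (un (A 0))).reg (b + 1) = un 0 :=
        (set_reg_ne _ _ (by omega)).trans (hF.reg_free _ (by omega))
      simp only [S]
      rw [set_eq_self _ e, hA]
      simp only [F0]
    rw [← hS0] at h₁
    have ha0 := hF.lt 0
    have Sreg : ∀ i r, (S i).reg r = if r = b + 1 then un i else if r = b then un (A i) else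
        s.reg r := by
      intro i r; simp only [S, set_reg]
    have h₂ := Runs.loop (S 0) (r := a 0) (b := b + 3) (n := v 0)
      (p := (.seq (ch (Fin.cons (b + 1) (Fin.cons b (Fin.tail a))) (b + 2) (b + 5))
        (.seq (.clear b) (.seq (.move (b + 2) b) (.push (b + 1) true)))))
      (by rw [Sreg, if_neg (by omega), if_neg (by omega)]; exact hF.reg_arg 0) (by omega)
      (by rw [Sreg, if_neg (by omega), if_neg (by omega)]; exact hF.reg_free _ (by omega))
      (by rw [Sreg, if_neg (by omega), if_neg (by omega)]; exact hF.reg_free _ (by omega))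
      S (fun i => Th l (Fin.cons i (Fin.cons (A i) w)) + 2 * A i + 3 * A (i + 1) + 3) rfl
      (by rw [Sreg, if_neg (by omega), if_neg (by omega)]; exact hF.reg_free _ (by omega))
      (fun i hi => by
        set c := un (v 0 - 1 - i)
        have hF' : Frame l (Fin.cons i (Fin.cons (A i) w) : Fin (k + 2) → ℕ)
            (Fin.cons (b + 1) (Fin.cons b (Fin.tail a))) (b + 2) (b + 5)
            ((S i).set (b + 3) c) := by
          constructor
          · rw [set_reg_ne _ _ (by omega), Sreg, if_neg (by omega), if_neg (by omega)]
            exact hF.reg_zero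
          · rw [set_reg_ne _ _ (by omega), Sreg, if_neg (by omega), if_neg (by omega)]
            exact hF.reg_one
          · refine Fin.cases ?_ (Fin.cases ?_ (fun i => ?_))
            · simp; omega
            · simp; omega
            · exact hF.two_le _
          · omega
          · refine Fin.cases ?_ (Fin.cases ?_ (fun i => ?_))
            · simp
            · simp
            · have := hF.lt i.succ; simp only [Fin.cons_succ, Fin.tail]; omega
          · omega
          · refine Fin.cases ?_ (Fin.cases ?_ (fun i => ?_))
            · simp
            · simp
            · have := hF.lt i.succ; simp only [Fin.cons_succ, Fin.tail]; omega
          · refine Fin.cases ?_ (Fin.cases ?_ (fun j => ?_))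
            · simp only [Fin.cons_zero]
              rw [set_reg_ne _ _ (by omega), Sreg, if_pos rfl]
            · simp only [Fin.cons_succ, Fin.cons_zero]
              rw [set_reg_ne _ _ (by omega), Sreg, if_neg (by omega), if_pos rfl]
            · have := hF.lt j.succ
              simp only [Fin.cons_succ, Fin.tail]
              rw [set_reg_ne _ _ (by omega), Sreg, if_neg (by omega), if_neg (by omega)]
              exact hF.reg_arg _
          · rw [set_reg_ne _ _ (by omega), Sreg, if_neg (by omega), if_neg (by omega)]
            exact hF.reg_free _ (by omega)
          · intro r hr
            rw [set_reg_ne _ _ (by omega), Sreg, if_neg (by omega), if_neg (by omega)]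
            exact hF.reg_free _ (by omega)
        have r₁ := hh₂ _ _ _ _ _ _ hF'
        rw [← Fs] at r₁
        have r₂ := Runs.clear (((S i).set (b + 3) c).set (b + 2) (un (A (i + 1)))) b
        have r₃ := Runs.move ((((S i).set (b + 3) c).set (b + 2) (un (A (i + 1)))).set b [])
          (r := b + 2) (d := b) (n := A (i + 1)) (m := 0) (by omega)
          (by rw [set_reg_ne _ _ (by omega), set_reg_self]) (by rw [set_reg_self]; rfl)
        have r₄ := r₁.seq (r₂.seq (r₃.seq (Runs.push _ (b + 1) true)))
        have e : (((((((S i).set (b + 3) c).set (b + 2) (un (A (i + 1)))).set b []).set (b + 2)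
            []).set b (un (0 + A (i + 1)))).set (b + 1) (true :: ((((((S i).set (b + 3) c).set
              (b + 2) (un (A (i + 1)))).set b []).set (b + 2) []).set b
                (un (0 + A (i + 1)))).reg (b + 1))) = (S (i + 1)).set (b + 3) c := by
          have hb2 := hF.reg_free (b + 2) (by omega)
          refine ext_reg (fun r => ?_) rfl
          simp only [set_reg, Sreg]
          by_cases q0 : r = b
          · subst q0; simp
          by_cases q1 : r = b + 1
          · subst q1; simp [List.replicate_succ]
          by_cases q2 : r = b + 2
          · subst q2; simp [hb2]
          simp [q0, q1, q2]
        rw [e] at r₄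
        have e' : ((((S i).set (b + 3) c).set (b + 2) (un (A (i + 1)))).reg b).length = A i := by
          rw [set_reg_ne _ _ (by omega), set_reg_ne _ _ (by omega), Sreg, if_neg (by omega),
            if_pos rfl]
          simp
        rw [e'] at r₄
        exact r₄.mono (by omega))
    have h₃ := Runs.move (S (v 0)) (r := b) (d := d) (n := A (v 0)) (m := 0) (by omega)
      (by rw [Sreg, if_neg (by omega), if_pos rfl])
      (by rw [Sreg, if_neg (by omega), if_neg (by omega)]; exact hF.reg_d)
    have h₄ := Runs.clear (((S (v 0)).set b []).set d (un (0 + A (v 0)))) (b + 1)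
    have e : (((S (v 0)).set b []).set d (un (0 + A (v 0)))).reg (b + 1) = un (v 0) := by
      rw [set_reg_ne _ _ (by omega), set_reg_ne _ _ (by omega), Sreg, if_pos rfl]
    rw [e] at h₄
    have e' : (((S (v 0)).set b []).set d (un (0 + A (v 0)))).set (b + 1) []
        = s.set d (un (A (v 0))) := by
      have hb0 := hF.reg_free b le_rfl
      have hb1 := hF.reg_free (b + 1) (by omega)
      refine ext_reg (fun r => ?_) rfl
      simp only [set_reg, Sreg]
      by_cases q0 : r = b
      · subst q0; simp [hb0, hd.ne']
      by_cases q1 : r = b + 1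
      · subst q1; simp [hb1, show b + 1 ≠ d by omega]
      simp [q0, q1]
    rw [e'] at h₄
    refine (h₁.seq (h₂.seq (h₃.seq h₄))).mono ?_
    simp only [List.length_replicate, ← hw, hA]
    omega

end Computes

/-! ### Reading the input word: registers 0 and 1 as the two halves of a tape. -/

namespace Prog

/-- Advance the input word by one letter. -/
def advance : Prog :=
  .ite 0 (· == some true) (.seq (.pop 0) (.push 1 true))
    (.ite 0 (· == some false) (.seq (.pop 0) (.push 1 false)) .nop)

/-- Rewind the input word. -/
def rewind : Prog :=
  .while 1 Option.isSome (.ite 1 (· == some true) (.seq (.pop 1) (.push 0 true))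
    (.seq (.pop 1) (.push 0 false)))

end Prog

namespace Runs

open PState

/-- The state in which the input word has been advanced by `i` letters. -/
def _root_.PState.at (s : PState) (l : List Bool) (i : ℕ) : PState :=
  (s.set 0 (l.drop i)).set 1 (l.take i).reverse

/-- Past the end the program does nothing, and `take` and `drop` saturate as well, so no bound on
`i` is needed. -/
theorem advance (s : PState) (l : List Bool) (i : ℕ) :
    Runs .advance (s.at l i) (s.at l (i + 1)) 4 := by
  have h0 : (s.at l i).reg 0 = l.drop i := by simp [PState.at, set_reg]
  have h1 : (s.at l i).reg 1 = (l.take i).reverse := by simp [PState.at]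
  have step : ∀ b, l[i]? = some b → Runs (.seq (.pop 0) (.push 1 b)) (s.at l i)
      (s.at l (i + 1)) 2 := by
    intro b hb
    have := (Runs.pop (s.at l i) 0).seq (Runs.push _ 1 b)
    convert this using 1
    refine ext_reg (fun r => ?_) rfl
    simp only [set_reg, PState.at]
    by_cases q1 : r = 1
    · subst q1; simp [List.take_add_one, hb]
    by_cases q0 : r = 0
    · subst q0; simp
    simp [q0, q1]
  unfold Prog.advance
  have hh : ((s.at l i).reg 0).head? = l[i]? := by rw [h0]; simp
  rcases hl : l[i]? with - | b
  · have e : s.at l (i + 1) = s.at l i := by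
      have hle : l.length ≤ i := by simpa using hl
      simp only [PState.at]
      rw [List.drop_eq_nil_of_le hle, List.drop_eq_nil_of_le (by omega), List.take_of_length_le hle,
        List.take_of_length_le (by omega)]
    rw [e]
    exact (ite_false (by rw [hh, hl]; rfl) (ite_false (by rw [hh, hl]; rfl) (Runs.nop _))).mono
      (by omega)
  · cases b with
    | true => exact (ite_true (by rw [hh, hl]; rfl) (step _ hl)).mono (by omega)
    | false =>
      exact ite_false (by rw [hh, hl]; rfl) (ite_true (by rw [hh, hl]; rfl) (step _ hl))

theorem rewind (s : PState) (l : List Bool) {n : ℕ} (hn : n ≤ l.length) :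
    Runs .rewind (s.at l n) (s.at l 0) (4 * n + 1) := by
  have := while_family (r := 1) (p := .ite 1 (· == some true) (.seq (.pop 1) (.push 0 true))
    (.seq (.pop 1) (.push 0 false))) n (fun i => s.at l (n - i)) (fun _ => 3)
    (fun i hi => by
      have hl : l ≠ [] := by rintro rfl; simp at hn; omega
      simp [PState.at, hl]; omega) (by simp [PState.at]) (fun i hi => by
      obtain ⟨j, hj⟩ : ∃ j, n - i = j + 1 := ⟨n - i - 1, by omega⟩
      have hj' : n - (i + 1) = j := by omega
      have hjl : j < l.length := by omega
      rw [hj, hj']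
      have h0 : (s.at l (j + 1)).reg 0 = l.drop (j + 1) := by simp [PState.at, set_reg]
      have h1 : (s.at l (j + 1)).reg 1 = l[j] :: (l.take j).reverse := by
        simp only [PState.at, set_reg_self]
        rw [← List.take_append_getElem hjl]
        simp
      have step : ∀ b, l[j] = b → Runs (.seq (.pop 1) (.push 0 b)) (s.at l (j + 1))
          (s.at l j) 2 := by
        intro b hb
        have := (Runs.pop (s.at l (j + 1)) 1).seq (Runs.push _ 0 b)
        convert this using 1
        refine ext_reg (fun r => ?_) rfl
        have e : l.drop j = b :: l.drop (j + 1) := by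
          rw [← hb]; exact List.drop_eq_getElem_cons hjl
        simp only [set_reg, h0, h1]
        simp only [PState.at, set_reg]
        by_cases q1 : r = 1
        · subst q1; simp
        by_cases q0 : r = 0
        · subst q0; simpa using e
        simp [q0, q1]
      cases hb : l[j] with
      | true => exact ite_true (by simp [h1, hb]) (step _ hb)
      | false => exact ite_false (by simp [h1, hb]) (step _ hb))
  simp only [Nat.sub_zero, Nat.sub_self] at this
  exact this.mono (by simp; omega)

end Runs

theorem PState.at_zero {s : PState} {l : List Bool} (h0 : s.reg 0 = l) (h1 : s.reg 1 = []) :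
    s.at l 0 = s := by
  have e : s.set 0 (l.drop 0) = s := set_eq_self s (by simpa using h0)
  rw [PState.at, e]
  exact set_eq_self s (by simpa using h1)

/-- The letter of a word at a position: `0` beyond the end, `1` for `false` and `2` for `true`. -/
def letter (l : List Bool) (i : ℕ) : ℕ :=
  match l[i]? with
  | none => 0
  | some false => 1
  | some true => 2

namespace Computes

open PState

theorem length : Computes (k := 0) (fun l _ => l.length) (fun l _ => 11 * l.length + 2) := by
  refine ⟨fun _ d _ => .seq (.while 0 Option.isSome (.seq .advance (.push d true))) .rewind, 0,
    fun a d b ha hd => by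
      simp only [Prog.advance, Prog.rewind, Prog.Within, and_true]; omega, fun l v a d b s hF => ?_⟩
  have hd2 := hF.two_le_d
  have h₁ := Runs.while_family (r := 0) (p := .seq .advance (.push d true)) l.length
    (fun i => (s.set d (un i)).at l i) (fun _ => 5)
    (fun i hi => by simp [PState.at, set_reg]; omega) (by simp [PState.at, set_reg]) (fun i hi => by
      have := (Runs.advance (s.set d (un i)) l i).seq (Runs.push _ d true)
      convert this using 1
      refine ext_reg (fun r => ?_) rfl
      simp only [PState.at, set_reg]
      by_cases q1 : r = 1
      · subst q1; simp [show 1 ≠ d by omega]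
      by_cases q0 : r = 0
      · subst q0; simp [show 0 ≠ d by omega]
      by_cases qd : r = d
      · subst qd; simp [List.replicate_succ, q0, q1]
      simp [q0, q1, qd])
  have e : s.set d (un 0) = s := set_eq_self s hF.reg_d
  have h₂ := Runs.rewind (s.set d (un l.length)) l le_rfl
  rw [at_zero ((set_reg_ne _ _ (by omega)).trans hF.reg_zero)
    ((set_reg_ne _ _ (by omega)).trans hF.reg_one)] at h₂
  simp only [e] at h₁
  rw [at_zero hF.reg_zero hF.reg_one] at h₁
  exact (h₁.seq h₂).mono (by simp; omega)

theorem letter : Computes (k := 1) (fun l v => letter l (v 0)) (fun _ v => 17 * v 0 + 10) := by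
  refine ⟨fun a d b => .seq (.loop (a 0) b .advance) (.seq (.ite 0 (· == some true)
    (.seq (.push d true) (.push d true)) (.ite 0 (· == some false) (.push d true) .nop)) .rewind),
    1, fun a d b ha hd => ⟨Prog.Within.loop (by have := ha 0; omega) le_rfl
      (by simp only [Prog.advance, Prog.Within, and_true]; omega), by
      simp only [Prog.rewind, Prog.Within, and_true]; omega⟩, fun l v a d b s hF => ?_⟩
  have hd2 := hF.two_le_d
  have hdb := hF.d_lt
  have hb := hF.reg_free b le_rfl
  have h₁ := Runs.loop s (r := a 0) (b := b) (n := v 0) (p := .advance) (hF.reg_arg 0) (hF.lt 0)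
    hb (hF.reg_free _ (by omega)) (fun i => s.at l i) (fun _ => 4)
    (at_zero hF.reg_zero hF.reg_one)
    (by simp [PState.at, set_reg, show b ≠ 0 by omega, show b ≠ 1 by omega, hb])
    (fun i hi => by
      have e : ∀ j, (s.at l j).set b (un (v 0 - 1 - i)) = (s.set b (un (v 0 - 1 - i))).at l j := by
        intro j
        simp only [PState.at]
        rw [set_comm _ _ _ (show 1 ≠ b by omega), set_comm _ _ _ (show 0 ≠ b by omega)]
      rw [e, e]
      exact Runs.advance _ _ _)
  -- Rewinding starts from a position inside the word, so a position beyond the end is replaced by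
  -- the end.
  have e₁ : s.at l (v 0) = s.at l (min (v 0) l.length) := by
    rcases le_total (v 0) l.length with h | h
    · rw [min_eq_left h]
    · rw [min_eq_right h]
      simp only [PState.at]
      rw [List.drop_eq_nil_of_le h, List.take_of_length_le h, List.drop_length, List.take_length]
  have hd0 : (s.at l (v 0)).reg d = [] := by
    simp [PState.at, set_reg, show d ≠ 0 by omega, show d ≠ 1 by omega, hF.reg_d]
  have h₂ : Runs (.ite 0 (· == some true)
      (.seq (.push d true) (.push d true)) (.ite 0 (· == some false) (.push d true) .nop))
      (s.at l (v 0)) ((s.at l (v 0)).set d (un (_root_.letter l (v 0)))) 3 := by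
    have hh : ((s.at l (v 0)).reg 0).head? = l[v 0]? := by simp [PState.at, set_reg]
    unfold _root_.letter
    rcases hl : l[v 0]? with - | c
    · refine (Runs.ite_false (by rw [hh, hl]; rfl)
        (Runs.ite_false (s' := (s.at l (v 0)).set d (un 0)) (by rw [hh, hl]; rfl) ?_))
      have e : (s.at l (v 0)).set d (un 0) = s.at l (v 0) := set_eq_self _ hd0
      rw [e]
      exact Runs.nop _
    · cases c with
      | true =>
        refine Runs.ite_true (by rw [hh, hl]; rfl) ?_
        have := (Runs.push (s.at l (v 0)) d true).seq (Runs.push _ d true)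
        rw [set_reg_self, set_set, hd0] at this
        exact this
      | false =>
        refine Runs.ite_false (by rw [hh, hl]; rfl) (Runs.ite_true (by rw [hh, hl]; rfl) ?_)
        have := Runs.push (s.at l (v 0)) d true
        rw [hd0] at this
        exact this
  have e₂ : (s.at l (v 0)).set d (un (_root_.letter l (v 0)))
      = (s.set d (un (_root_.letter l (v 0)))).at l (min (v 0) l.length) := by
    rw [e₁]
    simp only [PState.at]
    rw [set_comm _ _ _ (show 1 ≠ d by omega), set_comm _ _ _ (show 0 ≠ d by omega)]
  rw [e₂] at h₂
  have h₃ := Runs.rewind (s.set d (un (_root_.letter l (v 0)))) l (min_le_right (v 0) l.length)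
  rw [at_zero ((set_reg_ne _ _ (by omega)).trans hF.reg_zero)
    ((set_reg_ne _ _ (by omega)).trans hF.reg_one)] at h₃
  refine (h₁.seq (h₂.seq h₃)).mono ?_
  simp
  omega

end Computes

/-! ### Functions computable in polynomial time from unary arguments -/

/-- The size of an input consisting of a word and some numbers in unary. -/
def inputSize {k : ℕ} (l : List Bool) (v : Fin k → ℕ) : ℕ := l.length + ∑ i, v i + 2

/-- The summand 2 in the size makes it a valid base: constants and sums of powers are absorbed by a
larger exponent. -/
theorem two_le_inputSize {k : ℕ} (l : List Bool) (v : Fin k → ℕ) : 2 ≤ inputSize l v := by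
  simp [inputSize]

theorem inputSize_cons {k : ℕ} (l : List Bool) (v : Fin k → ℕ) (i : ℕ) :
    inputSize l (Fin.cons i v : Fin (k + 1) → ℕ) = inputSize l v + i := by
  simp [inputSize, Fin.sum_univ_succ]; ring

theorem inputSize_tail {k : ℕ} (l : List Bool) (v : Fin (k + 1) → ℕ) :
    inputSize l v = inputSize l (Fin.tail v) + v 0 := by
  simp [inputSize, Fin.sum_univ_succ, Fin.tail]; ring

/-- The function is bounded by a polynomial in the size of the input. -/
def PolyBdd {k : ℕ} (g : List Bool → (Fin k → ℕ) → ℕ) : Prop :=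
  ∃ c, ∀ l v, g l v ≤ inputSize l v ^ c

namespace PolyBdd

variable {k : ℕ} {f g : List Bool → (Fin k → ℕ) → ℕ}

theorem of_le (hg : PolyBdd g) (h : ∀ l v, f l v ≤ g l v) : PolyBdd f :=
  let ⟨c, hc⟩ := hg
  ⟨c, fun l v => (h l v).trans (hc l v)⟩

theorem const (n : ℕ) : PolyBdd (k := k) fun _ _ => n :=
  ⟨n, fun l v => Nat.lt_two_pow_self.le.trans (Nat.pow_le_pow_left (two_le_inputSize l v) n)⟩

theorem size : PolyBdd (k := k) inputSize := ⟨1, fun l v => by simp⟩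

theorem proj (i : Fin k) : PolyBdd fun _ v => v i :=
  size.of_le fun l v => by
    have := Finset.single_le_sum (f := v) (fun _ _ => Nat.zero_le _) (Finset.mem_univ i)
    simp only [inputSize]; omega

theorem length : PolyBdd (k := k) fun l _ => l.length :=
  size.of_le fun l v => by simp only [inputSize]; omega

theorem mul (hf : PolyBdd f) (hg : PolyBdd g) : PolyBdd fun l v => f l v * g l v :=
  let ⟨c, hc⟩ := hf
  let ⟨d, hd⟩ := hg
  ⟨c + d, fun l v => by rw [pow_add]; exact Nat.mul_le_mul (hc l v) (hd l v)⟩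

theorem add (hf : PolyBdd f) (hg : PolyBdd g) : PolyBdd fun l v => f l v + g l v := by
  obtain ⟨c, hc⟩ := hf
  obtain ⟨d, hd⟩ := hg
  refine ⟨c + d + 1, fun l v => ?_⟩
  have h2 := two_le_inputSize l v
  have h₁ : inputSize l v ^ c ≤ inputSize l v ^ (c + d) :=
    Nat.pow_le_pow_right (by omega) (by omega)
  have h₂ : inputSize l v ^ d ≤ inputSize l v ^ (c + d) :=
    Nat.pow_le_pow_right (by omega) (by omega)
  calc f l v + g l v ≤ inputSize l v ^ (c + d) * 2 := by linarith [hc l v, hd l v]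
    _ ≤ inputSize l v ^ (c + d) * inputSize l v := Nat.mul_le_mul_left _ h2
    _ = _ := (pow_succ _ _).symm

theorem pow (hf : PolyBdd f) (n : ℕ) : PolyBdd fun l v => f l v ^ n :=
  let ⟨c, hc⟩ := hf
  ⟨c * n, fun l v => by rw [pow_mul]; exact Nat.pow_le_pow_left (hc l v) n⟩

theorem sum {m : ℕ} {g : Fin m → List Bool → (Fin k → ℕ) → ℕ} (hg : ∀ j, PolyBdd (g j)) :
    PolyBdd fun l v => ∑ j, g j l v := by
  induction m with
  | zero => simpa using const 0
  | succ m ih =>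
    simp only [Fin.sum_univ_succ]
    exact (hg 0).add (ih fun j => hg j.succ)

theorem comp {m : ℕ} {f : List Bool → (Fin m → ℕ) → ℕ} {g : Fin m → List Bool → (Fin k → ℕ) → ℕ}
    (hf : PolyBdd f) (hg : ∀ j, PolyBdd (g j)) : PolyBdd fun l v => f l fun j => g j l v := by
  obtain ⟨c, hc⟩ := hf
  exact (((length.add (sum hg)).add (const 2)).pow c).of_le fun l v => hc _ _

theorem tail (hf : PolyBdd f) : PolyBdd fun l (v : Fin (k + 1) → ℕ) => f l (Fin.tail v) :=
  comp (g := fun j _ v => v j.succ) hf fun j => proj j.succ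

end PolyBdd

/-- The function is computable in time polynomial in the size of the input. -/
def UnaryPoly {k : ℕ} (f : List Bool → (Fin k → ℕ) → ℕ) : Prop :=
  ∃ T, PolyBdd T ∧ Computes f T

namespace UnaryPoly

variable {k : ℕ} {f g : List Bool → (Fin k → ℕ) → ℕ}

theorem polyBdd (hf : UnaryPoly f) : PolyBdd f :=
  let ⟨_, hT, h⟩ := hf
  hT.of_le h.le_time

theorem proj (i : Fin k) : UnaryPoly fun _ v => v i :=
  ⟨_, ((PolyBdd.const 10).mul (.proj i)).add (.const 3), .proj i⟩

theorem succ (hf : UnaryPoly f) : UnaryPoly fun l v => f l v + 1 :=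
  let ⟨_, hT, h⟩ := hf
  ⟨_, hT.add (.const 1), h.succ⟩

theorem const (n : ℕ) : UnaryPoly (k := k) fun _ _ => n := by
  induction n with
  | zero => exact ⟨_, .const 1, .zero⟩
  | succ n ih => exact ih.succ

theorem subst {m : ℕ} {f : List Bool → (Fin m → ℕ) → ℕ} (hf : UnaryPoly f)
    (g : Fin m → List Bool → (Fin k → ℕ) → ℕ) (hg : ∀ j, UnaryPoly (g j)) :
    UnaryPoly fun l v => f l fun j => g j l v := by
  have hb := fun j => (hg j).polyBdd
  obtain ⟨T, hT, h⟩ := hf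
  choose Tg hTg h' using hg
  exact ⟨_, ((hT.comp hb).add (.sum fun j => (((hTg j).add ((PolyBdd.const 2).mul (hb j))).add
    (.const 1)))).add (.const 2), h.comp h'⟩

theorem length : UnaryPoly (k := k) fun l _ => l.length :=
  subst (m := 0) (f := fun l _ => l.length) ⟨_, ((PolyBdd.const 11).mul .length).add (.const 2),
    .length⟩ Fin.elim0 (fun j => j.elim0)

theorem letter (hf : UnaryPoly f) : UnaryPoly fun l v => letter l (f l v) :=
  subst (m := 1) (f := fun l v => _root_.letter l (v 0)) ⟨_, ((PolyBdd.const 17).mul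
    (.proj 0)).add (.const 10), .letter⟩ (fun _ => f) (fun _ => hf)

theorem weaken (hf : UnaryPoly f) : UnaryPoly fun l (w : Fin (k + 1) → ℕ) => f l (Fin.tail w) :=
  hf.subst (fun i _ w => w i.succ) fun i => proj i.succ

theorem cons {f : List Bool → (Fin (k + 1) → ℕ) → ℕ} (hf : UnaryPoly f) (hg : UnaryPoly g) :
    UnaryPoly fun l v => f l (Fin.cons (g l v) v) := by
  have := hf.subst (Fin.cons g fun i _ v => v i) (Fin.cases hg fun i => proj i)
  convert this using 4 with l v
  funext i
  exact i.cases rfl fun _ => rfl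

/-- Unrestricted primitive recursion produces exponentially large values. The hypothesis `hF` bounds
the values at all stages by a polynomial; each round then runs on an input of polynomial size, and
the number of rounds is polynomial too. -/
theorem prec {n : List Bool → (Fin k → ℕ) → ℕ} {h : List Bool → (Fin (k + 2) → ℕ) → ℕ}
    (hn : UnaryPoly n) (hg : UnaryPoly g) (hh : UnaryPoly h)
    (F : List Bool → ℕ → (Fin k → ℕ) → ℕ)
    (F0 : ∀ l v, F l 0 v = g l v)
    (Fs : ∀ l i v, F l (i + 1) v = h l (Fin.cons i (Fin.cons (F l i v) v)))
    (hF : PolyBdd fun l (w : Fin (k + 1) → ℕ) => F l (w 0) (Fin.tail w)) :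
    UnaryPoly fun l v => F l (n l v) v := by
  have key : UnaryPoly fun l (w : Fin (k + 1) → ℕ) => F l (w 0) (Fin.tail w) := by
    obtain ⟨Tg, hTg, hg⟩ := hg
    obtain ⟨Th, hTh, hh⟩ := hh
    refine ⟨_, ?_, hg.prec hh F F0 Fs⟩
    obtain ⟨c, hc⟩ := hF
    obtain ⟨d, hd⟩ := hTh
    have hF' : PolyBdd fun l (w : Fin (k + 1) → ℕ) => F l (w 0) (Fin.tail w) := ⟨c, hc⟩
    have hs : PolyBdd fun l (w : Fin (k + 1) → ℕ) => w 0 *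
        ((inputSize l w + (inputSize l w + 1) ^ c) ^ d + 5 * (inputSize l w + 1) ^ c + 3) :=
      (PolyBdd.proj 0).mul ((((PolyBdd.size.add ((PolyBdd.size.add (.const 1)).pow c)).pow d).add
        ((PolyBdd.const 5).mul ((PolyBdd.size.add (.const 1)).pow c))).add (.const 3))
    have hs' : PolyBdd fun l (w : Fin (k + 1) → ℕ) => ∑ i ∈ Finset.range (w 0),
        (Th l (Fin.cons i (Fin.cons (F l i (Fin.tail w)) (Fin.tail w))) +
          2 * F l i (Fin.tail w) + 3 * F l (i + 1) (Fin.tail w) + 3) := by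
      refine hs.of_le fun l w => ?_
      refine (Finset.sum_le_card_nsmul _ _ _ fun i hi => ?_).trans (by simp; rfl)
      have hi' := Finset.mem_range.1 hi
      have bd : ∀ j, j ≤ w 0 → F l j (Fin.tail w) ≤ (inputSize l w + 1) ^ c := by
        intro j hj
        have := hc l (Fin.cons j (Fin.tail w))
        simp only [Fin.cons_zero, Fin.tail_cons] at this
        refine this.trans (Nat.pow_le_pow_left ?_ c)
        rw [inputSize_cons, inputSize_tail l w]
        omega
      have b1 := bd i hi'.le
      have b2 := bd (i + 1) hi'
      have b3 := hd l (Fin.cons i (Fin.cons (F l i (Fin.tail w)) (Fin.tail w)))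
      have b4 : inputSize l (Fin.cons i (Fin.cons (F l i (Fin.tail w)) (Fin.tail w)) :
          Fin (k + 2) → ℕ) ^ d ≤ (inputSize l w + (inputSize l w + 1) ^ c) ^ d := by
        refine Nat.pow_le_pow_left ?_ d
        rw [inputSize_cons, inputSize_cons, inputSize_tail l w] at *
        omega
      omega
    exact (((hTg.tail.add ((((PolyBdd.const 9).mul (.proj 0)).add (.const 3)).add hs')).add
      ((PolyBdd.const 3).mul hF')).add ((PolyBdd.const 2).mul (.proj 0))).add (.const 2)
  exact key.cons hn

theorem add (hf : UnaryPoly f) (hg : UnaryPoly g) : UnaryPoly fun l v => f l v + g l v :=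
  prec hg hf (h := fun _ w => w 1 + 1) (proj 1).succ (fun l i v => f l v + i)
    (fun _ _ => rfl) (fun _ _ _ => rfl) (hf.polyBdd.tail.add (.proj 0))

theorem mul (hf : UnaryPoly f) (hg : UnaryPoly g) : UnaryPoly fun l v => f l v * g l v :=
  prec hg (const 0) (h := fun l w => w 1 + f l (Fin.tail (Fin.tail w)))
    ((proj 1).add hf.weaken.weaken) (fun l i v => f l v * i)
    (fun _ _ => rfl) (fun _ _ _ => rfl) (hf.polyBdd.tail.mul (.proj 0))

theorem pred (hf : UnaryPoly f) : UnaryPoly fun l v => f l v - 1 :=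
  prec hf (const 0) (h := fun _ w => w 0) (proj 0) (fun _ i _ => i - 1)
    (fun _ _ => rfl) (fun _ _ _ => rfl) ((PolyBdd.proj 0).of_le fun _ _ => Nat.sub_le _ _)

theorem sub (hf : UnaryPoly f) (hg : UnaryPoly g) : UnaryPoly fun l v => f l v - g l v :=
  prec hg hf (h := fun _ w => w 1 - 1) (proj 1).pred (fun l i v => f l v - i)
    (fun _ _ => rfl) (fun _ _ _ => rfl) (hf.polyBdd.tail.of_le fun _ _ => Nat.sub_le _ _)

theorem sum {n : List Bool → (Fin k → ℕ) → ℕ} {F : List Bool → (Fin (k + 1) → ℕ) → ℕ}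
    (hn : UnaryPoly n) (hF : UnaryPoly F) :
    UnaryPoly fun l v => ∑ i ∈ Finset.range (n l v), F l (Fin.cons i v) := by
  refine prec hn (const 0) (h := fun l w => w 1 + F l (Fin.cons (w 0) (Fin.tail (Fin.tail w))))
    ((proj 1).add (hF.subst (Fin.cons (fun _ w => w 0) fun i _ w => w i.succ.succ)
      (Fin.cases (proj 0) fun i => proj i.succ.succ) |> fun h => ?_))
    (fun l i v => ∑ i ∈ Finset.range i, F l (Fin.cons i v)) (fun _ _ => rfl)
    (fun l i v => Finset.sum_range_succ _ _) ?_
  · convert h using 4 with l w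
    funext i
    exact i.cases rfl fun _ => rfl
  · obtain ⟨c, hc⟩ := hF.polyBdd
    refine ((PolyBdd.proj 0).mul (PolyBdd.size.pow c)).of_le fun l w => ?_
    refine (Finset.sum_le_card_nsmul _ _ (inputSize l w ^ c) fun i hi => ?_).trans (by simp)
    refine (hc _ _).trans (Nat.pow_le_pow_left ?_ c)
    rw [inputSize_cons, inputSize_tail l w]
    have := Finset.mem_range.1 hi
    omega

end UnaryPoly

/-! ### Polynomial-time predicates, connectives and bounded quantifiers. -/

/-- The predicate is decidable in time polynomial in the size of the input. -/
def UnaryDec {k : ℕ} (P : List Bool → (Fin k → ℕ) → Prop) : Prop :=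
  ∃ f : List Bool → (Fin k → ℕ) → ℕ, UnaryPoly f ∧ ∀ l v, (P l v ↔ f l v ≠ 0)

namespace UnaryDec

variable {k : ℕ} {P Q : List Bool → (Fin k → ℕ) → Prop} {f g : List Bool → (Fin k → ℕ) → ℕ}

theorem of_iff (hP : UnaryDec P) (h : ∀ l v, Q l v ↔ P l v) : UnaryDec Q :=
  let ⟨f, hf, e⟩ := hP
  ⟨f, hf, fun l v => (h l v).trans (e l v)⟩

theorem lt (hf : UnaryPoly f) (hg : UnaryPoly g) : UnaryDec fun l v => f l v < g l v :=
  ⟨_, hg.sub hf, fun l v => by omega⟩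

theorem not (hP : UnaryDec P) : UnaryDec fun l v => ¬ P l v :=
  let ⟨f, hf, e⟩ := hP
  ⟨_, (UnaryPoly.const 1).sub hf, fun l v => by have := e l v; simp only [this]; omega⟩

theorem and (hP : UnaryDec P) (hQ : UnaryDec Q) : UnaryDec fun l v => P l v ∧ Q l v :=
  let ⟨f, hf, e⟩ := hP
  let ⟨g, hg, e'⟩ := hQ
  ⟨_, hf.mul hg, fun l v => by simp only [e, e']; simp⟩

theorem or (hP : UnaryDec P) (hQ : UnaryDec Q) : UnaryDec fun l v => P l v ∨ Q l v :=
  (hP.not.and hQ.not).not.of_iff fun l v => by tauto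

theorem imp (hP : UnaryDec P) (hQ : UnaryDec Q) : UnaryDec fun l v => P l v → Q l v :=
  (hP.not.or hQ).of_iff fun l v => by tauto

theorem iff (hP : UnaryDec P) (hQ : UnaryDec Q) : UnaryDec fun l v => (P l v ↔ Q l v) :=
  ((hP.imp hQ).and (hQ.imp hP)).of_iff fun l v => by tauto

theorem le (hf : UnaryPoly f) (hg : UnaryPoly g) : UnaryDec fun l v => f l v ≤ g l v :=
  (lt hg hf).not.of_iff fun l v => by omega

theorem eq (hf : UnaryPoly f) (hg : UnaryPoly g) : UnaryDec fun l v => f l v = g l v :=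
  ((le hf hg).and (le hg hf)).of_iff fun l v => by omega

theorem ite (hP : UnaryDec P) (hf : UnaryPoly f) (hg : UnaryPoly g)
    [∀ l v, Decidable (P l v)] : UnaryPoly fun l v => if P l v then f l v else g l v := by
  obtain ⟨p, hp, e⟩ := hP
  have := (((UnaryPoly.const 1).sub hp).mul hg).add
    (((UnaryPoly.const 1).sub ((UnaryPoly.const 1).sub hp)).mul hf)
  convert this using 3 with l v
  have := e l v
  by_cases h : p l v = 0
  · rw [if_neg (by simp [this, h])]; simp [h]
  · rw [if_pos (by simp [this, h]), show 1 - p l v = 0 by omega]; simp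

theorem subst {m : ℕ} {P : List Bool → (Fin m → ℕ) → Prop} (hP : UnaryDec P)
    (g : Fin m → List Bool → (Fin k → ℕ) → ℕ) (hg : ∀ j, UnaryPoly (g j)) :
    UnaryDec fun l v => P l fun j => g j l v :=
  let ⟨_, hf, e⟩ := hP
  ⟨_, hf.subst g hg, fun _ _ => e _ _⟩

theorem bex {n : List Bool → (Fin k → ℕ) → ℕ} {P : List Bool → (Fin (k + 1) → ℕ) → Prop}
    (hn : UnaryPoly n) (hP : UnaryDec P) :
    UnaryDec fun l v => ∃ i < n l v, P l (Fin.cons i v) := by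
  obtain ⟨f, hf, e⟩ := hP
  refine ⟨_, hn.sum hf, fun l v => ?_⟩
  simp [e, Finset.sum_eq_zero_iff]

theorem ball {n : List Bool → (Fin k → ℕ) → ℕ} {P : List Bool → (Fin (k + 1) → ℕ) → Prop}
    (hn : UnaryPoly n) (hP : UnaryDec P) :
    UnaryDec fun l v => ∀ i < n l v, P l (Fin.cons i v) :=
  (bex hn hP.not).not.of_iff fun l v => by push Not; rfl

end UnaryDec

namespace UnaryPoly

variable {k : ℕ} {f g : List Bool → (Fin k → ℕ) → ℕ}

/-- The number of indices below a bound with a given property. -/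
theorem count {n : List Bool → (Fin k → ℕ) → ℕ} {P : List Bool → (Fin (k + 1) → ℕ) → Prop}
    (hn : UnaryPoly n) (hP : UnaryDec P) [∀ l v, DecidablePred fun i => P l (Fin.cons i v)] :
    UnaryPoly fun l v => ((Finset.range (n l v)).filter fun i => P l (Fin.cons i v)).card := by
  classical
  have := hn.sum (hP.ite (const 1) (const 0))
  convert this using 3 with l v
  rw [Finset.card_filter]
  refine Finset.sum_congr rfl fun i _ => ?_
  congr

/-- The quotient is the number of positive multiples of the divisor up to the dividend. The
condition that the divisor is positive gives the count 0 for division by zero. -/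
theorem div (hf : UnaryPoly f) (hg : UnaryPoly g) : UnaryPoly fun l v => f l v / g l v := by
  have := count (P := fun l w => 0 < g l (Fin.tail w) ∧ (w 0 + 1) * g l (Fin.tail w) ≤
    f l (Fin.tail w)) hf ((UnaryDec.lt (const 0) hg.weaken).and
      (UnaryDec.le ((proj 0).succ.mul hg.weaken) hf.weaken))
  convert this using 3 with l v
  simp only [Fin.tail_cons, Fin.cons_zero]
  rcases Nat.eq_zero_or_pos (g l v) with h | h
  · simp [h]
  · have e : ((Finset.range (f l v)).filter fun i => 0 < g l v ∧ (i + 1) * g l v ≤ f l v)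
        = Finset.range (f l v / g l v) := by
      ext i
      have h₁ := Nat.le_div_iff_mul_le h (x := i + 1) (y := f l v)
      have h₂ := Nat.div_le_self (f l v) (g l v)
      simp only [Finset.mem_filter, Finset.mem_range]
      constructor
      · rintro ⟨-, -, h₃⟩
        have := h₁.2 h₃
        omega
      · intro h₃
        exact ⟨by omega, h, h₁.1 (by omega)⟩
    rw [e, Finset.card_range]

theorem mod (hf : UnaryPoly f) (hg : UnaryPoly g) : UnaryPoly fun l v => f l v % g l v := by
  have := hf.sub (hg.mul (hf.div hg))
  convert this using 3 with l v
  have := Nat.div_add_mod (f l v) (g l v)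
  omega

end UnaryPoly

/-! ### Machines that write a word letter by letter and process it -/

theorem Runs.emit (s b) : Runs (.emit b) s ⟨s.reg, b :: s.out⟩ 1 := ⟨1, le_rfl, .emit s b⟩

open Classical in
/-- The word of length `K l` whose letters are given by the predicate `P`. -/
noncomputable def wordOf (K : List Bool → ℕ) (P : List Bool → (Fin 2 → ℕ) → Prop)
    (l : List Bool) : List Bool :=
  (List.range (K l)).map fun z => decide (P l ![K l, z])

-- The output is a stack, so letters are emitted from the last to the first. The countdown register
-- of the loop contains `K l - 1 - i` in round `i` and serves directly as the position of the
-- letter.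
open PState in
theorem exists_prog_wordOf {K TK : List Bool → ℕ}
    (hK : Computes (k := 0) (fun l _ => K l) (fun l _ => TK l))
    {P : List Bool → (Fin 2 → ℕ) → Prop} (hP : UnaryDec P) :
    ∃ p : Prog, ∃ R c : ℕ, p.Within R ∧ ∀ l,
      Runs p ⟨fun r => if r = 0 then l else [], []⟩ ⟨fun _ => [], wordOf K P l⟩
        (TK l + (l.length + K l + 2) ^ c) := by
  classical
  obtain ⟨f, hf, hPf⟩ := hP
  obtain ⟨c₁, hc₁⟩ := hf.polyBdd
  obtain ⟨T, ⟨c₂, hc₂⟩, hf⟩ := hf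
  obtain ⟨ck, Wk, hk₁, hk₂⟩ := hK
  obtain ⟨cf, Wf, hf₁, hf₂⟩ := hf
  -- Register 2 holds the length of the word, 3 the position (4 is the second loop register), and 5
  -- receives the value that decides the letter.
  let body : Prog := .seq (cf ![2, 3] 5 6) (.seq (.ite 5 Option.isSome (.emit true) (.emit false))
    (.clear 5))
  -- an explicit polynomial bound
  obtain ⟨c, hc⟩ : ∃ c, ∀ l, 15 + 11 * K l + 2 * l.length + K l * ((l.length + 2 * K l + 2) ^ c₂ +
      2 * (l.length + 2 * K l + 2) ^ c₁ + 5) ≤ (l.length + K l + 2) ^ c := by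
    have h : PolyBdd (k := 1) fun l v => 15 + 11 * v 0 + 2 * l.length +
        v 0 * ((l.length + 2 * v 0 + 2) ^ c₂ + 2 * (l.length + 2 * v 0 + 2) ^ c₁ + 5) := by
      have h₀ : PolyBdd (k := 1) fun l v => l.length + 2 * v 0 + 2 :=
        (PolyBdd.length.add ((PolyBdd.const 2).mul (.proj 0))).add (.const 2)
      exact (((PolyBdd.const 15).add ((PolyBdd.const 11).mul (.proj 0))).add
        ((PolyBdd.const 2).mul .length)).add ((PolyBdd.proj 0).mul (((h₀.pow c₂).add
          ((PolyBdd.const 2).mul (h₀.pow c₁))).add (.const 5)))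
    obtain ⟨c, hc⟩ := h
    refine ⟨c, fun l => ?_⟩
    have := hc l ![K l]
    simpa [inputSize] using this
  refine ⟨.seq (ck Fin.elim0 2 3) (.seq (.loop 2 3 body) (.seq (.clear 2) (.clear 0))),
    6 + Wk + Wf, c, ⟨(hk₁ _ _ _ (fun i => i.elim0) (by omega)).mono (by omega),
      Prog.Within.loop (by omega) (by omega) ⟨(hf₁ _ _ _ (fun i => ?_) (by omega)).mono (by omega),
        ?_⟩, ?_⟩, fun l => ?_⟩
  · fin_cases i <;> simp
  · simp only [Prog.clear, Prog.Within, and_true]; omega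
  · simp only [Prog.clear, Prog.Within]; omega
  · set s₀ : PState := ⟨fun r => if r = 0 then l else [], []⟩ with hs₀
    set w := wordOf K P l with hw
    have hwl : w.length = K l := by simp [hw, wordOf]
    have h₁ := hk₂ l Fin.elim0 Fin.elim0 2 3 s₀ (by
      constructor
      · rfl
      · rfl
      · exact fun i => i.elim0
      · omega
      · exact fun i => i.elim0
      · omega
      · exact fun i => i.elim0
      · exact fun i => i.elim0
      · rfl
      · intro r hr; exact if_neg (by omega))
    -- After `i` rounds the last `i` letters are on the output stack.
    let S : ℕ → PState := fun i => ⟨(s₀.set 2 (un (K l))).reg, w.drop (K l - i)⟩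
    have hS0 : S 0 = s₀.set 2 (un (K l)) := by
      refine PState.ext rfl ?_
      simp only [S, Nat.sub_zero]
      rw [← hwl, List.drop_length]
      rfl
    have Sreg : ∀ i r, (S i).reg r = if r = 2 then un (K l) else if r = 0 then l else [] := by
      intro i r; simp only [S, set_reg, hs₀]
    rw [← hS0] at h₁
    have h₂ := Runs.loop (S 0) (r := 2) (b := 3) (n := K l) (p := body) (by simp [Sreg])
      (by omega) (by simp [Sreg]) (by simp [Sreg]) S
      (fun i => (l.length + 2 * K l + 2) ^ c₂ + 2 * (l.length + 2 * K l + 2) ^ c₁ + 5) rfl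
      (by simp [Sreg]) (fun i hi => by
        set z := K l - 1 - i with hz
        set s := (S i).set 3 (un z)
        have sreg : ∀ r, s.reg r = if r = 3 then un z else if r = 2 then un (K l) else
            if r = 0 then l else [] := by
          intro r; simp only [s, set_reg, Sreg]
        have hF : Frame l ![K l, z] ![2, 3] 5 6 s := by
          constructor
          · simp [sreg]
          · simp [sreg]
          · intro i; fin_cases i <;> simp
          · omega
          · intro i; fin_cases i <;> simp
          · omega
          · intro i; fin_cases i <;> simp
          · intro i; fin_cases i <;> simp [sreg]
          · simp [sreg]
          · intro r hr
            rw [sreg, if_neg (by omega), if_neg (by omega), if_neg (by omega)]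
        have r₁ := hf₂ _ _ _ _ _ _ hF
        set y := f l ![K l, z]
        have hsz : inputSize l ![K l, z] ≤ l.length + 2 * K l + 2 := by
          simp [inputSize]; omega
        have hy : y ≤ (l.length + 2 * K l + 2) ^ c₁ :=
          (hc₁ _ _).trans (Nat.pow_le_pow_left hsz _)
        have hT : T l ![K l, z] ≤ (l.length + 2 * K l + 2) ^ c₂ :=
          (hc₂ _ _).trans (Nat.pow_le_pow_left hsz _)
        have r₂ : Runs (.ite 5 Option.isSome (.emit true) (.emit false)) (s.set 5 (un y))
            ⟨(s.set 5 (un y)).reg, decide (P l ![K l, z]) :: s.out⟩ 2 := by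
          by_cases h0 : y = 0
          · have hd : decide (P l ![K l, z]) = false := by
              rw [decide_eq_false_iff_not, hPf]; simpa using h0
            rw [hd]
            exact Runs.ite_false (by simp [h0]) (Runs.emit _ _)
          · have hd : decide (P l ![K l, z]) = true := by
              rw [decide_eq_true_iff, hPf]; simpa using h0
            rw [hd]
            obtain ⟨y', hy'⟩ := Nat.exists_eq_succ_of_ne_zero h0
            exact Runs.ite_true (by simp [hy', List.replicate_succ]) (Runs.emit _ _)
        have r₃ := Runs.clear ⟨(s.set 5 (un y)).reg, decide (P l ![K l, z]) :: s.out⟩ 5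
        have e : (⟨(s.set 5 (un y)).reg, decide (P l ![K l, z]) :: s.out⟩ : PState).set 5 []
            = (S (i + 1)).set 3 (un z) := by
          refine ext_reg (fun r => ?_) ?_
          · simp only [set_reg, sreg, Sreg]
            by_cases h5 : r = 5
            · subst h5; simp
            · simp [h5]
          · have hlt : z < w.length := by omega
            change decide (P l ![K l, z]) :: w.drop (K l - i) = w.drop (K l - (i + 1))
            rw [show K l - (i + 1) = z by omega, List.drop_eq_getElem_cons hlt,
              show K l - i = z + 1 by omega]
            congr 1
            simp [hw, wordOf]
        rw [e] at r₃
        refine (r₁.seq (r₂.seq r₃)).mono ?_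
        simp only [set_reg_self, List.length_replicate]
        omega)
    have h₃ := Runs.clear (S (K l)) 2
    have h₄ := Runs.clear ((S (K l)).set 2 []) 0
    have e : ((S (K l)).set 2 []).set 0 [] = ⟨fun _ => [], w⟩ := by
      refine ext_reg (fun r => ?_) ?_
      · simp only [set_reg, Sreg]
        split_ifs <;> rfl
      · simp [S]
    rw [e] at h₄
    have e₁ : ((S (K l)).reg 2).length = K l := by simp [Sreg]
    have e₂ : (((S (K l)).set 2 []).reg 0).length = l.length := by simp [set_reg, Sreg]
    rw [e₁] at h₃
    rw [e₂] at h₄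
    refine (h₁.seq (h₂.seq (h₃.seq h₄))).mono ?_
    have := hc l
    simp only [Finset.sum_const, Finset.card_range, smul_eq_mul]
    omega

open Turing in
/-- A machine that computes a word letter by letter and then runs the machine `M` on it. -/
theorem exists_machine_comp_wordOf (M : TM2ComputableAux Bool Bool) {K TK : List Bool → ℕ}
    (hK : Computes (k := 0) (fun l _ => K l) (fun l _ => TK l))
    {P : List Bool → (Fin 2 → ℕ) → Prop} (hP : UnaryDec P) :
    ∃ (M' : TM2ComputableAux Bool Bool) (c : ℕ), ∀ (l o : List Bool) (t : ℕ),
      Nonempty (TM2OutputsInTime M.tm ((wordOf K P l).map M.inputAlphabet.symm)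
        (some (o.map M.outputAlphabet.symm)) t) →
      Nonempty (TM2OutputsInTime M'.tm (l.map M'.inputAlphabet.symm)
        (some (o.map M'.outputAlphabet.symm)) (TK l + (l.length + K l + 2) ^ c + t)) := by
  obtain ⟨p, R, c, hR, h⟩ := exists_prog_wordOf hK hP
  refine ⟨⟨Prefixed.machine M.tm M.inputAlphabet R p, Equiv.refl Bool, M.outputAlphabet⟩, c,
    fun l o t ht => ?_⟩
  obtain ⟨t', ht', h'⟩ := h l
  obtain ⟨e⟩ := Prefixed.machine_outputs hR h' ht
  have hl : l.map (Equiv.refl Bool).symm = l := by simp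
  refine ⟨?_⟩
  have e' : TM2OutputsInTime (Prefixed.machine M.tm M.inputAlphabet R p)
      (l.map (Equiv.refl Bool).symm : List Bool) (some (o.map M.outputAlphabet.symm)) (t' + t) := by
    rw [hl]; exact e
  exact ⟨e'.toEvalsTo, e'.steps_le_m.trans (by omega)⟩

/-! ### Lines: polynomials of bounded degree, and families of them that agree crosswise -/

/-- A point `s` and a polynomial of degree less than `d`, thought of as the values of a function of
two variables on the line through `s`. -/
abbrev Line (F : Type) (d : ℕ) : Type := F × (Fin d → F)

section Lines

variable {F : Type} [Field F] {d : ℕ}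

/-- The value of the polynomial with the given coefficients. -/
def evalCoeff (a : Fin d → F) (t : F) : F := ∑ i, a i * t ^ (i : ℕ)

/-- Two lines are compatible: they have the same value at their intersection, and they are equal if
they belong to the same point. -/
def Compat (L L' : Line F d) : Prop :=
  evalCoeff L.2 L'.1 = evalCoeff L'.2 L.1 ∧ (L.1 = L'.1 → L = L')

open Polynomial in
theorem exists_poly (a : Fin d → F) : ∃ p : F[X], p.degree < d ∧ (∀ t, p.eval t = evalCoeff a t) ∧
    ∀ i : Fin d, p.coeff i = a i := by
  refine ⟨∑ i, C (a i) * X ^ (i : ℕ), ?_, fun t => ?_, fun i => ?_⟩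
  · exact degree_sum_fin_lt a
  · simp [eval_finsetSum, evalCoeff]
  · simp [finsetSum_coeff, coeff_C_mul, coeff_X_pow, Fin.val_inj]

theorem evalCoeff_injective {a b : Fin d → F} {T : Finset F} (hT : d ≤ T.card)
    (h : ∀ t ∈ T, evalCoeff a t = evalCoeff b t) : a = b := by
  obtain ⟨p, hp, hpe, hpc⟩ := exists_poly a
  obtain ⟨p', hp', hpe', hpc'⟩ := exists_poly b
  have hT' : (d : WithBot ℕ) ≤ T.card := by exact_mod_cast hT
  have := Polynomial.eq_of_degrees_lt_of_eval_finset_eq T (hp.trans_le hT') (hp'.trans_le hT')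
    fun t ht => by rw [hpe, hpe', h t ht]
  funext i
  rw [← hpc, ← hpc', this]

variable [DecidableEq F]

theorem exists_evalCoeff_eq {T : Finset F} (hT : T.card ≤ d) (y : F → F) :
    ∃ a : Fin d → F, ∀ t ∈ T, evalCoeff a t = y t := by
  have hinj : Set.InjOn (id : F → F) T := Function.injective_id.injOn
  set p := Lagrange.interpolate T id y
  have hp : p.degree < d :=
    (Lagrange.degree_interpolate_lt y hinj).trans_le (by exact_mod_cast hT)
  refine ⟨fun i => p.coeff i, fun t ht => ?_⟩
  have he := Lagrange.eval_interpolate_at_node y hinj ht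
  rw [id] at he
  rw [← he, evalCoeff]
  rcases Nat.eq_zero_or_pos d with h0 | h0
  · subst h0
    simp at hT
    subst hT
    simp at ht
  · have hn : p.natDegree < d := by
      by_cases h : p = 0
      · rw [h]; simpa using h0
      · exact (Polynomial.natDegree_lt_iff_degree_lt h).2 hp
    rw [Polynomial.eval_eq_sum_range' hn, Finset.sum_range]

/-- This is Lagrange interpolation, stated so that the weights `c u t` do not depend on the
polynomial. The formula can therefore be applied in both variables of a family with the same
weights. -/
theorem evalCoeff_eq_sum {T : Finset F} (hT : T.card = d) :
    ∃ c : F → F → F, ∀ (a : Fin d → F) (t : F),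
      evalCoeff a t = ∑ u ∈ T, evalCoeff a u * c u t := by
  refine ⟨fun u t => (Lagrange.basis T id u).eval t, fun a t => ?_⟩
  obtain ⟨p, hp, hpe, -⟩ := exists_poly a
  have := Lagrange.eq_interpolate (s := T) (v := (id : F → F)) (f := p)
    Function.injective_id.injOn (by rw [hT]; exact hp)
  rw [← hpe, this, Lagrange.interpolate_apply, Polynomial.eval_finsetSum]
  simp [hpe]

/-- A family of polynomials with symmetric values. -/
def Crosswise (T : Finset F) (φ : F → Fin d → F) : Prop :=
  ∀ s ∈ T, ∀ t ∈ T, evalCoeff (φ s) t = evalCoeff (φ t) s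

variable [Fintype F]

/-- A family with fewer than `d` members is enlarged one point at a time; once there are `d` members
they determine a symmetric polynomial in two variables, whose restrictions form the extension. The
induction is on the number of missing members. -/
theorem Crosswise.exists_extension {T : Finset F} {φ : F → Fin d → F} (hd : d ≤ Fintype.card F)
    (h : Crosswise T φ) : ∃ ψ : F → Fin d → F, Crosswise Finset.univ ψ ∧ ∀ t ∈ T, ψ t = φ t := by
  obtain ⟨n, hn⟩ : ∃ n, d - T.card = n := ⟨_, rfl⟩
  induction n generalizing T φ with
  | zero =>
    obtain ⟨T₀, hT₀, hcard⟩ := Finset.exists_subset_card_eq (show d ≤ T.card by omega)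
    obtain ⟨c, hc⟩ := evalCoeff_eq_sum (F := F) hcard
    choose ψ hψ using fun s => exists_evalCoeff_eq hcard.le fun t => evalCoeff (φ t) s
    refine ⟨ψ, fun s _ t _ => ?_, fun s hs => ?_⟩
    -- Interpolation in both variables writes the value as a double sum over the grid `T₀ × T₀`. It
    -- is symmetric in `s` and `t` because the grid values of `φ` are.
    · have key : ∀ s t, evalCoeff (ψ s) t
          = ∑ u ∈ T₀, ∑ w ∈ T₀, evalCoeff (φ u) w * c w s * c u t := by
        intro s t
        rw [hc (ψ s) t]
        refine Finset.sum_congr rfl fun u hu => ?_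
        rw [hψ s u hu, hc (φ u) s, Finset.sum_mul]
      rw [key, key, Finset.sum_comm]
      refine Finset.sum_congr rfl fun u hu => Finset.sum_congr rfl fun w hw => ?_
      rw [h _ (hT₀ hw) _ (hT₀ hu)]
      ring
    · refine evalCoeff_injective hcard.ge fun t ht => ?_
      rw [hψ s t ht, h _ (hT₀ ht) _ hs]
  | succ n ih =>
    obtain ⟨s, hs⟩ : ∃ s, s ∉ T := by
      by_contra! hall
      have : T = Finset.univ := Finset.eq_univ_of_forall hall
      rw [this, Finset.card_univ] at hn
      omega
    -- The new line at `s` has prescribed values only at the points of `T`, of which there are fewer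
    -- than `d`.
    obtain ⟨a, ha⟩ := exists_evalCoeff_eq (T := T) (d := d) (by omega) fun t => evalCoeff (φ t) s
    have hne : ∀ t ∈ T, t ≠ s := fun t ht e => hs (e ▸ ht)
    obtain ⟨ψ, hψ, hψT⟩ := ih (T := insert s T) (φ := Function.update φ s a) (by
      intro x hx y hy
      rcases Finset.mem_insert.1 hx with rfl | hx'
      · rcases Finset.mem_insert.1 hy with rfl | hy'
        · rfl
        · rw [Function.update_self, Function.update_of_ne (hne y hy'), ha y hy']
      · rcases Finset.mem_insert.1 hy with rfl | hy'
        · rw [Function.update_self, Function.update_of_ne (hne x hx'), ha x hx']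
        · rw [Function.update_of_ne (hne x hx'), Function.update_of_ne (hne y hy'), h x hx' y hy'])
      (by rw [Finset.card_insert_of_notMem hs]; omega)
    refine ⟨ψ, hψ, fun t ht => ?_⟩
    rw [hψT t (Finset.mem_insert_of_mem ht), Function.update_of_ne (hne t ht)]

omit [DecidableEq F] in
/-- A crosswise family is determined by its values on a grid. -/
theorem Crosswise.eq_of_grid {T : Finset F} (hT : d ≤ T.card) {φ ψ : F → Fin d → F}
    (hφ : Crosswise Finset.univ φ) (hψ : Crosswise Finset.univ ψ)
    (h : ∀ s ∈ T, ∀ t ∈ T, evalCoeff (φ s) t = evalCoeff (ψ s) t) : φ = ψ := by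
  have h' : ∀ s ∈ T, φ s = ψ s := fun s hs => evalCoeff_injective hT (h s hs)
  funext s
  refine evalCoeff_injective hT fun t ht => ?_
  rw [hφ s (Finset.mem_univ _) t (Finset.mem_univ _), h' t ht,
    hψ t (Finset.mem_univ _) s (Finset.mem_univ _)]

/-- Every symmetric matrix on a grid comes from a crosswise family. -/
theorem exists_crosswise_of_grid {T : Finset F} (hT : T.card = d) (M : F → F → F)
    (hM : ∀ s t, M s t = M t s) : ∃ φ : F → Fin d → F, Crosswise Finset.univ φ ∧
      ∀ s ∈ T, ∀ t ∈ T, evalCoeff (φ s) t = M s t := by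
  choose φ hφ using fun s => exists_evalCoeff_eq (d := d) hT.le fun t => M s t
  obtain ⟨ψ, hψ, h⟩ := Crosswise.exists_extension (T := T) (φ := φ) (hT ▸ T.card_le_univ)
    fun s hs t ht => by rw [hφ s t ht, hφ t s hs, hM]
  exact ⟨ψ, hψ, fun s hs t ht => by rw [h s hs, hφ s t ht]⟩

omit [DecidableEq F] in
theorem Crosswise.compat {φ : F → Fin d → F} (hφ : Crosswise Finset.univ φ) (s t : F) :
    Compat (s, φ s) (t, φ t) :=
  ⟨hφ s (Finset.mem_univ _) t (Finset.mem_univ _), fun (e : s = t) => by rw [e]⟩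

/-- A line outside a crosswise family is compatible with less than `d` members of the family. -/
theorem Crosswise.card_compat_lt {φ : F → Fin d → F} (hφ : Crosswise Finset.univ φ)
    {L : Line F d} (hL : L.2 ≠ φ L.1) :
    (Finset.univ.filter fun t => evalCoeff L.2 t = evalCoeff (φ t) L.1).card < d := by
  by_contra! h
  refine hL (evalCoeff_injective h fun t ht => ?_)
  rw [(Finset.mem_filter.1 ht).2, hφ t (Finset.mem_univ _) _ (Finset.mem_univ _)]

end Lines

/-! ### Counting communities in graphs of triples of lines -/

theorem ties_eq_card {V : Type} [Fintype V] [DecidableEq V] (G : SimpleGraph V) (v : V)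
    (S : Finset V) [DecidablePred fun w => w = v ∨ G.Adj v w] :
    ties G v S = (S.filter fun w => w = v ∨ G.Adj v w).card := by
  rw [ties, ← Set.ncard_coe_finset]
  congr 1
  ext w
  simp

/-- The graph on (codes of) triples of lines. The vertices outside `Real` form a complete graph with
one edge `p₁ p₂` removed. A triple with the property `Bad` occurs twice. -/
structure TripleGraph {F : Type} [Field F] {d : ℕ} {V : Type} (G : SimpleGraph V)
    (Real : V → Prop) (ln : V → Fin 3 → Line F d) (tw : V → Bool)
    (Bad : (Fin 3 → Line F d) → Prop) (p₁ p₂ p₃ : V) : Prop where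
  real_compat : ∀ v, Real v → ∀ i j, Compat (ln v i) (ln v j)
  real_bad : ∀ v, Real v → tw v = true → Bad (ln v)
  surj : ∀ (L : Fin 3 → Line F d) (b : Bool), (∀ i j, Compat (L i) (L j)) → (b = true → Bad L) →
    ∃ v, Real v ∧ ln v = L ∧ tw v = b
  inj : ∀ v w, Real v → Real w → ln v = ln w → tw v = tw w → v = w
  -- Requiring different triples of points excludes edges between the two copies of a bad triple, so
  -- a clique of real vertices has at most one vertex per triple of points.
  adj_real : ∀ v w, Real v → Real w → (G.Adj v w ↔ (fun i => (ln v i).1) ≠ (fun i => (ln w i).1) ∧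
    ∀ i j, Compat (ln v i) (ln w j))
  not_adj : ∀ v w, Real v → ¬ Real w → ¬ G.Adj v w
  adj_junk : ∀ v w, ¬ Real v → ¬ Real w → (G.Adj v w ↔ v ≠ w ∧ ¬ (v = p₁ ∧ w = p₂) ∧
    ¬ (v = p₂ ∧ w = p₁))
  junk₁ : ¬ Real p₁
  junk₂ : ¬ Real p₂
  junk₃ : ¬ Real p₃
  ne₁₂ : p₁ ≠ p₂
  ne₁₃ : p₁ ≠ p₃
  ne₂₃ : p₂ ≠ p₃

namespace TripleGraph

variable {F : Type} [Field F] [Fintype F] [DecidableEq F] {d : ℕ} {V : Type} [Fintype V]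
  [DecidableEq V] {G : SimpleGraph V} {Real : V → Prop} {ln : V → Fin 3 → Line F d} {tw : V → Bool}
  {Bad : (Fin 3 → Line F d) → Prop} {p₁ p₂ p₃ : V}

/-- A vertex that is outside a community is not adjacent to all members, nor to all but one of at
least two. -/
theorem exists_not_adj {ε : ℝ} (hε : ε ≤ 1 / 4) {S : Finset V} (hS : IsCommunity G 1 ε S) {u : V}
    (hu : u ∉ S) : ∃ w ∈ S, ¬ G.Adj u w := by
  classical
  by_contra! h
  have h₁ := hS.2.2 u hu
  rw [ties_eq_card, Finset.filter_true_of_mem fun w hw => Or.inr (h w hw)] at h₁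
  have h₂ : (0 : ℝ) < S.card := by exact_mod_cast hS.1.card_pos
  nlinarith

/-- If at most one of at least two members is not adjacent, there remain at least |S|/2 ties, which
exceeds ε|S|. -/
theorem exists_two_not_adj {ε : ℝ} (hε : ε ≤ 1 / 4) {S : Finset V} (hS : IsCommunity G 1 ε S)
    (hcard : 2 ≤ S.card) {u : V} (hu : u ∉ S) (x : V) : ∃ w ∈ S, w ≠ x ∧ ¬ G.Adj u w := by
  classical
  by_contra! h
  have h₁ := hS.2.2 u hu
  have h₂ : (S.erase x).card ≤ ties G u S := by
    rw [ties_eq_card]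
    refine Finset.card_le_card fun w hw => ?_
    rw [Finset.mem_erase] at hw
    exact Finset.mem_filter.2 ⟨hw.2, Or.inr (h w hw.2 hw.1)⟩
  have h₃ := Finset.pred_card_le_card_erase (s := S) (a := x)
  have h₄ : (S.card : ℝ) ≤ ties G u S + 1 := by exact_mod_cast (by omega)
  have h₅ : (2 : ℝ) ≤ S.card := by exact_mod_cast hcard
  nlinarith

/-- For α = 1 the number of ties of a member is all of |S|; communities are cliques. -/
theorem adj_of_mem {ε : ℝ} {S : Finset V} (hS : IsCommunity G 1 ε S) {v w : V} (hv : v ∈ S)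
    (hw : w ∈ S) (hvw : v ≠ w) : G.Adj v w := by
  classical
  have h := hS.2.1 v hv
  rw [one_mul, ties_eq_card] at h
  have h' : S.card ≤ (S.filter fun w => w = v ∨ G.Adj v w).card := by exact_mod_cast h
  have := Finset.filter_card_eq (le_antisymm (Finset.card_filter_le _ _) h') w hw
  exact this.resolve_left hvw.symm

-- A community with a vertex outside `Real` lies entirely outside `Real`, as there are no edges
-- across. It must contain `p₃`, which is adjacent to all other such vertices. It cannot contain
-- both `p₁` and `p₂`, since their edge is missing. If one of these is outside, its only possible
-- non-neighbour in the community is the other one, so the community would be that single vertex,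
-- contradicting `p₃ ∈ S`.
omit [Fintype F] [DecidableEq F] in
theorem real_of_mem (hG : TripleGraph G Real ln tw Bad p₁ p₂ p₃) {ε : ℝ} (hε : ε ≤ 1 / 4)
    {S : Finset V} (hS : IsCommunity G 1 ε S) {v : V} (hv : v ∈ S) : Real v := by
  by_contra hr
  have hall : ∀ w ∈ S, ¬ Real w := by
    intro w hw hw'
    exact hG.not_adj w v hw' hr (adj_of_mem hS hw hv (fun e => hr (e ▸ hw')))
  have hp : ∀ x y, x ∉ S → ¬ Real x → (∀ w, ¬ Real w → w ≠ x → w ≠ y → G.Adj x w) → S = {y} := by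
    intro x y hx hxr h
    obtain ⟨w, hw, hxw⟩ := exists_not_adj hε hS hx
    have hy : w = y := by
      by_contra hwy
      exact hxw (h w (hall w hw) (fun e => hx (e ▸ hw)) hwy)
    subst hy
    refine Finset.eq_singleton_iff_unique_mem.2 ⟨hw, fun z hz => ?_⟩
    by_contra hzw
    have hcard : 2 ≤ S.card := Finset.one_lt_card.2 ⟨z, hz, w, hw, hzw⟩
    obtain ⟨z', hz', hz'w, hxz'⟩ := exists_two_not_adj hε hS hcard hx w
    exact hxz' (h z' (hall z' hz') (fun e => hx (e ▸ hz')) hz'w)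
  have a₁ : ∀ w, ¬ Real w → w ≠ p₁ → w ≠ p₂ → G.Adj p₁ w := by
    intro w hw h₁ h₂
    rw [hG.adj_junk _ _ hG.junk₁ hw]
    exact ⟨h₁.symm, fun h => h₂ h.2, fun h => h₁ h.2⟩
  have a₂ : ∀ w, ¬ Real w → w ≠ p₂ → w ≠ p₁ → G.Adj p₂ w := by
    intro w hw h₁ h₂
    rw [hG.adj_junk _ _ hG.junk₂ hw]
    exact ⟨h₁.symm, fun h => hG.ne₁₂ h.1.symm, fun h => h₂ h.2⟩
  have a₃ : ∀ w, ¬ Real w → w ≠ p₃ → G.Adj p₃ w := by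
    intro w hw h₁
    rw [hG.adj_junk _ _ hG.junk₃ hw]
    exact ⟨h₁.symm, fun h => hG.ne₁₃ h.1.symm, fun h => hG.ne₂₃ h.1.symm⟩
  have h₃ : p₃ ∉ S → False := by
    intro h
    obtain ⟨w, hw, hw'⟩ := exists_not_adj hε hS h
    exact hw' (a₃ w (hall w hw) fun e => h (e ▸ hw))
  by_cases h₁ : p₁ ∈ S
  · by_cases h₂ : p₂ ∈ S
    · have := adj_of_mem hS h₁ h₂ hG.ne₁₂
      rw [hG.adj_junk _ _ hG.junk₁ hG.junk₂] at this
      exact this.2.1 ⟨rfl, rfl⟩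
    · have e := hp p₂ p₁ h₂ hG.junk₂ a₂
      exact h₃ (by rw [e]; simpa using hG.ne₁₃.symm)
  · have e := hp p₁ p₂ h₁ hG.junk₁ a₁
    exact h₃ (by rw [e]; simpa using hG.ne₂₃.symm)

/-- The vertices that represent a crosswise family. -/
theorem exists_crosswise (hG : TripleGraph G Real ln tw Bad p₁ p₂ p₃) (hd : d ≤ Fintype.card F)
    {ε : ℝ} (hε : ε ≤ 1 / 4) {S : Finset V} (hS : IsCommunity G 1 ε S) :
    ∃ φ : F → Fin d → F, Crosswise Finset.univ φ ∧
      ∀ v ∈ S, ∀ i, (ln v i).2 = φ (ln v i).1 := by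
  classical
  have hreal := fun v hv => hG.real_of_mem hε hS (v := v) hv
  have hc : ∀ v ∈ S, ∀ w ∈ S, ∀ i j, Compat (ln v i) (ln w j) := by
    intro v hv w hw i j
    by_cases e : v = w
    · subst e; exact hG.real_compat v (hreal v hv) i j
    · exact ((hG.adj_real v w (hreal v hv) (hreal w hw)).1 (adj_of_mem hS hv hw e)).2 i j
  -- The choice does not matter: compatible lines at the same point are equal. The value 0 at points
  -- not met by `S` is discarded by the extension below.
  let φ : F → Fin d → F := fun s => if h : ∃ v ∈ S, ∃ i, (ln v i).1 = s then
    (ln h.choose h.choose_spec.2.choose).2 else 0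
  have hφ : ∀ v ∈ S, ∀ i, (ln v i).2 = φ (ln v i).1 := by
    intro v hv i
    have h : ∃ w ∈ S, ∃ j, (ln w j).1 = (ln v i).1 := ⟨v, hv, i, rfl⟩
    simp only [φ]
    rw [dif_pos h]
    have := hc v hv h.choose h.choose_spec.1 i h.choose_spec.2.choose
    rw [← this.2 h.choose_spec.2.choose_spec.symm]
  let T : Finset F := S.biUnion fun v => Finset.univ.image fun i => (ln v i).1
  have hT : Crosswise T φ := by
    intro s hs t ht
    simp only [T, Finset.mem_biUnion, Finset.mem_image, Finset.mem_univ, true_and] at hs ht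
    obtain ⟨v, hv, i, rfl⟩ := hs
    obtain ⟨w, hw, j, rfl⟩ := ht
    rw [← hφ v hv, ← hφ w hw]
    exact (hc v hv w hw i j).1
  obtain ⟨ψ, hψ, h⟩ := hT.exists_extension hd
  refine ⟨ψ, hψ, fun v hv i => ?_⟩
  rw [hφ v hv i, h]
  simp only [T, Finset.mem_biUnion, Finset.mem_image, Finset.mem_univ, true_and]
  exact ⟨v, hv, i, rfl⟩

/-- The lines of a family at three points. -/
abbrev linesAt (φ : F → Fin d → F) (τ : Fin 3 → F) : Fin 3 → Line F d := fun i => (τ i, φ (τ i))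

omit [Field F] in
theorem card_triples {A : Finset F} :
    (Finset.univ.filter fun τ : Fin 3 → F => τ 0 ∈ A).card = A.card * Fintype.card F ^ 2 := by
  have : (Finset.univ.filter fun τ : Fin 3 → F => τ 0 ∈ A)
      = Fintype.piFinset fun i => if i = 0 then A else Finset.univ := by
    ext τ
    simp [Fintype.mem_piFinset, Fin.forall_fin_succ]
  rw [this, Fintype.card_piFinset]
  simp [Fin.prod_univ_three]
  ring

/-- The set of vertices of a crosswise family without bad triples is a community. -/
theorem isCommunity_image (hG : TripleGraph G Real ln tw Bad p₁ p₂ p₃)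
    {ε : ℝ} (hε0 : 0 ≤ ε) (hdε : (d : ℝ) - 1 ≤ ε * Fintype.card F) {φ : F → Fin d → F}
    (hφ : Crosswise Finset.univ φ) (hbad : ∀ τ, ¬ Bad (linesAt φ τ)) (vert : (Fin 3 → F) → V)
    (hvert : ∀ τ, Real (vert τ) ∧ ln (vert τ) = linesAt φ τ ∧ tw (vert τ) = false) :
    IsCommunity G 1 ε (Finset.univ.image vert) := by
  classical
  have hvi : Function.Injective vert := by
    intro τ τ' h
    have h₁ := (hvert τ).2.1
    rw [h, (hvert τ').2.1] at h₁
    funext i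
    exact (congrArg Prod.fst (congrFun h₁ i)).symm
  have hidx : ∀ τ, (fun i => (ln (vert τ) i).1) = τ := fun τ => by rw [(hvert τ).2.1]
  refine ⟨⟨vert 0, Finset.mem_image_of_mem _ (Finset.mem_univ _)⟩, ?_, ?_⟩
  · intro v hv
    obtain ⟨τ, -, rfl⟩ := Finset.mem_image.1 hv
    rw [one_mul, ties_eq_card, Finset.filter_true_of_mem]
    intro w hw
    obtain ⟨τ', -, rfl⟩ := Finset.mem_image.1 hw
    by_cases h : τ' = τ
    · left; rw [h]
    · right
      rw [hG.adj_real _ _ (hvert τ).1 (hvert τ').1, hidx, hidx]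
      refine ⟨fun e => h e.symm, fun i j => ?_⟩
      rw [(hvert τ).2.1, (hvert τ').2.1]
      exact hφ.compat _ _
  · intro u hu
    rw [Finset.card_image_of_injective _ hvi, Finset.card_univ, Fintype.card_fun, Fintype.card_fin]
    by_cases hr : Real u
    -- If all lines of `u` belonged to the family, `u` would not be a second copy, the family having
    -- no bad triples, and so `u` would be a member.
    · have hne : ∃ i, (ln u i).2 ≠ φ (ln u i).1 := by
        by_contra! hall
        have e : ln u = linesAt φ fun i => (ln u i).1 := by
          funext i
          exact Prod.ext rfl (hall i)
        cases htw : tw u with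
        | true => exact hbad _ (e ▸ hG.real_bad u hr htw)
        | false =>
          refine hu (Finset.mem_image.2 ⟨fun i => (ln u i).1, Finset.mem_univ _, ?_⟩)
          have := hvert fun i => (ln u i).1
          exact hG.inj _ _ this.1 hr (this.2.1.trans e.symm) (this.2.2.trans htw.symm)
      obtain ⟨i, hi⟩ := hne
      have hlt := hφ.card_compat_lt hi
      set A := Finset.univ.filter fun t => evalCoeff (ln u i).2 t = evalCoeff (φ t) (ln u i).1
      have hle : ties G u (Finset.univ.image vert) ≤ A.card * Fintype.card F ^ 2 := by
        rw [ties_eq_card, ← card_triples]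
        -- Only the first line of each member is compared with line `i` of `u`. It has to sit at one
        -- of the fewer than `d` points where that line agrees with the family; the other two points
        -- are arbitrary.
        refine (Finset.card_le_card (t := (Finset.univ.filter fun τ : Fin 3 → F =>
          τ 0 ∈ A).image vert) fun w hw => ?_).trans Finset.card_image_le
        obtain ⟨hw₁, hw₂⟩ := Finset.mem_filter.1 hw
        obtain ⟨τ, -, rfl⟩ := Finset.mem_image.1 hw₁
        refine Finset.mem_image_of_mem _ (Finset.mem_filter.2 ⟨Finset.mem_univ _, ?_⟩)
        have hadj := hw₂.resolve_left fun e => hu (e ▸ hw₁)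
        have := (((hG.adj_real _ _ hr (hvert τ).1).1 hadj).2 i 0).1
        rw [(hvert τ).2.1] at this
        exact Finset.mem_filter.2 ⟨Finset.mem_univ _, this⟩
      have h₁ : (ties G u (Finset.univ.image vert) : ℝ) ≤ A.card * (Fintype.card F : ℝ) ^ 2 := by
        exact_mod_cast hle
      have h₂ : (A.card : ℝ) ≤ d - 1 := by
        have : (A.card : ℝ) + 1 ≤ d := by exact_mod_cast hlt
        linarith
      calc (ties G u (Finset.univ.image vert) : ℝ) ≤ A.card * (Fintype.card F : ℝ) ^ 2 := h₁
        _ ≤ (ε * Fintype.card F) * (Fintype.card F : ℝ) ^ 2 := by gcongr; linarith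
        _ = _ := by push_cast; ring
    · have : ties G u (Finset.univ.image vert) = 0 := by
        rw [ties_eq_card, Finset.card_eq_zero, Finset.filter_eq_empty_iff]
        intro w hw h
        rcases h with rfl | h
        · exact hu hw
        · obtain ⟨τ, -, rfl⟩ := Finset.mem_image.1 hw
          exact hG.not_adj _ _ (hvert τ).1 hr h.symm
      rw [this]
      push_cast
      positivity

/-- Every community consists of the vertices of a crosswise family without bad triples. -/
theorem exists_eq_image (hG : TripleGraph G Real ln tw Bad p₁ p₂ p₃) (hd : d ≤ Fintype.card F)
    {ε : ℝ} (hε : ε ≤ 1 / 4) {S : Finset V} (hS : IsCommunity G 1 ε S) :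
    ∃ φ : F → Fin d → F, Crosswise Finset.univ φ ∧ (∀ τ, ¬ Bad (linesAt φ τ)) ∧
      ∀ v, v ∈ S ↔ ∃ τ, Real v ∧ ln v = linesAt φ τ ∧ tw v = false := by
  classical
  obtain ⟨φ, hφ, h⟩ := hG.exists_crosswise hd hε hS
  have hreal := fun v hv => hG.real_of_mem hε hS (v := v) hv
  have hln : ∀ v ∈ S, ln v = linesAt φ fun i => (ln v i).1 := fun v hv => by
    funext i
    exact Prod.ext rfl (h v hv i)
  have hadj : ∀ u τ, Real u → ln u = linesAt φ τ → ∀ w ∈ S, (fun i => (ln w i).1) ≠ τ →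
      G.Adj u w := by
    intro u τ hu hl w hw hne
    rw [hG.adj_real u w hu (hreal w hw), hl, hln w hw]
    exact ⟨fun e => hne e.symm, fun i j => hφ.compat _ _⟩
  -- If no member sits at the triple of points `τ`, the vertex of the family at `τ` is outside and
  -- adjacent to every member.
  have hex : ∀ τ, ∃ v ∈ S, (fun i => (ln v i).1) = τ := by
    intro τ
    by_contra! hno
    obtain ⟨u, hu, hl, -⟩ := hG.surj (linesAt φ τ) false (fun i j => hφ.compat _ _) (by simp)
    have huS : u ∉ S := fun hmem => hno u hmem (by rw [hl])
    obtain ⟨w, hw, hn⟩ := exists_not_adj hε hS huS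
    exact hn (hadj u τ hu hl w hw (hno w hw))
  have huniq : ∀ v ∈ S, ∀ w ∈ S, (fun i => (ln v i).1) = (fun i => (ln w i).1) → v = w := by
    intro v hv w hw e
    by_contra hne
    exact ((hG.adj_real v w (hreal v hv) (hreal w hw)).1 (adj_of_mem hS hv hw hne)).1 e
  have hcard : 2 ≤ S.card := by
    obtain ⟨v, hv, e⟩ := hex 0
    obtain ⟨w, hw, e'⟩ := hex 1
    refine Finset.one_lt_card.2 ⟨v, hv, w, hw, fun hvw => ?_⟩
    rw [hvw, e'] at e
    exact one_ne_zero (congrFun e 0)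
  -- For a bad triple, the copy that is not in `S` is adjacent to all members except its twin.
  have hgood : ∀ τ, ¬ Bad (linesAt φ τ) := by
    intro τ hb
    obtain ⟨v, hv, e⟩ := hex τ
    have hlv : ln v = linesAt φ τ := by rw [hln v hv, e]
    obtain ⟨u, hu, hl, htw⟩ := hG.surj (linesAt φ τ) (!tw v) (fun i j => hφ.compat _ _)
      fun _ => hb
    have huS : u ∉ S := by
      intro hmem
      have := huniq u hmem v hv (by rw [hl, hlv])
      rw [this] at htw
      cases htw' : tw v <;> simp [htw'] at htw
    obtain ⟨w, hw, hwv, hn⟩ := exists_two_not_adj hε hS hcard huS v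
    exact hn (hadj u τ hu hl w hw fun e' => hwv (huniq w hw v hv (e'.trans e.symm)))
  have htw : ∀ v ∈ S, tw v = false := by
    intro v hv
    by_contra h'
    have := hG.real_bad v (hreal v hv) (by simpa using h')
    rw [hln v hv] at this
    exact hgood _ this
  refine ⟨φ, hφ, hgood, fun v => ⟨fun hv => ⟨_, hreal v hv, hln v hv, htw v hv⟩, ?_⟩⟩
  rintro ⟨τ, hr, hl, ht⟩
  obtain ⟨w, hw, e⟩ := hex τ
  have : v = w := hG.inj v w hr (hreal w hw) (by rw [hl, hln w hw, e]) (ht.trans (htw w hw).symm)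
  rwa [this]

/-- The communities are in bijection with the crosswise families without bad triples. -/
theorem ncard_communities (hG : TripleGraph G Real ln tw Bad p₁ p₂ p₃) (hd : d ≤ Fintype.card F)
    {ε : ℝ} (hε0 : 0 ≤ ε) (hε : ε ≤ 1 / 4) (hdε : (d : ℝ) - 1 ≤ ε * Fintype.card F) :
    {S : Finset V | IsCommunity G 1 ε S}.ncard
      = {φ : F → Fin d → F | Crosswise Finset.univ φ ∧ ∀ τ, ¬ Bad (linesAt φ τ)}.ncard := by
  classical
  have hv : ∀ φ : F → Fin d → F, Crosswise Finset.univ φ → ∀ τ, ∃ v, Real v ∧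
      ln v = linesAt φ τ ∧ tw v = false := fun φ hφ τ =>
    hG.surj _ false (fun i j => hφ.compat _ _) (by simp)
  let vert : (φ : F → Fin d → F) → (Fin 3 → F) → V := fun φ τ =>
    if h : Crosswise Finset.univ φ then (hv φ h τ).choose else p₁
  have hvert : ∀ φ, Crosswise Finset.univ φ → ∀ τ, Real (vert φ τ) ∧
      ln (vert φ τ) = linesAt φ τ ∧ tw (vert φ τ) = false := by
    intro φ hφ τ
    simp only [vert, dif_pos hφ]
    exact (hv φ hφ τ).choose_spec
  symm
  refine Set.ncard_congr (fun φ _ => Finset.univ.image (vert φ)) ?_ ?_ ?_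
  · rintro φ ⟨hφ, hb⟩
    exact hG.isCommunity_image hε0 hdε hφ hb (vert φ) (hvert φ hφ)
  · rintro φ ψ ⟨hφ, -⟩ ⟨hψ, -⟩ e
    funext s
    -- The vertex at the constant triple `s, s, s` carries the line of the family at `s`, so the
    -- community determines the family.
    have hmem : vert φ (fun _ => s) ∈ Finset.univ.image (vert ψ) := by
      rw [← e]; exact Finset.mem_image_of_mem _ (Finset.mem_univ _)
    obtain ⟨τ, -, hτ⟩ := Finset.mem_image.1 hmem
    have h₁ := (hvert φ hφ fun _ => s).2.1
    rw [← hτ, (hvert ψ hψ τ).2.1] at h₁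
    have h₂ := congrFun h₁ 0
    have h₃ : τ 0 = s := congrArg Prod.fst h₂
    have h₄ : ψ (τ 0) = φ s := congrArg Prod.snd h₂
    rw [← h₄, h₃]
  · intro S hS
    obtain ⟨φ, hφ, hb, h⟩ := hG.exists_eq_image hd hε hS
    refine ⟨φ, ⟨hφ, hb⟩, ?_⟩
    ext v
    rw [h, Finset.mem_image]
    constructor
    · rintro ⟨τ, -, rfl⟩
      exact ⟨τ, hvert φ hφ τ⟩
    · rintro ⟨τ, hr, hl, ht⟩
      have := hvert φ hφ τ
      exact ⟨τ, Finset.mem_univ _, hG.inj _ _ this.1 hr (this.2.1.trans hl.symm)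
        (this.2.2.trans ht.symm)⟩

end TripleGraph

/-! ### Satisfying assignments as crosswise families -/

/-- The variable `v` occupies the cell `(v / m, m + v % m)` and its mirror image. -/
def Occupies (m v i t : ℕ) : Prop := (i = v / m ∧ t = m + v % m) ∨ (t = v / m ∧ i = m + v % m)

theorem Occupies.symm {m v i t : ℕ} (h : Occupies m v i t) : Occupies m v t i := Or.symm h

/-- The block of variables has row indices below `m` and column indices from `m` on, so it is
disjoint from its mirror image; within the block, quotient and remainder determine the variable. -/
theorem Occupies.unique {m v w i t : ℕ} (hv : v < m * m) (hw : w < m * m)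
    (h : Occupies m v i t) (h' : Occupies m w i t) : v = w := by
  have h₁ : v / m < m := Nat.div_lt_of_lt_mul hv
  have h₂ : w / m < m := Nat.div_lt_of_lt_mul hw
  have h₃ := Nat.div_add_mod v m
  have h₄ := Nat.div_add_mod w m
  have h₅ : v / m = w / m → v % m = w % m → v = w := by
    intro a b
    rw [← h₃, ← h₄, a, b]
  rcases h with ⟨a, b⟩ | ⟨a, b⟩ <;> rcases h' with ⟨a', b'⟩ | ⟨a', b'⟩
  · exact h₅ (by omega) (by omega)
  · omega
  · omega
  · exact h₅ (by omega) (by omega)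

section

variable {n : ℕ} (m : ℕ) {F : Type} [Field F] {d : ℕ}

/-- The values of a line at the grid are Boolean, and zero where there is no variable. -/
def GridOK (n m : ℕ) (L : Line F d) : Prop :=
  ∀ i < 2 * m, L.1 = (i : F) → ∀ t < 2 * m, evalCoeff L.2 (t : F) = 0 ∨
    (evalCoeff L.2 (t : F) = 1 ∧ ∃ v < n, Occupies m v i t)

/-- The lines satisfy the clauses whose variables they carry. -/
def ClausesOK (φ : ThreeCNF n) (L : Fin 3 → Line F d) : Prop :=
  ∀ C ∈ φ, (∀ c, (L c).1 = (((C c).1 / m : ℕ) : F)) →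
    ∃ c, (evalCoeff (L c).2 ((m + (C c).1 % m : ℕ) : F) = 1 ↔ (C c).2 = true)

/-- The lines do not come from a satisfying assignment. -/
def BadTriple (φ : ThreeCNF n) (L : Fin 3 → Line F d) : Prop :=
  ¬ ((∀ c, GridOK n m (L c)) ∧ ClausesOK m φ L)

variable {m} [Fintype F] [DecidableEq F]

/-- A family is determined by its values on the 2m × 2m grid, and every symmetric matrix occurs
there. The grid condition on single lines leaves the Boolean matrices supported on the occupied
cells, that is, the assignments. The rows of the three variables of a clause form one of the triples
of points, so the condition on triples is satisfaction of each clause. -/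
theorem ncard_good_families (hn : n ≤ m * m) (hinj : Set.InjOn (Nat.cast : ℕ → F) {i | i < 2 * m})
    (φ : ThreeCNF n) :
    {ψ : F → Fin (2 * m) → F | Crosswise Finset.univ ψ ∧
      ∀ τ, ¬ BadTriple m φ (TripleGraph.linesAt ψ τ)}.ncard = φ.satCount := by
  classical
  let T : Finset F := (Finset.range (2 * m)).image Nat.cast
  have hT : T.card = 2 * m := by
    rw [Finset.card_image_of_injOn, Finset.card_range]
    intro a ha b hb e
    exact hinj (by simpa using ha) (by simpa using hb) e
  have hTmem : ∀ t ∈ T, ∃ i < 2 * m, (i : F) = t := by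
    intro t ht
    obtain ⟨i, hi, rfl⟩ := Finset.mem_image.1 ht
    exact ⟨i, Finset.mem_range.1 hi, rfl⟩
  have hmemT : ∀ i < 2 * m, (i : F) ∈ T := fun i hi =>
    Finset.mem_image_of_mem _ (Finset.mem_range.2 hi)
  have hvar : ∀ v : Fin n, (v : ℕ) < m * m := fun v => v.2.trans_le hn
  have hm : ∀ v : Fin n, 0 < m := fun v => by
    have := hvar v
    rcases Nat.eq_zero_or_pos m with h | h
    · subst h; simp at this
    · exact h
  have hrow : ∀ v : Fin n, (v : ℕ) / m < 2 * m := fun v => by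
    have := Nat.div_lt_of_lt_mul (hvar v)
    omega
  have hcol : ∀ v : Fin n, m + (v : ℕ) % m < 2 * m := fun v => by
    have := Nat.mod_lt (v : ℕ) (hm v)
    omega
  let asg : (F → Fin (2 * m) → F) → Fin n → Bool := fun ψ v =>
    decide (evalCoeff (ψ (((v : ℕ) / m : ℕ) : F)) ((m + (v : ℕ) % m : ℕ) : F) = 1)
  have hgood : ∀ ψ : F → Fin (2 * m) → F, (∀ τ, ¬ BadTriple m φ (TripleGraph.linesAt ψ τ)) →
      (∀ s, GridOK n m ((s, ψ s) : Line F (2 * m))) ∧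
        ∀ τ, ClausesOK m φ (TripleGraph.linesAt ψ τ) := by
    intro ψ h
    simp only [BadTriple, not_not] at h
    -- Constant triples give the grid condition for each single line.
    exact ⟨fun s => (h fun _ => s).1 0, fun τ => (h τ).2⟩
  rw [ThreeCNF.satCount]
  refine Set.ncard_congr (fun ψ _ => asg ψ) ?_ ?_ ?_
  · rintro ψ ⟨-, hb⟩ C hC
    obtain ⟨-, h⟩ := hgood ψ hb
    obtain ⟨c, hc⟩ := h (fun c => (((C c).1 / m : ℕ) : F)) C hC fun c => rfl
    refine ⟨c, ?_⟩
    simp only [asg]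
    by_cases h1 : (C c).2 = true
    · rw [h1, decide_eq_true_iff]; exact hc.2 h1
    · rw [Bool.not_eq_true] at h1
      rw [h1, decide_eq_false_iff_not]
      exact fun e => by simpa [h1] using hc.1 e
  · rintro ψ ψ' ⟨hψ, hb⟩ ⟨hψ', hb'⟩ e
    refine hψ.eq_of_grid hT.ge hψ' fun s hs t ht => ?_
    obtain ⟨i, hi, rfl⟩ := hTmem s hs
    obtain ⟨j, hj, rfl⟩ := hTmem t ht
    have val : ∀ ψ : F → Fin (2 * m) → F, Crosswise Finset.univ ψ →
        (∀ τ, ¬ BadTriple m φ (TripleGraph.linesAt ψ τ)) → ∀ v : Fin n, Occupies m v i j →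
        (evalCoeff (ψ i) j = 1 ↔ asg ψ v = true) := by
      intro ψ hψ hb v hv
      simp only [asg, decide_eq_true_iff]
      rcases hv with ⟨rfl, rfl⟩ | ⟨rfl, rfl⟩
      · rfl
      · rw [hψ _ (Finset.mem_univ _) _ (Finset.mem_univ _)]
    have o₁ := (hgood ψ hb).1 i i hi rfl j hj
    have o₂ := (hgood ψ' hb').1 i i hi rfl j hj
    by_cases hv : ∃ v < n, Occupies m v i j
    · obtain ⟨v, hvn, hv⟩ := hv
      have e₁ := val ψ hψ hb ⟨v, hvn⟩ hv
      have e₂ := val ψ' hψ' hb' ⟨v, hvn⟩ hv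
      rw [← show asg ψ = asg ψ' from e] at e₂
      have e₃ := e₁.trans e₂.symm
      rcases o₁ with o₁ | ⟨o₁, -⟩ <;> rcases o₂ with o₂ | ⟨o₂, -⟩
      · exact o₁.trans o₂.symm
      · exact (e₃.2 o₂).trans o₂.symm
      · exact o₁.trans (e₃.1 o₁).symm
      · exact o₁.trans o₂.symm
    · rw [o₁.resolve_right fun h => hv h.2, o₂.resolve_right fun h => hv h.2]
  · intro x hx
    let M : F → F → F := fun s t => if ∃ i j, i < 2 * m ∧ j < 2 * m ∧ (i : F) = s ∧ (j : F) = t ∧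
      ∃ v : Fin n, x v = true ∧ Occupies m v i j then 1 else 0
    have hM : ∀ i < 2 * m, ∀ j < 2 * m, M i j =
        if ∃ v : Fin n, x v = true ∧ Occupies m v i j then 1 else 0 := by
      intro i hi j hj
      simp only [M]
      congr 1
      apply propext
      constructor
      · rintro ⟨i', j', hi', hj', ei, ej, h⟩
        rw [hinj hi' hi ei, hinj hj' hj ej] at h
        exact h
      · intro h
        exact ⟨i, j, hi, hj, rfl, rfl, h⟩
    obtain ⟨ψ, hψ, h⟩ := exists_crosswise_of_grid hT M (by
      intro s t
      simp only [M]
      congr 1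
      apply propext
      constructor
      · rintro ⟨i, j, hi, hj, ei, ej, v, hx, h⟩
        exact ⟨j, i, hj, hi, ej, ei, v, hx, h.symm⟩
      · rintro ⟨i, j, hi, hj, ei, ej, v, hx, h⟩
        exact ⟨j, i, hj, hi, ej, ei, v, hx, h.symm⟩)
    have hval : ∀ i < 2 * m, ∀ j < 2 * m, evalCoeff (ψ i) j =
        if ∃ v : Fin n, x v = true ∧ Occupies m v i j then (1 : F) else 0 := fun i hi j hj => by
      rw [h _ (hmemT i hi) _ (hmemT j hj), hM i hi j hj]
    have hx1 : ∀ v : Fin n, (evalCoeff (ψ (((v : ℕ) / m : ℕ) : F)) ((m + (v : ℕ) % m : ℕ) : F) = 1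
        ↔ x v = true) := by
      intro v
      rw [hval _ (hrow v) _ (hcol v)]
      by_cases hv : x v = true
      · rw [if_pos ⟨v, hv, Or.inl ⟨rfl, rfl⟩⟩]; simp [hv]
      · rw [if_neg]
        · simp [hv]
        · rintro ⟨w, hw, ho⟩
          have := Occupies.unique (hvar w) (hvar v) ho (Or.inl ⟨rfl, rfl⟩)
          rw [Fin.ext this] at hw
          exact hv hw
    refine ⟨ψ, ⟨hψ, fun τ => ?_⟩, ?_⟩
    · simp only [BadTriple, not_not]
      refine ⟨fun c i hi hs t ht => ?_, fun C hC hidx => ?_⟩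
      · change τ c = (i : F) at hs
        change evalCoeff (ψ (τ c)) _ = 0 ∨ (evalCoeff (ψ (τ c)) _ = 1 ∧ _)
        rw [hs, hval i hi t ht]
        by_cases hv : ∃ v : Fin n, x v = true ∧ Occupies m v i t
        · rw [if_pos hv]
          obtain ⟨v, -, ho⟩ := hv
          exact Or.inr ⟨rfl, v, v.2, ho⟩
        · rw [if_neg hv]; exact Or.inl rfl
      · obtain ⟨c, hc⟩ := hx C hC
        refine ⟨c, ?_⟩
        have := hidx c
        change τ c = _ at this
        change evalCoeff (ψ (τ c)) _ = 1 ↔ _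
        rw [this, hx1, hc]
    · funext v
      have := hx1 v
      simp only [asg]
      by_cases hv : x v = true
      · rw [hv, decide_eq_true_iff]; exact this.2 hv
      · rw [Bool.not_eq_true] at hv
        rw [hv, decide_eq_false_iff_not, this, hv]; simp

end

/-! ### The reduction in terms of numbers -/

/-- The digit number `i` of `y` in base `q`. -/
def dig (q y i : ℕ) : ℕ := y / q ^ i % q

/-- Modular powers, with the value `0` for the modulus `0`. -/
def powMod (t i q : ℕ) : ℕ := if q = 0 then 0 else t ^ i % q

/-- The point of the line number `c` of `y`. -/
def lineIdx (q d y c : ℕ) : ℕ := dig q y (c * (d + 1))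

/-- A coefficient of the line number `c` of `y`. -/
def lineCoeff (q d y c i : ℕ) : ℕ := dig q y (c * (d + 1) + 1 + i)

/-- A value of the line number `c` of `y`. -/
def lineVal (q d y c t : ℕ) : ℕ :=
  (∑ i ∈ Finset.range d, lineCoeff q d y c i * powMod t i q) % q

/-- Compatibility of lines. -/
def CompatN (q d y c y' c' : ℕ) : Prop :=
  lineVal q d y c (lineIdx q d y' c') = lineVal q d y' c' (lineIdx q d y c) ∧
    (lineIdx q d y c = lineIdx q d y' c' → ∀ i < d, lineCoeff q d y c i = lineCoeff q d y' c' i)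

/-- The first position from `p` on that carries no `true` (if the word contains a `false` there). -/
def nextFalse (l : List Bool) (p : ℕ) : ℕ :=
  p + ((Finset.range l.length).filter fun i => ∀ j < i + 1, letter l (p + j) = 2).card

/-- The position of a literal in the code of a formula. -/
def litPos (l : List Bool) (j : ℕ) : ℕ := (fun p => nextFalse l p + 2)^[j] (nextFalse l 0 + 1)

/-- The variable of a literal in the code of a formula. -/
def litVar (l : List Bool) (j : ℕ) : ℕ := nextFalse l (litPos l j) - litPos l j

/-- A literal in the code of a formula is positive. -/
def LitPositive (l : List Bool) (j : ℕ) : Prop := letter l (nextFalse l (litPos l j) + 1) = 2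

/-- The lines of `y` have admissible values at the grid. -/
def GridN (n m q y : ℕ) : Prop :=
  ∀ c < 3, ∀ i < 2 * m, lineIdx q (2 * m) y c = i → ∀ t < 2 * m, lineVal q (2 * m) y c t = 0 ∨
    (lineVal q (2 * m) y c t = 1 ∧ ∃ v < n, Occupies m v i t)

/-- The lines of `y` satisfy the clauses whose variables they carry. -/
def ClausesN (l : List Bool) (m q y : ℕ) : Prop :=
  ∀ j < l.length, litPos l (3 * j) < l.length →
    (∀ c < 3, lineIdx q (2 * m) y c = litVar l (3 * j + c) / m) →
    ∃ c < 3, (lineVal q (2 * m) y c (m + litVar l (3 * j + c) % m) = 1 ↔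
      LitPositive l (3 * j + c))

/-- The number codes a triple of lines that is a proper vertex. -/
def RealN (l : List Bool) (n m q x : ℕ) : Prop :=
  x / 2 / q ^ (3 * (2 * m + 1)) = 0 ∧
  (∀ c < 3, ∀ c' < 3, CompatN q (2 * m) (x / 2) c (x / 2) c') ∧
  (x % 2 = 1 → ¬ (GridN n m q (x / 2) ∧ ClausesN l m q (x / 2)))

/-- Adjacency of vertices. -/
def AdjN (l : List Bool) (n m q N x y : ℕ) : Prop :=
  (RealN l n m q x ∧ RealN l n m q y ∧
    (∃ c < 3, lineIdx q (2 * m) (x / 2) c ≠ lineIdx q (2 * m) (y / 2) c) ∧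
    ∀ c < 3, ∀ c' < 3, CompatN q (2 * m) (x / 2) c (y / 2) c') ∨
  (¬ RealN l n m q x ∧ ¬ RealN l n m q y ∧ x ≠ y ∧ ¬ (x = N - 1 ∧ y = N - 2) ∧
    ¬ (x = N - 2 ∧ y = N - 1))

/-! ### The reduction is computable in polynomial time from unary arguments -/

namespace UnaryPoly

variable {k : ℕ} {f g h f₁ f₂ f₃ f₄ f₅ : List Bool → (Fin k → ℕ) → ℕ}

/-- Repeated division never forms the power, which need not be polynomially bounded. For this reason
`RealN` expresses the bound on a code by a vanishing quotient. -/
theorem divPow (hf : UnaryPoly f) (hg : UnaryPoly g) (hh : UnaryPoly h) :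
    UnaryPoly fun l v => f l v / g l v ^ h l v :=
  prec hh hf (h := fun l w => w 1 / g l (Fin.tail (Fin.tail w))) ((proj 1).div hg.weaken.weaken)
    (fun l i v => f l v / g l v ^ i) (fun _ _ => by simp)
    (fun l i v => by
      change _ = f l v / g l v ^ i / g l v
      rw [Nat.div_div_eq_div_mul, pow_succ])
    (hf.polyBdd.tail.of_le fun _ _ => Nat.div_le_self _ _)

theorem dig (hf : UnaryPoly f) (hg : UnaryPoly g) (hh : UnaryPoly h) :
    UnaryPoly fun l v => dig (f l v) (g l v) (h l v) :=
  (hg.divPow hf hh).mod hf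

/-- Reducing in each round bounds the intermediate values by the modulus. The convention for modulus
0 is needed here, since `t ^ i % 0` is the full power. -/
theorem powMod (hf : UnaryPoly f) (hg : UnaryPoly g) (hh : UnaryPoly h) :
    UnaryPoly fun l v => powMod (f l v) (g l v) (h l v) := by
  refine prec hg (g := fun l v => if h l v = 0 then 0 else 1 % h l v)
    (UnaryDec.ite (UnaryDec.eq hh (const 0)) (const 0) ((const 1).mod hh))
    (h := fun l w => if h l (Fin.tail (Fin.tail w)) = 0 then 0 else
      (w 1 * f l (Fin.tail (Fin.tail w))) % h l (Fin.tail (Fin.tail w)))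
    (UnaryDec.ite (UnaryDec.eq hh.weaken.weaken (const 0)) (const 0)
      (((proj 1).mul hf.weaken.weaken).mod hh.weaken.weaken))
    (fun l i v => _root_.powMod (f l v) i (h l v)) (fun _ _ => by simp [_root_.powMod])
    (fun l i v => ?_) (hh.polyBdd.tail.of_le fun l v => ?_)
  · change (if h l v = 0 then 0 else _) = if h l v = 0 then 0 else
      (_root_.powMod (f l v) i (h l v) * f l v) % h l v
    by_cases h0 : h l v = 0
    · simp [h0]
    · simp [h0, _root_.powMod, pow_succ, Nat.mod_mul_mod]
  · unfold _root_.powMod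
    split_ifs with h0
    · omega
    · exact (Nat.mod_lt _ (Nat.pos_of_ne_zero h0)).le

theorem sqrt (hf : UnaryPoly f) : UnaryPoly fun l v => Nat.sqrt (f l v) := by
  have := count (P := fun l w => (w 0 + 1) * (w 0 + 1) ≤ f l (Fin.tail w)) hf
    (UnaryDec.le ((proj 0).succ.mul (proj 0).succ) hf.weaken)
  convert this using 3 with l v
  simp only [Fin.tail_cons, Fin.cons_zero]
  rw [← Finset.card_range (Nat.sqrt (f l v))]
  congr 1
  ext i
  have h₁ := Nat.sqrt_le_self (f l v)
  have h₂ := Nat.le_sqrt (m := i + 1) (n := f l v)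
  simp only [Finset.mem_filter, Finset.mem_range]
  constructor
  · intro h; exact ⟨by omega, h₂.1 h⟩
  · intro h; exact h₂.2 h.2

theorem log (hf : UnaryPoly f) : UnaryPoly fun l v => Nat.log 2 (f l v) := by
  have := count (P := fun l w => 0 < f l (Fin.tail w) / 2 ^ (w 0 + 1)) hf
    (UnaryDec.lt (const 0) (hf.weaken.divPow (const 2) (proj 0).succ))
  convert this using 3 with l v
  simp only [Fin.tail_cons, Fin.cons_zero]
  rw [← Finset.card_range (Nat.log 2 (f l v))]
  congr 1
  ext i
  have h₁ := Nat.log_le_self 2 (f l v)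
  simp only [Finset.mem_filter, Finset.mem_range, Nat.div_pos_iff, Nat.pow_pos, true_and,
    Nat.ofNat_pos]
  constructor
  · intro h
    exact ⟨by omega, Nat.pow_le_of_le_log (by rintro h0; simp [h0] at h) h⟩
  · intro h
    exact Nat.le_log_of_pow_le (by norm_num) h.2

theorem min (hf : UnaryPoly f) (hg : UnaryPoly g) : UnaryPoly fun l v => min (f l v) (g l v) :=
  UnaryDec.ite (UnaryDec.le hf hg) hf hg

/-- Capping each doubling keeps the recursion polynomially bounded. Where the power is known to be
at most the cap, this computes the power itself. -/
theorem minPow (hf : UnaryPoly f) (hg : UnaryPoly g) :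
    UnaryPoly fun l v => Min.min (2 ^ f l v) (g l v) :=
  prec hf ((const 1).min hg) (h := fun l w => Min.min (2 * w 1) (g l (Fin.tail (Fin.tail w))))
    (((const 2).mul (proj 1)).min hg.weaken.weaken) (fun l i v => Min.min (2 ^ i) (g l v))
    (fun _ _ => rfl) (fun l i v => by
      change _ = Min.min (2 * Min.min (2 ^ i) (g l v)) (g l v)
      rw [pow_succ]; omega)
    (hg.polyBdd.tail.of_le fun _ _ => min_le_right _ _)

theorem lineIdx (h₁ : UnaryPoly f₁) (h₂ : UnaryPoly f₂) (h₃ : UnaryPoly f₃) (h₄ : UnaryPoly f₄) :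
    UnaryPoly fun l v => lineIdx (f₁ l v) (f₂ l v) (f₃ l v) (f₄ l v) :=
  dig h₁ h₃ (h₄.mul h₂.succ)

theorem lineCoeff (h₁ : UnaryPoly f₁) (h₂ : UnaryPoly f₂) (h₃ : UnaryPoly f₃) (h₄ : UnaryPoly f₄)
    (h₅ : UnaryPoly f₅) :
    UnaryPoly fun l v => lineCoeff (f₁ l v) (f₂ l v) (f₃ l v) (f₄ l v) (f₅ l v) :=
  dig h₁ h₃ ((h₄.mul h₂.succ).succ.add h₅)

theorem lineVal (h₁ : UnaryPoly f₁) (h₂ : UnaryPoly f₂) (h₃ : UnaryPoly f₃) (h₄ : UnaryPoly f₄)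
    (h₅ : UnaryPoly f₅) :
    UnaryPoly fun l v => lineVal (f₁ l v) (f₂ l v) (f₃ l v) (f₄ l v) (f₅ l v) :=
  (sum h₂ (F := fun l w => _root_.lineCoeff (f₁ l (Fin.tail w)) (f₂ l (Fin.tail w))
    (f₃ l (Fin.tail w)) (f₄ l (Fin.tail w)) (w 0) *
      _root_.powMod (f₅ l (Fin.tail w)) (w 0) (f₁ l (Fin.tail w)))
    ((lineCoeff h₁.weaken h₂.weaken h₃.weaken h₄.weaken (proj 0)).mul
      (powMod h₅.weaken (proj 0) h₁.weaken))).mod h₁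

theorem nextFalse (hf : UnaryPoly f) : UnaryPoly fun l v => nextFalse l (f l v) := by
  have := hf.add (count (P := fun l w => ∀ j < w 0 + 1, _root_.letter l (f l (Fin.tail w) + j) = 2)
    length (UnaryDec.ball (P := fun l u => _root_.letter l (f l (Fin.tail (Fin.tail u)) + u 0) = 2)
      (proj 0).succ (UnaryDec.eq (letter (hf.weaken.weaken.add (proj 0))) (const 2))))
  convert this using 3
  rfl

/-- Each literal moves the position by at most the length of the word plus 2, which gives the bound
needed for the recursion. -/
theorem litPos (hf : UnaryPoly f) : UnaryPoly fun l v => litPos l (f l v) := by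
  refine prec hf (g := fun l _ => _root_.nextFalse l 0 + 1) (nextFalse (const 0)).succ
    (h := fun l w => _root_.nextFalse l (w 1) + 2) ((nextFalse (proj 1)).add (const 2))
    (fun l i _ => _root_.litPos l i) (fun _ _ => rfl)
    (fun l i v => Function.iterate_succ_apply' _ _ _) ?_
  refine PolyBdd.of_le ((((PolyBdd.proj 0).add (.const 1)).mul (PolyBdd.length.add (.const 2))))
    fun l v => ?_
  have hle : ∀ p, _root_.nextFalse l p ≤ p + l.length := fun p => by
    have := Finset.card_filter_le (Finset.range l.length) fun i =>
      ∀ j < i + 1, _root_.letter l (p + j) = 2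
    rw [Finset.card_range] at this
    unfold _root_.nextFalse
    omega
  generalize v 0 = i
  induction i with
  | zero =>
    have := hle 0
    change _root_.nextFalse l 0 + 1 ≤ _
    omega
  | succ i ih =>
    have e : _root_.litPos l (i + 1) = _root_.nextFalse l (_root_.litPos l i) + 2 :=
      Function.iterate_succ_apply' _ _ _
    rw [e]
    have := hle (_root_.litPos l i)
    nlinarith

theorem litVar (hf : UnaryPoly f) : UnaryPoly fun l v => litVar l (f l v) :=
  (nextFalse (litPos hf)).sub (litPos hf)

end UnaryPoly

namespace UnaryDec

open UnaryPoly

variable {k : ℕ} {f g h f₁ f₂ f₃ f₄ f₅ f₆ : List Bool → (Fin k → ℕ) → ℕ}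

theorem litPositive (hf : UnaryPoly f) : UnaryDec fun l v => LitPositive l (f l v) :=
  eq (letter (nextFalse (litPos hf)).succ) (const 2)

theorem compatN (h₁ : UnaryPoly f₁) (h₂ : UnaryPoly f₂) (h₃ : UnaryPoly f₃) (h₄ : UnaryPoly f₄)
    (h₅ : UnaryPoly f₅) (h₆ : UnaryPoly f₆) : UnaryDec fun l v =>
      CompatN (f₁ l v) (f₂ l v) (f₃ l v) (f₄ l v) (f₅ l v) (f₆ l v) :=
  (eq (lineVal h₁ h₂ h₃ h₄ (lineIdx h₁ h₂ h₅ h₆)) (lineVal h₁ h₂ h₅ h₆ (lineIdx h₁ h₂ h₃ h₄))).and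
    ((eq (lineIdx h₁ h₂ h₃ h₄) (lineIdx h₁ h₂ h₅ h₆)).imp
      (ball (P := fun l w => _root_.lineCoeff (f₁ l (Fin.tail w)) (f₂ l (Fin.tail w))
        (f₃ l (Fin.tail w)) (f₄ l (Fin.tail w)) (w 0) = _root_.lineCoeff (f₁ l (Fin.tail w))
          (f₂ l (Fin.tail w)) (f₅ l (Fin.tail w)) (f₆ l (Fin.tail w)) (w 0)) h₂
        (eq (lineCoeff h₁.weaken h₂.weaken h₃.weaken h₄.weaken (proj 0))
          (lineCoeff h₁.weaken h₂.weaken h₅.weaken h₆.weaken (proj 0)))))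

theorem occupies (h₁ : UnaryPoly f₁) (h₂ : UnaryPoly f₂) (h₃ : UnaryPoly f₃) (h₄ : UnaryPoly f₄) :
    UnaryDec fun l v => Occupies (f₁ l v) (f₂ l v) (f₃ l v) (f₄ l v) :=
  ((eq h₃ (h₂.div h₁)).and (eq h₄ (h₁.add (h₂.mod h₁)))).or
    ((eq h₄ (h₂.div h₁)).and (eq h₃ (h₁.add (h₂.mod h₁))))

/-- The parameters are, in this order, `n`, `m`, `q` and `y`. -/
theorem gridN_base : UnaryDec (k := 4) fun _ v => GridN (v 0) (v 1) (v 2) (v 3) := by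
  -- Each quantified variable is put in front and shifts the others by one; the coordinates here are
  -- the variable, `t`, `i`, `c`, followed by `n`, `m`, `q`, `y`.
  have h₁ : UnaryDec (k := 8) fun _ u => Occupies (u 5) (u 0) (u 2) (u 1) :=
    occupies (proj 5) (proj 0) (proj 2) (proj 1)
  have h₂ : UnaryDec (k := 7) fun _ u => ∃ v < u 3, Occupies (u 4) v (u 1) (u 0) :=
    bex (proj 3) h₁
  have hv : UnaryPoly (k := 7) fun _ u => _root_.lineVal (u 5) (2 * u 4) (u 6) (u 2) (u 0) :=
    lineVal (proj 5) ((const 2).mul (proj 4)) (proj 6) (proj 2) (proj 0)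
  have h₃ : UnaryDec (k := 6) fun _ u => ∀ t < 2 * u 3,
      _root_.lineVal (u 4) (2 * u 3) (u 5) (u 1) t = 0 ∨
        (_root_.lineVal (u 4) (2 * u 3) (u 5) (u 1) t = 1 ∧
          ∃ v < u 2, Occupies (u 3) v (u 0) t) :=
    ball ((const 2).mul (proj 3)) ((eq hv (const 0)).or ((eq hv (const 1)).and h₂))
  have h₄ : UnaryDec (k := 6) fun _ u => _root_.lineIdx (u 4) (2 * u 3) (u 5) (u 1) = u 0 :=
    eq (lineIdx (proj 4) ((const 2).mul (proj 3)) (proj 5) (proj 1)) (proj 0)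
  have h₅ : UnaryDec (k := 5) fun _ u => ∀ i < 2 * u 2, _root_.lineIdx (u 3) (2 * u 2) (u 4) (u 0) =
      i → ∀ t < 2 * u 2, _root_.lineVal (u 3) (2 * u 2) (u 4) (u 0) t = 0 ∨
        (_root_.lineVal (u 3) (2 * u 2) (u 4) (u 0) t = 1 ∧ ∃ v < u 1, Occupies (u 2) v i t) :=
    ball ((const 2).mul (proj 2)) (h₄.imp h₃)
  exact ball (const 3) h₅

/-- The parameters are, in this order, `m`, `q` and `y`. -/
theorem clausesN_base : UnaryDec (k := 3) fun l v => ClausesN l (v 0) (v 1) (v 2) := by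
  -- The coordinates are `c`, `j`, `m`, `q`, `y`.
  have hl : UnaryPoly (k := 5) fun _ u => 3 * u 1 + u 0 := ((const 3).mul (proj 1)).add (proj 0)
  have h₁ : UnaryDec (k := 5) fun l u => _root_.lineVal (u 3) (2 * u 2) (u 4) (u 0)
      (u 2 + _root_.litVar l (3 * u 1 + u 0) % u 2) = 1 ↔ LitPositive l (3 * u 1 + u 0) :=
    iff (eq (lineVal (proj 3) ((const 2).mul (proj 2)) (proj 4) (proj 0)
      ((proj 2).add ((litVar hl).mod (proj 2)))) (const 1)) (litPositive hl)
  have h₂ : UnaryDec (k := 5) fun l u => _root_.lineIdx (u 3) (2 * u 2) (u 4) (u 0) =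
      _root_.litVar l (3 * u 1 + u 0) / u 2 :=
    eq (lineIdx (proj 3) ((const 2).mul (proj 2)) (proj 4) (proj 0)) ((litVar hl).div (proj 2))
  have h₃ : UnaryDec (k := 4) fun l u => ∃ c < 3, (_root_.lineVal (u 2) (2 * u 1) (u 3) c
      (u 1 + _root_.litVar l (3 * u 0 + c) % u 1) = 1 ↔ LitPositive l (3 * u 0 + c)) :=
    bex (const 3) h₁
  have h₄ : UnaryDec (k := 4) fun l u => ∀ c < 3, _root_.lineIdx (u 2) (2 * u 1) (u 3) c =
      _root_.litVar l (3 * u 0 + c) / u 1 :=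
    ball (const 3) h₂
  have h₅ : UnaryDec (k := 4) fun l u => _root_.litPos l (3 * u 0) < l.length :=
    lt (litPos ((const 3).mul (proj 0))) length
  exact ball length (h₅.imp (h₄.imp h₃))

/-- The parameters are, in this order, `q`, `d`, `y` and `y'`. -/
theorem compatN_all_base : UnaryDec (k := 4) fun _ v =>
    ∀ c < 3, ∀ c' < 3, CompatN (v 0) (v 1) (v 2) c (v 3) c' := by
  have h₁ : UnaryDec (k := 6) fun _ u => CompatN (u 2) (u 3) (u 4) (u 1) (u 5) (u 0) :=
    compatN (proj 2) (proj 3) (proj 4) (proj 1) (proj 5) (proj 0)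
  have h₂ : UnaryDec (k := 5) fun _ u => ∀ c' < 3, CompatN (u 1) (u 2) (u 3) (u 0) (u 4) c' :=
    ball (const 3) h₁
  exact ball (const 3) h₂

theorem compatN_all (h₁ : UnaryPoly f₁) (h₂ : UnaryPoly f₂) (h₃ : UnaryPoly f₃)
    (h₄ : UnaryPoly f₄) : UnaryDec fun l v =>
      ∀ c < 3, ∀ c' < 3, CompatN (f₁ l v) (f₂ l v) (f₃ l v) c (f₄ l v) c' :=
  compatN_all_base.subst ![f₁, f₂, f₃, f₄] (by intro j; fin_cases j; exacts [h₁, h₂, h₃, h₄])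

theorem realN (h₁ : UnaryPoly f₁) (h₂ : UnaryPoly f₂) (h₃ : UnaryPoly f₃) (h₄ : UnaryPoly f₄) :
    UnaryDec fun l v => RealN l (f₁ l v) (f₂ l v) (f₃ l v) (f₄ l v) := by
  have hx := h₄.div (const 2)
  have hd := (const (k := k) 2).mul h₂
  have hg : UnaryDec fun l v => GridN (f₁ l v) (f₂ l v) (f₃ l v) (f₄ l v / 2) :=
    gridN_base.subst ![f₁, f₂, f₃, fun l v => f₄ l v / 2]
      (by intro j; fin_cases j; exacts [h₁, h₂, h₃, hx])
  have hc : UnaryDec fun l v => ClausesN l (f₂ l v) (f₃ l v) (f₄ l v / 2) :=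
    clausesN_base.subst ![f₂, f₃, fun l v => f₄ l v / 2]
      (by intro j; fin_cases j; exacts [h₂, h₃, hx])
  exact (eq (hx.divPow h₃ ((const 3).mul hd.succ)) (const 0)).and
    ((compatN_all h₃ hd hx hx).and ((eq (h₄.mod (const 2)) (const 1)).imp (hg.and hc).not))

theorem adjN (h₁ : UnaryPoly f₁) (h₂ : UnaryPoly f₂) (h₃ : UnaryPoly f₃) (h₄ : UnaryPoly f₄)
    (h₅ : UnaryPoly f₅) (h₆ : UnaryPoly f₆) :
    UnaryDec fun l v => AdjN l (f₁ l v) (f₂ l v) (f₃ l v) (f₄ l v) (f₅ l v) (f₆ l v) := by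
  have hd := (const (k := k) 2).mul h₂
  have hx := h₅.div (const 2)
  have hy := h₆.div (const 2)
  have hne : UnaryDec fun l v => ∃ c < 3, _root_.lineIdx (f₃ l v) (2 * f₂ l v) (f₅ l v / 2) c ≠
      _root_.lineIdx (f₃ l v) (2 * f₂ l v) (f₆ l v / 2) c :=
    bex (P := fun l w => _root_.lineIdx (f₃ l (Fin.tail w)) (2 * f₂ l (Fin.tail w))
      (f₅ l (Fin.tail w) / 2) (w 0) ≠ _root_.lineIdx (f₃ l (Fin.tail w)) (2 * f₂ l (Fin.tail w))
        (f₆ l (Fin.tail w) / 2) (w 0)) (const 3)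
      (eq (lineIdx h₃.weaken hd.weaken hx.weaken (proj 0))
        (lineIdx h₃.weaken hd.weaken hy.weaken (proj 0))).not
  have r₁ := realN h₁ h₂ h₃ h₅
  have r₂ := realN h₁ h₂ h₃ h₆
  have n₁ := h₄.sub (const 1)
  have n₂ := h₄.sub (const 2)
  exact (r₁.and (r₂.and (hne.and (compatN_all h₃ hd hx hy)))).or
    (r₁.not.and (r₂.not.and ((eq h₅ h₆).not.and (((eq h₅ n₁).and (eq h₆ n₂)).not.and
      ((eq h₅ n₂).and (eq h₆ n₁)).not))))

theorem prime (hf : UnaryPoly f) : UnaryDec fun l v => Nat.Prime (f l v) := by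
  have h₁ : UnaryDec (k := 3) fun _ u => u 1 * u 0 = u 2 :=
    eq ((proj 1).mul (proj 0)) (proj 2)
  have h₂ : UnaryDec (k := 2) fun _ u => ∃ y < u 1 + 1, u 0 * y = u 1 :=
    bex (proj 1).succ h₁
  have h₃ : UnaryDec (k := 1) fun _ u => ∀ x < u 0, 2 ≤ x → ¬ ∃ y < u 0 + 1, x * y = u 0 :=
    ball (proj 0) ((le (const 2) (proj 0)).imp h₂.not)
  have h₄ : UnaryDec (k := 1) fun _ u => Nat.Prime (u 0) := by
    refine ((le (const 2) (proj 0)).and h₃).of_iff fun l u => ?_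
    rw [Nat.prime_def_lt']
    refine and_congr_right fun h2 => forall_congr' fun x => ?_
    rw [imp.swap]
    refine imp_congr_right fun _ => imp_congr_right fun hx2 => not_congr ⟨?_, ?_⟩
    · rintro ⟨y, hy⟩
      exact ⟨y, by rw [hy]; nlinarith, hy.symm⟩
    · rintro ⟨y, -, hy⟩
      exact ⟨y, hy.symm⟩
  exact h₄.subst ![f] (by intro j; fin_cases j; exact hf)

end UnaryDec

/-! ### The least prime above a bound, and Bertrand's postulate. -/

theorem exists_prime_gt (B : ℕ) : ∃ p, p.Prime ∧ B < p :=
  let ⟨p, hp, h⟩ := Nat.exists_infinite_primes (B + 1)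
  ⟨p, h, hp⟩

open Classical in
/-- The least prime number that is larger than `B`. -/
noncomputable def nextPrime (B : ℕ) : ℕ := Nat.find (exists_prime_gt B)

theorem nextPrime_prime (B : ℕ) : (nextPrime B).Prime := by
  classical exact (Nat.find_spec (exists_prime_gt B)).1

theorem lt_nextPrime (B : ℕ) : B < nextPrime B := by
  classical exact (Nat.find_spec (exists_prime_gt B)).2

theorem nextPrime_le {B : ℕ} (hB : B ≠ 0) : nextPrime B ≤ 2 * B := by
  classical
  obtain ⟨p, hp, h₁, h₂⟩ := Nat.exists_prime_lt_and_le_two_mul B hB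
  exact (Nat.find_min' (exists_prime_gt B) ⟨hp, h₁⟩).trans h₂

/-- The minimum counts the numbers below the cap up to which no prime larger than the bound occurs.
The cap limits the search. -/
theorem UnaryPoly.minNextPrime {k : ℕ} {f g : List Bool → (Fin k → ℕ) → ℕ} (hf : UnaryPoly f)
    (hg : UnaryPoly g) : UnaryPoly fun l v => Min.min (nextPrime (f l v)) (g l v) := by
  classical
  have := count (P := fun l w => ∀ p < w 0 + 1, ¬ (p.Prime ∧ f l (Fin.tail w) < p)) hg
    (UnaryDec.ball (P := fun l u => ¬ ((u 0).Prime ∧ f l (Fin.tail (Fin.tail u)) < u 0))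
      (proj 0).succ ((UnaryDec.prime (proj 0)).and (UnaryDec.lt hf.weaken.weaken (proj 0))).not)
  convert this using 3 with l v
  simp only [Fin.tail_cons, Fin.cons_zero]
  rw [← Finset.card_range (Min.min _ _)]
  congr 1
  ext i
  simp only [Finset.mem_filter, Finset.mem_range, lt_min_iff]
  rw [and_comm]
  refine and_congr_right fun _ => ?_
  simp only [nextPrime]
  rw [Nat.lt_find_iff]
  refine forall_congr' fun p => ?_
  rw [Nat.lt_succ_iff]

/-! ### Reading the code of a formula -/

theorem letter_drop (l : List Bool) (p i : ℕ) : letter (l.drop p) i = letter l (p + i) := by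
  simp [letter]

theorem nextFalse_eq {l : List Bool} {p v : ℕ} {r : List Bool}
    (h : l.drop p = List.replicate v true ++ false :: r) : nextFalse l p = p + v := by
  have hv : v < l.length := by
    have := congrArg List.length h
    simp at this
    omega
  have ht : ∀ j < v, letter l (p + j) = 2 := by
    intro j hj
    rw [← letter_drop, h]
    simp [letter, List.getElem?_append_left, hj]
  have hf : letter l (p + v) = 1 := by
    rw [← letter_drop, h]
    simp [letter]
  unfold nextFalse
  congr 1
  rw [← Finset.card_range v]
  congr 1
  ext i
  simp only [Finset.mem_filter, Finset.mem_range]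
  constructor
  · rintro ⟨-, h₁⟩
    by_contra! h₂
    have := h₁ v (by omega)
    omega
  · intro hi
    exact ⟨by omega, fun j hj => ht j (by omega)⟩

/-- The literals of a formula in the order in which they are encoded. -/
def literals {n : ℕ} (φ : ThreeCNF n) : List (Literal n) := φ.flatMap fun C => [C 0, C 1, C 2]

theorem encodeCNF_eq {n : ℕ} (φ : ThreeCNF n) : encodeCNF ⟨n, φ⟩ =
    List.replicate n true ++ false :: (literals φ).flatMap encodeLiteral := by
  simp [encodeCNF, literals, List.flatMap_assoc]

theorem length_literals {n : ℕ} (φ : ThreeCNF n) : (literals φ).length = 3 * φ.length := by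
  induction φ with
  | nil => rfl
  | cons C φ ih =>
    simp only [literals] at ih
    simp [literals, ih]; ring

theorem getElem?_literals {n : ℕ} (φ : ThreeCNF n) {j : ℕ} (hj : j < φ.length) (c : Fin 3) :
    (literals φ)[3 * j + c]? = some (φ[j] c) := by
  induction φ generalizing j with
  | nil => simp at hj
  | cons C φ ih =>
    cases j with
    | zero => fin_cases c <;> simp [literals]
    | succ j =>
      have := ih (j := j) (by simpa using hj)
      rw [show 3 * (j + 1) + (c : ℕ) = 3 * j + c + 1 + 1 + 1 by ring]
      simpa [literals] using this

theorem nextFalse_encodeCNF {n : ℕ} (φ : ThreeCNF n) : nextFalse (encodeCNF ⟨n, φ⟩) 0 = n := by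
  rw [nextFalse_eq (r := (literals φ).flatMap encodeLiteral) (v := n)]
  · simp
  · simp [encodeCNF_eq]

theorem litPos_succ (l : List Bool) (j : ℕ) : litPos l (j + 1) = nextFalse l (litPos l j) + 2 :=
  Function.iterate_succ_apply' _ _ _

/-- A literal consists of its unary index, a separator and a sign, so the next one begins two
letters after the position of the separator. The header ends with its separator, which is why the
first literal begins one letter after it. -/
theorem drop_litPos {n : ℕ} (φ : ThreeCNF n) {j : ℕ} (hj : j ≤ 3 * φ.length) :
    (encodeCNF ⟨n, φ⟩).drop (litPos (encodeCNF ⟨n, φ⟩) j)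
      = ((literals φ).drop j).flatMap encodeLiteral := by
  induction j with
  | zero =>
    have : litPos (encodeCNF ⟨n, φ⟩) 0 = n + 1 := by
      simp [litPos, nextFalse_encodeCNF]
    rw [this, encodeCNF_eq, ← List.drop_drop]
    simp
  | succ j ih =>
    have ih := ih (by omega)
    have hj' : j < (literals φ).length := by rw [length_literals]; omega
    rw [List.drop_eq_getElem_cons hj', List.flatMap_cons] at ih
    have e : nextFalse (encodeCNF ⟨n, φ⟩) (litPos (encodeCNF ⟨n, φ⟩) j)
        = litPos (encodeCNF ⟨n, φ⟩) j + ((literals φ)[j].1 : ℕ) := by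
      refine nextFalse_eq (r := (literals φ)[j].2 ::
        ((literals φ).drop (j + 1)).flatMap encodeLiteral) ?_
      rw [ih]
      simp [encodeLiteral]
    rw [litPos_succ, e, add_assoc, ← List.drop_drop, ih]
    simp [encodeLiteral, List.drop_append]

theorem nextFalse_litPos {n : ℕ} (φ : ThreeCNF n) {j : ℕ} (hj : j < φ.length) (c : Fin 3) :
    nextFalse (encodeCNF ⟨n, φ⟩) (litPos (encodeCNF ⟨n, φ⟩) (3 * j + c))
        = litPos (encodeCNF ⟨n, φ⟩) (3 * j + c) + ((φ[j] c).1 : ℕ) ∧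
      letter (encodeCNF ⟨n, φ⟩) (litPos (encodeCNF ⟨n, φ⟩) (3 * j + c) + ((φ[j] c).1 + 1))
        = if (φ[j] c).2 then 2 else 1 := by
  have hj' : 3 * j + (c : ℕ) < (literals φ).length := by rw [length_literals]; omega
  have h := drop_litPos φ (j := 3 * j + c) (by omega)
  have hl := getElem?_literals φ hj c
  rw [List.getElem?_eq_getElem hj'] at hl
  rw [List.drop_eq_getElem_cons hj', List.flatMap_cons, Option.some_inj.1 hl] at h
  constructor
  · refine nextFalse_eq (r := (φ[j] c).2 ::
      ((literals φ).drop (3 * j + c + 1)).flatMap encodeLiteral) ?_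
    rw [h]
    simp [encodeLiteral]
  · rw [← letter_drop, h]
    simp only [encodeLiteral, letter]
    cases (φ[j] c).2 <;> simp

theorem litVar_encodeCNF {n : ℕ} (φ : ThreeCNF n) {j : ℕ} (hj : j < φ.length) (c : Fin 3) :
    litVar (encodeCNF ⟨n, φ⟩) (3 * j + c) = (φ[j] c).1 := by
  rw [litVar, (nextFalse_litPos φ hj c).1]
  omega

theorem litPositive_encodeCNF {n : ℕ} (φ : ThreeCNF n) {j : ℕ} (hj : j < φ.length) (c : Fin 3) :
    LitPositive (encodeCNF ⟨n, φ⟩) (3 * j + c) ↔ (φ[j] c).2 = true := by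
  rw [LitPositive, (nextFalse_litPos φ hj c).1, add_assoc, (nextFalse_litPos φ hj c).2]
  cases (φ[j] c).2 <;> simp

/-- Before the last clause is read, a nonempty part of the code remains; afterwards the positions
are past the end, and they only grow. This is how `ClausesN` recognizes which indices belong to
clauses. -/
theorem litPos_lt_iff {n : ℕ} (φ : ThreeCNF n) (j : ℕ) :
    litPos (encodeCNF ⟨n, φ⟩) (3 * j) < (encodeCNF ⟨n, φ⟩).length ↔ j < φ.length := by
  constructor
  · intro h
    by_contra! hj
    have h₀ : (encodeCNF ⟨n, φ⟩).length ≤ litPos (encodeCNF ⟨n, φ⟩) (3 * φ.length) := by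
      have := drop_litPos φ (j := 3 * φ.length) le_rfl
      rw [← length_literals, List.drop_length, List.flatMap_nil, List.drop_eq_nil_iff] at this
      rwa [length_literals] at this
    have hmono : Monotone (litPos (encodeCNF ⟨n, φ⟩)) := monotone_nat_of_le_succ fun i => by
      rw [litPos_succ, nextFalse]; omega
    have := hmono (show 3 * φ.length ≤ 3 * j by omega)
    omega
  · intro hj
    have h := drop_litPos φ (j := 3 * j) (by omega)
    have hj' : 3 * j < (literals φ).length := by rw [length_literals]; omega
    by_contra! hle
    rw [List.drop_eq_nil_of_le hle, List.drop_eq_getElem_cons hj', List.flatMap_cons] at h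
    simp [encodeLiteral] at h

theorem length_le_encodeCNF {n : ℕ} (φ : ThreeCNF n) : φ.length ≤ (encodeCNF ⟨n, φ⟩).length := by
  by_contra! h
  have h₀ := (litPos_lt_iff φ (encodeCNF ⟨n, φ⟩).length).2 h
  have : ∀ j, j ≤ litPos (encodeCNF ⟨n, φ⟩) j := by
    intro j
    induction j with
    | zero => omega
    | succ j ih => rw [litPos_succ, nextFalse]; omega
  have := this (3 * (encodeCNF ⟨n, φ⟩).length)
  omega

theorem clausesN_encodeCNF {n : ℕ} (φ : ThreeCNF n) (m q y : ℕ) :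
    ClausesN (encodeCNF ⟨n, φ⟩) m q y ↔ ∀ C ∈ φ,
      (∀ c : Fin 3, lineIdx q (2 * m) y c = ((C c).1 : ℕ) / m) →
      ∃ c : Fin 3, (lineVal q (2 * m) y c (m + ((C c).1 : ℕ) % m) = 1 ↔ (C c).2 = true) := by
  have fin : ∀ P : ℕ → Prop, (∀ c < 3, P c) ↔ ∀ c : Fin 3, P c := fun P =>
    ⟨fun h c => h c c.2, fun h c hc => h ⟨c, hc⟩⟩
  have fin' : ∀ P : ℕ → Prop, (∃ c < 3, P c) ↔ ∃ c : Fin 3, P c := fun P =>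
    ⟨fun ⟨c, hc, h⟩ => ⟨⟨c, hc⟩, h⟩, fun ⟨c, h⟩ => ⟨c, c.2, h⟩⟩
  unfold ClausesN
  simp only [fin, fin', litPos_lt_iff]
  constructor
  · intro h C hC
    obtain ⟨j, hj, rfl⟩ := List.getElem_of_mem hC
    have := h j (hj.trans_le (length_le_encodeCNF φ)) hj
    simpa only [litVar_encodeCNF φ hj, litPositive_encodeCNF φ hj] using this
  · intro h j _ hj
    have := h φ[j] (List.getElem_mem hj)
    simpa only [litVar_encodeCNF φ hj, litPositive_encodeCNF φ hj] using this

/-! ### The graph of a formula -/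

theorem exists_digits {q : ℕ} (hq : 0 < q) (D : ℕ) (g : ℕ → ℕ) (hg : ∀ i, g i < q) :
    ∃ y < q ^ D, ∀ i < D, dig q y i = g i := by
  induction D generalizing g with
  | zero => exact ⟨0, by simp, fun i hi => absurd hi (by omega)⟩
  | succ D ih =>
    obtain ⟨y, hy, h⟩ := ih (fun i => g (i + 1)) fun i => hg _
    refine ⟨g 0 + q * y, ?_, fun i hi => ?_⟩
    · have := hg 0
      rw [pow_succ]
      nlinarith
    · cases i with
      | zero => simp [dig, Nat.mod_eq_of_lt (hg 0)]
      | succ i =>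
        rw [← h i (by omega), dig, dig, pow_succ', ← Nat.div_div_eq_div_mul,
          Nat.add_mul_div_left _ _ hq, Nat.div_eq_of_lt (hg 0), zero_add]

theorem eq_of_digits {q : ℕ} (D : ℕ) {y y' : ℕ} (hy : y < q ^ D) (hy' : y' < q ^ D)
    (h : ∀ i < D, dig q y i = dig q y' i) : y = y' := by
  induction D generalizing y y' with
  | zero => simp at hy hy'; omega
  | succ D ih =>
    have h₀ : y % q = y' % q := by simpa [dig] using h 0 (by omega)
    have h₁ : y / q = y' / q := by
      refine ih (Nat.div_lt_of_lt_mul (by rwa [← pow_succ']))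
        (Nat.div_lt_of_lt_mul (by rwa [← pow_succ'])) fun i hi => ?_
      have := h (i + 1) (by omega)
      simpa only [dig, pow_succ', ← Nat.div_div_eq_div_mul] using this
    rw [← Nat.div_add_mod y q, ← Nat.div_add_mod y' q, h₀, h₁]

/-- Digits in base `q` and reduced values are less than `q`, so equations between these numbers can
be read in the field. -/
theorem natCast_inj_of_lt {q a b : ℕ} (ha : a < q) (hb : b < q) :
    ((a : ZMod q) = b) ↔ a = b := by
  rw [ZMod.natCast_eq_natCast_iff', Nat.mod_eq_of_lt ha, Nat.mod_eq_of_lt hb]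

section

variable {n m q : ℕ} [hq : Fact q.Prime]

/-- A line of a number. -/
def lineOf (q d y : ℕ) (c : Fin 3) : Line (ZMod q) d :=
  (lineIdx q d y c, fun i => lineCoeff q d y c i)

theorem dig_lt (y i : ℕ) : dig q y i < q := Nat.mod_lt _ hq.out.pos

theorem lineIdx_lt (d y c : ℕ) : lineIdx q d y c < q := dig_lt _ _

theorem lineVal_lt (d y c t : ℕ) : lineVal q d y c t < q := Nat.mod_lt _ hq.out.pos

theorem evalCoeff_lineOf (d y : ℕ) (c : Fin 3) (t : ℕ) :
    evalCoeff (lineOf q d y c).2 (t : ZMod q) = (lineVal q d y c t : ZMod q) := by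
  rw [lineVal, ZMod.natCast_mod, evalCoeff, Finset.sum_range]
  push_cast
  refine Finset.sum_congr rfl fun i _ => ?_
  rw [powMod, if_neg hq.out.ne_zero, ZMod.natCast_mod]
  push_cast
  rfl

theorem compatN_iff (d y y' : ℕ) (c c' : Fin 3) :
    CompatN q d y c y' c' ↔ Compat (lineOf q d y c) (lineOf q d y' c') := by
  unfold CompatN Compat
  change _ ↔ evalCoeff (lineOf q d y c).2 ((lineIdx q d y' c' : ℕ) : ZMod q)
    = evalCoeff (lineOf q d y' c').2 ((lineIdx q d y c : ℕ) : ZMod q) ∧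
      (((lineIdx q d y c : ℕ) : ZMod q) = ((lineIdx q d y' c' : ℕ) : ZMod q) → _)
  rw [evalCoeff_lineOf, evalCoeff_lineOf, natCast_inj_of_lt (lineVal_lt _ _ _ _)
    (lineVal_lt _ _ _ _), natCast_inj_of_lt (lineIdx_lt _ _ _) (lineIdx_lt _ _ _)]
  refine and_congr_right fun _ => imp_congr_right fun e => ?_
  simp only [lineOf, Prod.mk.injEq, e, true_and, funext_iff]
  constructor
  · intro h i
    rw [h i i.2]
  · intro h i hi
    exact (natCast_inj_of_lt (dig_lt _ _) (dig_lt _ _)).1 (h ⟨i, hi⟩)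

theorem gridN_iff (hm : 2 * m ≤ q) (y : ℕ) :
    GridN n m q y ↔ ∀ c, GridOK n m (lineOf q (2 * m) y c) := by
  have fin : ∀ P : ℕ → Prop, (∀ c < 3, P c) ↔ ∀ c : Fin 3, P c := fun P =>
    ⟨fun h c => h c c.2, fun h c hc => h ⟨c, hc⟩⟩
  unfold GridN GridOK
  rw [fin]
  refine forall_congr' fun c => forall_congr' fun i => imp_congr_right fun hi => ?_
  have h0 : (0 : ZMod q) = ((0 : ℕ) : ZMod q) := by simp
  have h1 : (1 : ZMod q) = ((1 : ℕ) : ZMod q) := by simp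
  refine imp_congr ?_ (forall_congr' fun t => imp_congr_right fun ht => ?_)
  · exact (natCast_inj_of_lt (dig_lt _ _) (by omega)).symm
  · rw [evalCoeff_lineOf, h0, h1, natCast_inj_of_lt (lineVal_lt _ _ _ _) hq.out.pos,
      natCast_inj_of_lt (lineVal_lt _ _ _ _) hq.out.one_lt]

theorem clausesN_iff (hn : n ≤ m * m) (hm : 2 * m ≤ q) (φ : ThreeCNF n) (y : ℕ) :
    ClausesN (encodeCNF ⟨n, φ⟩) m q y ↔ ClausesOK m φ (lineOf q (2 * m) y) := by
  rw [clausesN_encodeCNF]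
  refine forall_congr' fun C => imp_congr_right fun hC => imp_congr ?_ ?_
  · refine forall_congr' fun c => ?_
    have : ((C c).1 : ℕ) / m < m := Nat.div_lt_of_lt_mul ((C c).1.2.trans_le hn)
    exact (natCast_inj_of_lt (dig_lt _ _) (by omega)).symm
  · refine exists_congr fun c => ?_
    have h1 : (1 : ZMod q) = ((1 : ℕ) : ZMod q) := by simp
    rw [evalCoeff_lineOf, h1, natCast_inj_of_lt (lineVal_lt _ _ _ _) hq.out.one_lt]

theorem realN_iff (hn : n ≤ m * m) (hm : 2 * m ≤ q) (φ : ThreeCNF n) (x : ℕ) :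
    RealN (encodeCNF ⟨n, φ⟩) n m q x ↔ x / 2 < q ^ (3 * (2 * m + 1)) ∧
      (∀ c c', Compat (lineOf q (2 * m) (x / 2) c) (lineOf q (2 * m) (x / 2) c')) ∧
      (x % 2 = 1 → BadTriple m φ (lineOf q (2 * m) (x / 2))) := by
  have fin : ∀ P : ℕ → Prop, (∀ c < 3, P c) ↔ ∀ c : Fin 3, P c := fun P =>
    ⟨fun h c => h c c.2, fun h c hc => h ⟨c, hc⟩⟩
  unfold RealN BadTriple
  simp only [fin, compatN_iff]
  rw [Nat.div_eq_zero_iff_lt (Nat.pow_pos hq.out.pos), gridN_iff hm, clausesN_iff hn hm]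

/-- The graph on numbers with the adjacency relation `AdjN`. -/
def graphOf (l : List Bool) (n m q N : ℕ) : SimpleGraph (Fin N) where
  Adj x y := AdjN l n m q N x y
  symm := ⟨by
    rintro x y (⟨h₁, h₂, ⟨c, hc, h₃⟩, h₄⟩ | ⟨h₁, h₂, h₃, h₄, h₅⟩)
    · refine Or.inl ⟨h₂, h₁, ⟨c, hc, h₃.symm⟩, fun c hc c' hc' => ?_⟩
      obtain ⟨e₁, e₂⟩ := h₄ c' hc' c hc
      exact ⟨e₁.symm, fun e i hi => (e₂ e.symm i hi).symm⟩
    · exact Or.inr ⟨h₂, h₁, h₃.symm, fun h => h₅ ⟨h.2, h.1⟩, fun h => h₄ ⟨h.2, h.1⟩⟩⟩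
  loopless := ⟨by
    rintro x (⟨h₁, h₂, ⟨c, hc, h₃⟩, h₄⟩ | ⟨h₁, h₂, h₃, h₄, h₅⟩)
    · exact h₃ rfl
    · exact h₃ rfl⟩

/-- The vertex `2 * y + b` stands for the triple whose lines are the digits of `y` in base `q`, each
line taking `2 * m + 1` of them, and `b` marks the second copy. By the bound on `N`, the last three
numbers are too large to be codes and supply the special vertices. -/
theorem tripleGraph_graphOf (hn : n ≤ m * m) (hm : 2 * m ≤ q) (φ : ThreeCNF n) {N : ℕ}
    (hN : 2 * q ^ (3 * (2 * m + 1)) + 3 ≤ N) :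
    TripleGraph (graphOf (encodeCNF ⟨n, φ⟩) n m q N)
      (fun x => RealN (encodeCNF ⟨n, φ⟩) n m q x) (fun x => lineOf q (2 * m) (x / 2))
      (fun x => decide ((x : ℕ) % 2 = 1)) (BadTriple m φ) ⟨N - 1, by omega⟩ ⟨N - 2, by omega⟩
      ⟨N - 3, by omega⟩ := by
  have fin : ∀ P : ℕ → Prop, (∀ c < 3, P c) ↔ ∀ c : Fin 3, P c := fun P =>
    ⟨fun h c => h c c.2, fun h c hc => h ⟨c, hc⟩⟩
  have fin' : ∀ P : ℕ → Prop, (∃ c < 3, P c) ↔ ∃ c : Fin 3, P c := fun P =>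
    ⟨fun ⟨c, hc, h⟩ => ⟨⟨c, hc⟩, h⟩, fun ⟨c, h⟩ => ⟨c, c.2, h⟩⟩
  have hjunk : ∀ x, 2 * q ^ (3 * (2 * m + 1)) ≤ x → ¬ RealN (encodeCNF ⟨n, φ⟩) n m q x := by
    intro x hx h
    have := ((realN_iff hn hm φ x).1 h).1
    omega
  constructor
  · intro v hv
    exact ((realN_iff hn hm φ v).1 hv).2.1
  · intro v hv htw
    exact ((realN_iff hn hm φ v).1 hv).2.2 (by simpa using htw)
  · intro L b hL hb
    -- The digits of the code of `L`: in the block of a line, digit 0 is its point and digit `i + 1`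
    -- its coefficient `i`.
    let g : ℕ → ℕ := fun i =>
      let K := L (Fin.ofNat 3 (i / (2 * m + 1)))
      if h : 0 < i % (2 * m + 1) then
        (K.2 ⟨i % (2 * m + 1) - 1, by have := Nat.mod_lt i (show 0 < 2 * m + 1 by omega); omega⟩).val
      else K.1.val
    obtain ⟨y, hy, hg⟩ := exists_digits hq.out.pos (3 * (2 * m + 1)) g fun i => by
      simp only [g]
      split_ifs
      · exact ZMod.val_lt _
      · exact ZMod.val_lt _
    have hline : lineOf q (2 * m) y = L := by
      funext c
      have hc := c.2
      refine Prod.ext ?_ (funext fun i => ?_)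
      · change ((dig q y (c * (2 * m + 1)) : ℕ) : ZMod q) = _
        rw [hg _ (by nlinarith)]
        simp only [g]
        rw [dif_neg (by simp), Nat.mul_div_cancel _ (by omega), ZMod.natCast_zmod_val]
        congr 2
        exact Fin.ext (by simp)
      · change ((dig q y (c * (2 * m + 1) + 1 + i) : ℕ) : ZMod q) = _
        have hi := i.2
        rw [hg _ (by nlinarith)]
        have e₁ : ((c : ℕ) * (2 * m + 1) + 1 + i) % (2 * m + 1) = 1 + i := by
          rw [add_assoc, Nat.mul_add_mod', Nat.mod_eq_of_lt (by omega)]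
        have e₂ : ((c : ℕ) * (2 * m + 1) + 1 + i) / (2 * m + 1) = c := by
          rw [add_assoc, add_comm, Nat.add_mul_div_right _ _ (by omega),
            Nat.div_eq_of_lt (by omega), zero_add]
        simp only [g]
        rw [dif_pos (by omega), ZMod.natCast_zmod_val]
        have e₃ : Fin.ofNat 3 (((c : ℕ) * (2 * m + 1) + 1 + i) / (2 * m + 1)) = c :=
          Fin.ext (by rw [e₂]; simp)
        rw [e₃]
        refine congrArg (L c).2 (Fin.ext ?_)
        change _ % _ - 1 = (i : ℕ)
        omega
    have hlt : 2 * y + b.toNat < N := by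
      have := b.toNat_le
      omega
    have h₁ : (2 * y + b.toNat) / 2 = y := by have := b.toNat_le; omega
    have h₂ : (2 * y + b.toNat) % 2 = b.toNat := by have := b.toNat_le; omega
    refine ⟨⟨2 * y + b.toNat, hlt⟩, ?_, ?_, ?_⟩
    · rw [realN_iff hn hm]
      dsimp only
      rw [h₁, h₂, hline]
      exact ⟨hy, hL, fun hb' => hb (by cases b <;> simp_all)⟩
    · dsimp only
      rw [h₁, hline]
    · dsimp only
      rw [h₂]
      cases b <;> rfl
  · intro v w hv hw hl ht
    have hv' := ((realN_iff hn hm φ v).1 hv).1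
    have hw' := ((realN_iff hn hm φ w).1 hw).1
    have e : (v : ℕ) / 2 = (w : ℕ) / 2 := by
      refine eq_of_digits _ hv' hw' fun i hi => ?_
      have hc : i / (2 * m + 1) < 3 := Nat.div_lt_of_lt_mul (by linarith)
      have hl' := congrFun hl ⟨_, hc⟩
      have hr := Nat.mod_lt i (show 0 < 2 * m + 1 by omega)
      have hi' := Nat.div_add_mod' i (2 * m + 1)
      rcases Nat.eq_zero_or_pos (i % (2 * m + 1)) with h | h
      · have := congrArg Prod.fst hl'
        have := (natCast_inj_of_lt (dig_lt _ _) (dig_lt _ _)).1 this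
        dsimp only at this
        rwa [show i / (2 * m + 1) * (2 * m + 1) = i by omega] at this
      · have := congrFun (congrArg Prod.snd hl') ⟨i % (2 * m + 1) - 1, by omega⟩
        have := (natCast_inj_of_lt (dig_lt _ _) (dig_lt _ _)).1 this
        dsimp only at this
        rwa [show i / (2 * m + 1) * (2 * m + 1) + 1 + (i % (2 * m + 1) - 1) = i by omega] at this
    have e' : ((v : ℕ) % 2 = 1 ↔ (w : ℕ) % 2 = 1) := by simpa using ht
    exact Fin.ext (by omega)
  · intro v w hv hw
    change AdjN _ _ _ _ _ _ _ ↔ _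
    unfold AdjN
    have hne : (∃ c < 3, lineIdx q (2 * m) (v / 2) c ≠ lineIdx q (2 * m) (w / 2) c) ↔
        (fun i => (lineOf q (2 * m) (v / 2) i).1) ≠ fun i => (lineOf q (2 * m) (w / 2) i).1 := by
      rw [fin', Function.ne_iff]
      exact exists_congr fun c =>
        not_congr (natCast_inj_of_lt (dig_lt _ _) (dig_lt _ _)).symm
    rw [hne]
    simp only [hv, hw, true_and, not_true, false_and, or_false, fin, compatN_iff]
  · intro v w hv hw h
    change AdjN _ _ _ _ _ _ _ at h
    unfold AdjN at h
    simp [hv, hw] at h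
  · intro v w hv hw
    change AdjN _ _ _ _ _ _ _ ↔ _
    unfold AdjN
    simp [hv, hw, Fin.ext_iff]
  · exact hjunk _ (by dsimp only; omega)
  · exact hjunk _ (by dsimp only; omega)
  · exact hjunk _ (by dsimp only; omega)
  · simp only [ne_eq, Fin.mk.injEq]; omega
  · simp only [ne_eq, Fin.mk.injEq]; omega
  · simp only [ne_eq, Fin.mk.injEq]; omega

/-- The communities of the graph of a formula correspond to the satisfying assignments. -/
theorem communityCount_graphOf (hn : n ≤ m * m) (hm : 2 * m ≤ q) (φ : ThreeCNF n) {N : ℕ}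
    (hN : 2 * q ^ (3 * (2 * m + 1)) + 3 ≤ N) {ε : ℝ} (hε0 : 0 ≤ ε) (hε : ε ≤ 1 / 4)
    (hmε : ((2 * m : ℕ) : ℝ) - 1 ≤ ε * q) :
    communityCount (graphOf (encodeCNF ⟨n, φ⟩) n m q N) 1 ε = φ.satCount := by
  have hcard : Fintype.card (ZMod q) = q := ZMod.card q
  rw [communityCount, (tripleGraph_graphOf hn hm φ hN).ncard_communities (by rw [hcard]; exact hm)
    hε0 hε (by rw [hcard]; exact hmε)]
  refine ncard_good_families hn (fun a ha b hb e => ?_) φ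
  rw [Set.mem_ofPred_eq] at ha hb
  exact (natCast_inj_of_lt (by omega) (by omega)).1 e

end

/-! ### The parameters of the reduction -/

/-- The number of grid lines for `n` variables. -/
def gridSize (n : ℕ) : ℕ := Nat.sqrt n + 1

/-- The number of bits of a field element. -/
def fieldBits (n : ℕ) : ℕ := 4 * Nat.log 2 (gridSize n) + 12

/-- The size of the field. -/
noncomputable def fieldSize (n : ℕ) : ℕ := nextPrime (2 ^ (fieldBits n - 1))

/-- The binary logarithm of the number of vertices. -/
def orderExp (n : ℕ) : ℕ := fieldBits n * (3 * (2 * gridSize n + 1)) + 2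

/-- The reciprocal of the parameter `ε` for graphs with `N` vertices. -/
def invThreshold (N : ℕ) : ℕ := 2 ^ Nat.log 2 (Nat.log 2 N)

theorem le_gridSize_mul_self (n : ℕ) : n ≤ gridSize n * gridSize n :=
  (Nat.lt_succ_sqrt n).le

theorem two_pow_lt_fieldSize (n : ℕ) : 2 ^ (4 * Nat.log 2 (gridSize n) + 11) < fieldSize n :=
  lt_nextPrime _

theorem fieldSize_le (n : ℕ) : fieldSize n ≤ 2 ^ fieldBits n := by
  refine (nextPrime_le (by positivity)).trans (le_of_eq ?_)
  rw [← pow_succ']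
  congr 1

theorem gridSize_lt (n : ℕ) : gridSize n < 2 * 2 ^ Nat.log 2 (gridSize n) := by
  rw [← pow_succ']
  exact Nat.lt_pow_succ_log_self one_lt_two _

/-- The field has to exceed the degree by the factor 1/ε, which is at most `orderExp n`. That
exponent depends on the field in turn, but only through its number of bits, so a fourth power
suffices: with M the largest power of two up to the grid size, the left side is at most 584 M³,
while the field is larger than 2048 M⁴. -/
theorem two_mul_gridSize_mul_orderExp_le (n : ℕ) :
    2 * gridSize n * orderExp n ≤ fieldSize n := by
  have h := gridSize_lt n
  have hs : Nat.log 2 (gridSize n) < 2 ^ Nat.log 2 (gridSize n) := Nat.lt_two_pow_self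
  refine le_trans ?_ (two_pow_lt_fieldSize n).le
  have e : 2 ^ (4 * Nat.log 2 (gridSize n) + 11) = 2048 * (2 ^ Nat.log 2 (gridSize n)) ^ 4 := by
    rw [pow_add, mul_comm 4, pow_mul]; ring
  rw [e, orderExp, fieldBits]
  generalize 2 ^ Nat.log 2 (gridSize n) = M at *
  generalize Nat.log 2 (gridSize n) = s at *
  generalize gridSize n = m at *
  have h₁ : 4 * s + 12 ≤ 12 * M := by omega
  have h₂ : 3 * (2 * m + 1) ≤ 12 * M := by omega
  have hM : 1 ≤ M := by omega
  have h₃ : (4 * s + 12) * (3 * (2 * m + 1)) + 2 ≤ 146 * M ^ 2 := by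
    have := Nat.mul_le_mul h₁ h₂
    nlinarith
  calc 2 * m * ((4 * s + 12) * (3 * (2 * m + 1)) + 2) ≤ (4 * M) * (146 * M ^ 2) :=
        Nat.mul_le_mul (by omega) h₃
    _ = 584 * M ^ 3 := by ring
    _ ≤ 2048 * M ^ 4 := by
        rw [pow_succ M 3]
        nlinarith [Nat.mul_le_mul_left (M ^ 3) hM]

theorem four_le_orderExp (n : ℕ) : 4 ≤ orderExp n := by
  have : 12 * 3 ≤ fieldBits n * (3 * (2 * gridSize n + 1)) :=
    Nat.mul_le_mul (by simp [fieldBits]) (by omega)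
  simp only [orderExp]; omega

theorem two_mul_gridSize_le (n : ℕ) : 2 * gridSize n ≤ fieldSize n :=
  (Nat.le_mul_of_pos_right _ (by have := four_le_orderExp n; omega)).trans
    (two_mul_gridSize_mul_orderExp_le n)

/-- With `x = 2 ^ (bits * digits)`, at least 2, there are at most `x` codes. The summand 2 in
`orderExp` provides `4 * x` vertices, enough for both copies and three further ones. -/
theorem order_bound (n : ℕ) :
    2 * fieldSize n ^ (3 * (2 * gridSize n + 1)) + 3 ≤ 2 ^ orderExp n := by
  have h := Nat.pow_le_pow_left (fieldSize_le n) (3 * (2 * gridSize n + 1))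
  rw [← pow_mul] at h
  have : 1 ≤ 2 ^ (fieldBits n * (3 * (2 * gridSize n + 1))) := Nat.one_le_two_pow
  rw [orderExp, pow_add]
  have h2 : 2 ≤ 2 ^ (fieldBits n * (3 * (2 * gridSize n + 1))) := by
    refine Nat.le_self_pow ?_ 2
    simp [fieldBits]
  omega

theorem invThreshold_two_pow (e : ℕ) : invThreshold (2 ^ e) = 2 ^ Nat.log 2 e := by
  rw [invThreshold, Nat.log_pow one_lt_two]

theorem invThreshold_pos (N : ℕ) : 0 < invThreshold N := by
  simp [invThreshold]

/-- The reduction is parsimonious. -/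
theorem communityCount_reduction {n : ℕ} (φ : ThreeCNF n) :
    communityCount (graphOf (encodeCNF ⟨n, φ⟩) n (gridSize n) (fieldSize n) (2 ^ orderExp n)) 1
      (1 / (invThreshold (2 ^ orderExp n) : ℝ)) = φ.satCount := by
  have : Fact (fieldSize n).Prime := ⟨nextPrime_prime _⟩
  have hk : 4 ≤ invThreshold (2 ^ orderExp n) := by
    rw [invThreshold_two_pow]
    exact Nat.pow_le_pow_right (show 0 < 2 by norm_num)
      (Nat.le_log_of_pow_le (x := 2) one_lt_two (four_le_orderExp n))
  have hk' : invThreshold (2 ^ orderExp n) ≤ orderExp n := by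
    rw [invThreshold_two_pow]
    exact Nat.pow_log_le_self 2 (by have := four_le_orderExp n; omega)
  have hk₀ : (4 : ℝ) ≤ invThreshold (2 ^ orderExp n) := by exact_mod_cast hk
  refine communityCount_graphOf (le_gridSize_mul_self n) (two_mul_gridSize_le n) φ (order_bound n)
    (by positivity) (one_div_le_one_div_of_le (by norm_num) hk₀) ?_
  -- The condition (2m - 1) ≤ εq follows from 2m/ε ≤ 2m · log₂ N ≤ q.
  rw [div_mul_eq_mul_div, one_mul, le_div_iff₀ (by linarith)]
  have h : 2 * gridSize n * invThreshold (2 ^ orderExp n) ≤ fieldSize n :=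
    (Nat.mul_le_mul_left _ hk').trans (two_mul_gridSize_mul_orderExp_le n)
  have h' : ((2 * gridSize n : ℕ) : ℝ) * invThreshold (2 ^ orderExp n) ≤ fieldSize n := by
    exact_mod_cast h
  linarith

/-! ### The reduction as a computation -/

theorem flatMap_range_map {α : Type*} (f : ℕ → ℕ → α) (M N : ℕ) :
    ((List.range M).flatMap fun i => (List.range N).map (f i)) =
      (List.range (M * N)).map fun z => f (z / N) (z % N) := by
  induction M with
  | zero => simp
  | succ M ih =>
    rw [List.range_succ, List.flatMap_append, ih, Nat.succ_mul, List.range_add, List.map_append,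
      List.flatMap_singleton, List.map_map]
    congr 1
    refine List.map_congr_left fun j hj => ?_
    have hj := List.mem_range.1 hj
    simp only [Function.comp_apply]
    rw [add_comm, Nat.add_mul_div_right _ _ (by omega), Nat.div_eq_of_lt hj,
      Nat.add_mul_mod_self_right, Nat.mod_eq_of_lt hj, zero_add]

open Classical in
theorem encodeGraph_eq {N : ℕ} (G : SimpleGraph (Fin N)) (A : ℕ → ℕ → Prop)
    (h : ∀ i j : Fin N, G.Adj i j ↔ A i j) :
    encodeGraph ⟨N, G⟩ = (List.range (N * N)).map fun z => decide (A (z / N) (z % N)) := by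
  rw [← flatMap_range_map (fun i j => decide (A i j)), encodeGraph, ← List.map_coe_finRange_eq_range]
  simp only [List.flatMap_map, List.map_map]
  refine List.flatMap_congr fun i _ => List.map_congr_left fun j _ => ?_
  simp [h]

/-- Squares of powers of two are computable in time polynomial in their value. -/
theorem exists_computes_two_pow_sq {e : List Bool → ℕ} (he : UnaryPoly (k := 0) fun l _ => e l) :
    ∃ (T : List Bool → ℕ) (c : ℕ),
      Computes (k := 0) (fun l _ => 2 ^ e l * 2 ^ e l) (fun l _ => T l) ∧
      ∀ l, T l ≤ (l.length + 2 ^ e l + 2) ^ c := by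
  obtain ⟨Te, ⟨ce, hTe⟩, he⟩ := he
  obtain ⟨Ta, ⟨ca, hTa⟩, ha⟩ : UnaryPoly (k := 2) fun _ w => w 1 + w 1 :=
    (UnaryPoly.proj 1).add (.proj 1)
  obtain ⟨Tm, ⟨cm, hTm⟩, hm⟩ : UnaryPoly (k := 1) fun _ w => w 0 * w 0 :=
    (UnaryPoly.proj 0).mul (.proj 0)
  obtain ⟨T₁, ⟨c₁, hT₁⟩, h₁⟩ : UnaryPoly (k := 0) fun _ _ => 1 := .const 1
  -- The power is formed by repeated doubling. It need not be polynomial in the length of the word,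
  -- so `UnaryPoly.prec` does not apply and the time is estimated directly.
  have hp := Computes.prec h₁ ha (fun _ i _ => 2 ^ i) (fun _ _ => rfl)
    (fun l i v => by change 2 ^ (i + 1) = 2 ^ i + 2 ^ i; ring)
  have hN := Computes.comp hp (g := fun _ l _ => e l) (fun _ => he)
  have hK := Computes.comp hm (g := fun _ l _ => 2 ^ e l) (fun _ => hN)
  -- The argument `v 0` stands for the number `2 ^ e l`; treating it as an input makes the time a
  -- polynomial bound in the previous sense.
  obtain ⟨c, hc⟩ : PolyBdd (k := 1) fun l v => (l.length + v 0 + 2) ^ cm + ((l.length + 2) ^ c₁ +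
      (9 * v 0 + 3 + v 0 * ((l.length + 2 * v 0 + 2) ^ ca + 5 * v 0 + 3)) + 3 * v 0 + 2 * v 0 + 2 +
      ((l.length + 2) ^ ce + 2 * v 0 + 1) + 2 + 2 * v 0 + 1) + 2 := by
    have h₀ := PolyBdd.proj (k := 1) 0
    have hm (a : ℕ) : PolyBdd (k := 1) fun _ v => a * v 0 := (PolyBdd.const a).mul h₀
    have hl (a : ℕ) : PolyBdd (k := 1) fun l v => l.length + a * v 0 + 2 :=
      (PolyBdd.length.add (hm a)).add (.const 2)
    have hl' : PolyBdd (k := 1) fun l v => l.length + 2 := PolyBdd.length.add (.const 2)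
    have hl₁ : PolyBdd (k := 1) fun l v => l.length + v 0 + 2 :=
      (PolyBdd.length.add h₀).add (.const 2)
    exact ((hl₁.pow cm).add (((((((((hl'.pow c₁).add (((hm 9).add (.const 3)).add
      (h₀.mul ((((hl 2).pow ca).add (hm 5)).add (.const 3))))).add (hm 3)).add (hm 2)).add
      (.const 2)).add (((hl'.pow ce).add (hm 2)).add (.const 1))).add (.const 2)).add
      (hm 2)).add (.const 1))).add (.const 2)
  refine ⟨fun l => (l.length + 2 ^ e l + 2) ^ c, c, hK.mono fun l v => ?_, fun l => le_rfl⟩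
  have hc' := hc l ![2 ^ e l]
  simp only [inputSize, Finset.univ_unique, Finset.sum_singleton, Matrix.cons_val_fin_one,
    Fin.default_eq_zero] at hc'
  refine le_trans ?_ hc'
  change Tm l (fun _ : Fin 1 => 2 ^ e l) + ∑ _ : Fin 1, (T₁ l (Fin.tail fun _ : Fin 1 => e l) +
    (9 * e l + 3 + ∑ i ∈ Finset.range (e l), (Ta l (Fin.cons i (Fin.cons (2 ^ i)
      (Fin.tail fun _ : Fin 1 => e l))) + 2 * 2 ^ i + 3 * 2 ^ (i + 1) + 3)) + 3 * 2 ^ e l +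
    2 * e l + 2 + ∑ _ : Fin 1, (Te l v + 2 * e l + 1) + 2 + 2 * 2 ^ e l + 1) + 2 ≤ _
  simp only [Finset.univ_unique, Finset.sum_singleton]
  have he₁ : e l ≤ 2 ^ e l := Nat.lt_two_pow_self.le
  have b₁ := hTm l fun _ => 2 ^ e l
  have b₂ := hT₁ l (Fin.tail fun _ : Fin 1 => e l)
  have b₃ := hTe l v
  simp only [inputSize, Finset.univ_unique, Finset.sum_singleton, Finset.univ_eq_empty,
    Finset.sum_empty, add_zero] at b₁ b₂ b₃
  have b₄ : (∑ i ∈ Finset.range (e l), (Ta l (Fin.cons i (Fin.cons (2 ^ i)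
      (Fin.tail fun _ : Fin 1 => e l))) + 2 * 2 ^ i + 3 * 2 ^ (i + 1) + 3)) ≤
      2 ^ e l * ((l.length + 2 * 2 ^ e l + 2) ^ ca + 5 * 2 ^ e l + 3) := by
    refine (Finset.sum_le_card_nsmul _ _ ((l.length + 2 * 2 ^ e l + 2) ^ ca + 5 * 2 ^ e l + 3)
      fun i hi => ?_).trans ?_
    · have hi := Finset.mem_range.1 hi
      have p₁ : 2 ^ (i + 1) ≤ 2 ^ e l := Nat.pow_le_pow_right (by norm_num) hi
      have p₂ : 2 ^ i ≤ 2 ^ e l := Nat.pow_le_pow_right (by norm_num) hi.le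
      have p₃ : Ta l (Fin.cons i (Fin.cons (2 ^ i) (Fin.tail fun _ : Fin 1 => e l))) ≤
          (l.length + 2 * 2 ^ e l + 2) ^ ca := by
        refine (hTa _ _).trans (Nat.pow_le_pow_left ?_ _)
        simp [inputSize, Fin.sum_univ_succ]
        omega
      omega
    · rw [Finset.card_range, smul_eq_mul]
      exact Nat.mul_le_mul_right _ he₁
  omega

namespace UnaryPoly

variable {k : ℕ} {f : List Bool → (Fin k → ℕ) → ℕ}

theorem twoPowLog (hf : UnaryPoly f) : UnaryPoly fun l v => 2 ^ Nat.log 2 (f l v + 1) := by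
  convert minPow hf.succ.log hf.succ using 3 with l v
  exact (min_eq_left (Nat.pow_log_le_self 2 (by omega))).symm

theorem gridSize (hf : UnaryPoly f) : UnaryPoly fun l v => gridSize (f l v) := hf.sqrt.succ

theorem fieldBits (hf : UnaryPoly f) : UnaryPoly fun l v => fieldBits (f l v) :=
  ((const 4).mul hf.gridSize.log).add (const 12)

theorem orderExp (hf : UnaryPoly f) : UnaryPoly fun l v => orderExp (f l v) :=
  (hf.fieldBits.mul ((const 3).mul (((const 2).mul hf.gridSize).succ))).add (const 2)

/-- The lower bound for the prime is 2048 M⁴, where M is the largest power of two up to the grid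
size; hence it is polynomial in the argument. Bertrand's postulate provides the cap for the search.
-/
theorem fieldSize (hf : UnaryPoly f) : UnaryPoly fun l v => fieldSize (f l v) := by
  have h := hf.sqrt.twoPowLog
  have hb : UnaryPoly fun l v => 2 ^ (_root_.fieldBits (f l v) - 1) := by
    convert (const 2048).mul ((h.mul h).mul (h.mul h)) using 3 with l v
    rw [_root_.fieldBits, _root_.gridSize, Nat.add_sub_assoc (by norm_num), pow_add, mul_comm 4,
      pow_mul]
    ring
  convert minNextPrime hb ((const 2).mul hb) using 3 with l v
  exact (min_eq_left (nextPrime_le (by positivity))).symm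

end UnaryPoly

theorem pow_add_pow_le_pow {S : ℕ} (hS : 2 ≤ S) (a b : ℕ) : S ^ a + S ^ b ≤ S ^ (a + b + 1) := by
  have h₁ : S ^ a ≤ S ^ (a + b) := Nat.pow_le_pow_right (by omega) (by omega)
  have h₂ : S ^ b ≤ S ^ (a + b) := Nat.pow_le_pow_right (by omega) (by omega)
  calc S ^ a + S ^ b ≤ S ^ (a + b) * 2 := by omega
    _ ≤ S ^ (a + b) * S := Nat.mul_le_mul_left _ hS

/-- An algorithm that counts communities yields an algorithm that counts satisfying assignments. -/
theorem exists_solvableInTime_satCount {T : ℕ → ℝ}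
    (h : SolvableInTime encodeGraph
      (fun G => communityCount G.2 1 (1 / (invThreshold G.1 : ℝ))) fun G => T G.1) :
    ∃ c : ℕ, SolvableInTime encodeCNF (fun φ => φ.2.satCount) fun φ =>
      (((encodeCNF φ).length + 2 ^ orderExp φ.1 * 2 ^ orderExp φ.1 + 2 : ℕ) : ℝ) ^ c +
        T (2 ^ orderExp φ.1) := by
  obtain ⟨M, hM⟩ := h
  obtain ⟨TK, c₁, hK, hTK⟩ := exists_computes_two_pow_sq
    (e := fun l => orderExp (nextFalse l 0)) (UnaryPoly.orderExp (.nextFalse (.const 0)))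
  -- The predicate receives the length N² of the word and a position. The order N is recovered as a
  -- square root, which stays polynomial in the unary arguments; row and column are quotient and
  -- remainder by N.
  let P : List Bool → (Fin 2 → ℕ) → Prop := fun l v => AdjN l (nextFalse l 0)
    (gridSize (nextFalse l 0)) (fieldSize (nextFalse l 0)) (Nat.sqrt (v 0))
    (v 1 / Nat.sqrt (v 0)) (v 1 % Nat.sqrt (v 0))
  have hP : UnaryDec P := by
    have h₀ : UnaryPoly (k := 2) fun l _ => nextFalse l 0 := .nextFalse (.const 0)
    have h₁ : UnaryPoly (k := 2) fun _ v => Nat.sqrt (v 0) := (UnaryPoly.proj 0).sqrt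
    exact .adjN h₀ h₀.gridSize h₀.fieldSize h₁ ((UnaryPoly.proj 1).div h₁)
      ((UnaryPoly.proj 1).mod h₁)
  obtain ⟨M', c₂, hM'⟩ := exists_machine_comp_wordOf M hK hP
  refine ⟨c₁ + c₂ + 1, M', fun φ => ?_⟩
  obtain ⟨n, φ⟩ := φ
  obtain ⟨t, ht, ht'⟩ := hM ⟨2 ^ orderExp n, graphOf (encodeCNF ⟨n, φ⟩) n (gridSize n) (fieldSize n)
    (2 ^ orderExp n)⟩
  dsimp only at ht ht' ⊢
  rw [communityCount_reduction] at ht'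
  have hw : encodeGraph ⟨2 ^ orderExp n, graphOf (encodeCNF ⟨n, φ⟩) n (gridSize n) (fieldSize n)
      (2 ^ orderExp n)⟩ = wordOf (fun l => 2 ^ orderExp (nextFalse l 0) *
        2 ^ orderExp (nextFalse l 0)) P (encodeCNF ⟨n, φ⟩) := by
    rw [encodeGraph_eq _ (AdjN (encodeCNF ⟨n, φ⟩) n (gridSize n) (fieldSize n) (2 ^ orderExp n))
      fun _ _ => Iff.rfl, wordOf, nextFalse_encodeCNF]
    refine List.map_congr_left fun z _ => decide_eq_decide.2 ?_
    simp only [P, nextFalse_encodeCNF, Matrix.cons_val_zero, Matrix.cons_val_one, Nat.sqrt_eq]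
  rw [hw] at ht'
  refine ⟨_, ?_, hM' _ _ _ ht'⟩
  have hb := hTK (encodeCNF ⟨n, φ⟩)
  simp only [nextFalse_encodeCNF] at hb ⊢
  have h2 : (encodeCNF ⟨n, φ⟩).length + 2 ^ orderExp n + 2 ≤
      (encodeCNF ⟨n, φ⟩).length + 2 ^ orderExp n * 2 ^ orderExp n + 2 := by
    have := Nat.le_mul_self (2 ^ orderExp n)
    omega
  have hS : 2 ≤ (encodeCNF ⟨n, φ⟩).length + 2 ^ orderExp n * 2 ^ orderExp n + 2 :=
    Nat.le_add_left _ _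
  have h3 := hb.trans (Nat.pow_le_pow_left h2 c₁)
  generalize (encodeCNF ⟨n, φ⟩).length + 2 ^ orderExp n * 2 ^ orderExp n + 2 = S at h3 hS ⊢
  have h4 := (Nat.add_le_add_right h3 (S ^ c₂)).trans (pow_add_pow_le_pow hS c₁ c₂)
  have h5 : ((TK (encodeCNF ⟨n, φ⟩) + S ^ c₂ : ℕ) : ℝ) ≤ (S : ℝ) ^ (c₁ + c₂ + 1) := by
    exact_mod_cast h4
  rw [Nat.cast_add]
  exact add_le_add h5 ht

/-! ### The threshold function is computable -/

theorem encodeNat_two_pow (j : ℕ) :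
    Computability.encodeNat (2 ^ j) = List.replicate j false ++ [true] := by
  have h : ((2 ^ j : ℕ) : Num) = Num.pos (PosNum.bit0^[j] PosNum.one) := by
    rw [← Num.of_to_nat (Num.pos (PosNum.bit0^[j] PosNum.one))]
    congr 1
    induction j with
    | zero => rfl
    | succ j ih =>
      rw [Function.iterate_succ_apply', pow_succ', ih]
      simp [two_mul]
  have h' : ∀ j, Computability.encodePosNum (PosNum.bit0^[j] PosNum.one) =
      List.replicate j false ++ [true] := fun j => by
    induction j with
    | zero => rfl
    | succ j ih =>
      rw [Function.iterate_succ_apply', Computability.encodePosNum, List.replicate_succ,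
        List.cons_append, ih]
  rw [Computability.encodeNat, h, Computability.encodeNum, h']

theorem length_unaryEncodeNat (n : ℕ) : (Computability.unaryEncodeNat n).length = n :=
  Computability.unary_decode_encode_nat n

theorem wordOf_last (K : List Bool → ℕ) (l : List Bool) (j : ℕ) (h : K l = j + 1) :
    wordOf K (fun _ v => v 1 + 1 = v 0) l = List.replicate j false ++ [true] := by
  rw [wordOf, h, List.range_succ, List.map_append]
  congr 1
  · refine List.eq_replicate_iff.2 ⟨by simp, fun b hb => ?_⟩
    obtain ⟨z, hz, rfl⟩ := List.mem_map.1 hb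
    have := List.mem_range.1 hz
    simp only [decide_eq_false_iff_not]
    simp
    omega
  · simp

-- The value is a power of two, so its binary word, least significant bit first, consists of zeros
-- followed by a one. Only the length, a double logarithm, has to be computed; the word is then
-- passed to the identity machine.
open Turing in
theorem polyTimeInValue_invThreshold : PolyTimeInValue invThreshold := by
  obtain ⟨T, ⟨c₁, hT⟩, hK⟩ : UnaryPoly (k := 0) fun l _ => Nat.log 2 (Nat.log 2 l.length) + 1 :=
    UnaryPoly.length.log.log.succ
  have hP : UnaryDec (k := 2) fun _ v => v 1 + 1 = v 0 :=
    .eq (UnaryPoly.proj 1).succ (.proj 0)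
  have hK' : Computes (k := 0) (fun l _ => Nat.log 2 (Nat.log 2 l.length) + 1)
      fun l _ => (l.length + 2) ^ c₁ :=
    hK.mono fun l v => (hT l v).trans (by simp [inputSize])
  obtain ⟨M, c₂, hM⟩ := exists_machine_comp_wordOf
    ⟨idComputer Bool, Equiv.refl Bool, Equiv.refl Bool⟩ hK' hP
  refine ⟨{ M with
    time := (Polynomial.X + 2) ^ c₁ + (Polynomial.X + Polynomial.X + 3) ^ c₂ + 1
    outputsFun := fun n => Classical.choice ?_ }⟩
  have h := hM (Computability.unaryEncodeNat n) (Computability.encodeNat (invThreshold n)) 1 (by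
    rw [wordOf_last _ _ (Nat.log 2 (Nat.log 2 n)) (by rw [length_unaryEncodeNat]), invThreshold,
      encodeNat_two_pow]
    exact ⟨⟨⟨1, rfl⟩, le_rfl⟩⟩)
  obtain ⟨e⟩ := h
  refine ⟨⟨e.toEvalsTo, e.steps_le_m.trans ?_⟩⟩
  simp only [Polynomial.eval_add, Polynomial.eval_pow, Polynomial.eval_X, Polynomial.eval_ofNat,
    Polynomial.eval_one, length_unaryEncodeNat]
  have h₁ : Nat.log 2 (Nat.log 2 n) ≤ n := (Nat.log_le_self _ _).trans (Nat.log_le_self _ _)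
  have h₂ := Nat.pow_le_pow_left
    (show n + (Nat.log 2 (Nat.log 2 n) + 1) + 2 ≤ n + n + 3 by omega) c₂
  omega

/-! ### Growth of the parameters -/

theorem tendsto_natLog_two : Tendsto (Nat.log 2) atTop atTop :=
  tendsto_atTop_atTop_of_monotone Nat.log_monotone fun b => ⟨2 ^ b, (Nat.log_pow one_lt_two b).ge⟩

theorem tendsto_one_div_invThreshold :
    Tendsto (fun N => 1 / (invThreshold N : ℝ)) atTop (𝓝 0) := by
  have h : Tendsto invThreshold atTop atTop :=
    tendsto_atTop_mono (fun N => Nat.lt_two_pow_self.le)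
      (tendsto_natLog_two.comp tendsto_natLog_two)
  simp only [one_div]
  exact (tendsto_natCast_atTop_atTop.comp h).inv_tendsto_atTop

/-- The exponent loss in the lower bound, for graphs with `N` vertices. -/
noncomputable def exponentLoss (N : ℕ) : ℝ := 1 / √(Real.log (Real.log N))

theorem tendsto_exponentLoss : Tendsto exponentLoss atTop (𝓝 0) := by
  have h : Tendsto (fun N : ℕ => √(Real.log (Real.log N))) atTop atTop :=
    Real.tendsto_sqrt_atTop.comp (Real.tendsto_log_atTop.comp
      (Real.tendsto_log_atTop.comp tendsto_natCast_atTop_atTop))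
  exact h.inv_tendsto_atTop.congr fun N => (one_div _).symm

theorem tendsto_sq_mul_exp_neg (a b : ℝ) :
    Tendsto (fun u : ℝ => (a * u ^ 2 + b) ^ 2 * Real.exp (-u)) atTop (𝓝 0) := by
  have h := (((Real.tendsto_pow_mul_exp_neg_atTop_nhds_zero 4).const_mul (a ^ 2)).add
    ((Real.tendsto_pow_mul_exp_neg_atTop_nhds_zero 2).const_mul (2 * a * b))).add
    ((Real.tendsto_pow_mul_exp_neg_atTop_nhds_zero 0).const_mul (b ^ 2))
  simp only [mul_zero, add_zero] at h
  refine h.congr fun u => ?_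
  ring

/-- If `x ^ 2` is at most `n` up to logarithmic factors, then the power of `x` with exponent
`2 - 1 / √(log x)` is smaller than `n` by any constant factor. -/
theorem eventually_rpow_le (a b c : ℝ) (ha : 0 ≤ a) (hb : 0 < b) (hc : 0 < c) :
    ∀ᶠ x : ℝ in atTop, ∀ n : ℝ, x ^ 2 ≤ n * (a * Real.log x + b) ^ 2 →
      x ≤ c * n ∧ x ^ (2 - 1 / √(Real.log x)) ≤ c * n := by
  have hu : Tendsto (fun x => √(Real.log x)) atTop atTop :=
    Real.tendsto_sqrt_atTop.comp Real.tendsto_log_atTop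
  filter_upwards [hu.eventually ((tendsto_sq_mul_exp_neg a b).eventually (gt_mem_nhds hc)),
    hu.eventually_ge_atTop 1, eventually_ge_atTop 1] with x h₁ h₂ hx n hn
  have hx₀ : 0 < x := by linarith
  have hl : 0 ≤ Real.log x := Real.log_nonneg hx
  have hsq := Real.sq_sqrt hl
  set u := √(Real.log x) with hu
  -- Since x = exp(u²), the factor x^(-1/u) is exp(-u), which outweighs the logarithmic factors
  -- because these are polynomial in u.
  have hrpow : x ^ (2 - 1 / u) = x ^ 2 * Real.exp (-u) := by
    have hu₀ : u ≠ 0 := by linarith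
    rw [Real.rpow_def_of_pos hx₀, show Real.log x * (2 - 1 / u) = Real.log x + Real.log x + -u by
      rw [← hsq]; field_simp; ring, Real.exp_add, Real.exp_add, Real.exp_log hx₀]
    ring
  have key : x ^ (2 - 1 / u) ≤ c * n := by
    rw [hrpow]
    rw [← hsq] at hn
    have hp : 0 < a * u ^ 2 + b := by positivity
    have hn₀ : 0 < n := by
      by_contra! h
      nlinarith [mul_nonneg (neg_nonneg.2 h) (sq_nonneg (a * u ^ 2 + b)), sq_pos_of_pos hx₀]
    calc x ^ 2 * Real.exp (-u) ≤ n * (a * u ^ 2 + b) ^ 2 * Real.exp (-u) := by gcongr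
      _ = ((a * u ^ 2 + b) ^ 2 * Real.exp (-u)) * n := by ring
      _ ≤ c * n := by gcongr
  refine ⟨le_trans ?_ key, key⟩
  calc x = x ^ (1 : ℝ) := (Real.rpow_one x).symm
    _ ≤ x ^ (2 - 1 / u) := Real.rpow_le_rpow_of_exponent_le hx (by
      have : 1 / u ≤ 1 := (div_le_one (by linarith)).2 h₂
      linarith)

theorem gridSize_le_orderExp (n : ℕ) : 2 * gridSize n ≤ orderExp n := by
  have : 1 * (2 * gridSize n) ≤ fieldBits n * (3 * (2 * gridSize n + 1)) :=
    Nat.mul_le_mul (by simp [fieldBits]) (by omega)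
  simp only [orderExp]; omega

/-- The logarithm of the number of vertices. -/
noncomputable def logOrder (n : ℕ) : ℝ := orderExp n * Real.log 2

theorem log_order (n : ℕ) : Real.log ((2 ^ orderExp n : ℕ) : ℝ) = logOrder n := by
  push_cast
  rw [Real.log_pow, logOrder]

theorem order_eq_exp (n : ℕ) : ((2 ^ orderExp n : ℕ) : ℝ) = Real.exp (logOrder n) := by
  rw [← log_order, Real.exp_log (Nat.cast_pos.2 (Nat.two_pow_pos _))]

theorem gridSize_le_logOrder (n : ℕ) : (gridSize n : ℝ) ≤ logOrder n := by
  have h : ((2 * gridSize n : ℕ) : ℝ) ≤ orderExp n := by exact_mod_cast gridSize_le_orderExp n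
  have := Real.log_two_gt_d9
  push_cast at h
  rw [logOrder]
  have : (0 : ℝ) ≤ orderExp n := by positivity
  nlinarith

theorem one_le_gridSize (n : ℕ) : 1 ≤ gridSize n := Nat.le_add_left _ _

/-- For grid size m and s = ⌊log₂ m⌋, the exponent is at most 9m(4s + 13). From 2^s ≤ m ≤ log N and
log 2 > 1/2 follows s ≤ 2 log log N. Finally m ≤ 2√n, and 81 · 4 = 324. -/
theorem sq_logOrder_le {n : ℕ} (hn : 1 ≤ n) :
    logOrder n ^ 2 ≤ (324 * n : ℝ) * (8 * Real.log (logOrder n) + 13) ^ 2 := by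
  have hm₁ : (1 : ℝ) ≤ gridSize n := by exact_mod_cast one_le_gridSize n
  have hs : (Nat.log 2 (gridSize n) : ℝ) ≤ 2 * Real.log (logOrder n) := by
    have h : ((2 ^ Nat.log 2 (gridSize n) : ℕ) : ℝ) ≤ logOrder n :=
      (Nat.cast_le.2 (Nat.pow_log_le_self 2 (by have := one_le_gridSize n; omega))).trans
        (gridSize_le_logOrder n)
    have h' := Real.log_le_log (by positivity) h
    push_cast at h'
    rw [Real.log_pow] at h'
    have := Real.log_two_gt_d9
    have : (0 : ℝ) ≤ Nat.log 2 (gridSize n) := by positivity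
    nlinarith
  have hm : (gridSize n : ℝ) ^ 2 ≤ 4 * n := by
    have h₁ : Nat.sqrt n * Nat.sqrt n ≤ n := Nat.sqrt_le n
    have h₂ : 1 ≤ Nat.sqrt n := Nat.sqrt_pos.2 hn
    have : gridSize n ^ 2 ≤ 4 * n := by rw [gridSize]; nlinarith
    exact_mod_cast this
  have he : (orderExp n : ℝ) ≤ 9 * gridSize n * (4 * Nat.log 2 (gridSize n) + 13) := by
    have : orderExp n ≤ 9 * gridSize n * (4 * Nat.log 2 (gridSize n) + 13) := by
      rw [orderExp, fieldBits]
      have := one_le_gridSize n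
      nlinarith [Nat.zero_le (Nat.log 2 (gridSize n))]
    exact_mod_cast this
  have hx : logOrder n ≤ 9 * gridSize n * (8 * Real.log (logOrder n) + 13) := by
    have h₁ : logOrder n ≤ orderExp n := by
      rw [logOrder]
      have := Real.log_two_lt_d9
      have : (0 : ℝ) ≤ orderExp n := by positivity
      nlinarith
    exact h₁.trans (he.trans (mul_le_mul_of_nonneg_left (by linarith) (by positivity)))
  have hx₀ : 0 ≤ logOrder n := by linarith [gridSize_le_logOrder n]
  calc logOrder n ^ 2 ≤ (9 * gridSize n * (8 * Real.log (logOrder n) + 13)) ^ 2 := by gcongr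
    _ = 81 * (gridSize n : ℝ) ^ 2 * (8 * Real.log (logOrder n) + 13) ^ 2 := by ring
    _ ≤ 81 * (4 * n) * (8 * Real.log (logOrder n) + 13) ^ 2 := by gcongr
    _ = _ := by ring

theorem tendsto_logOrder : Tendsto logOrder atTop atTop := by
  refine tendsto_atTop_mono gridSize_le_logOrder (tendsto_natCast_atTop_atTop.comp ?_)
  exact tendsto_atTop_atTop_of_monotone (fun a b h => Nat.succ_le_succ (Nat.sqrt_le_sqrt h))
    fun b => ⟨b * b, by rw [gridSize, Nat.sqrt_eq]; omega⟩

theorem eventually_logOrder_le {c : ℝ} (hc : 0 < c) : ∀ᶠ n : ℕ in atTop,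
    logOrder n ≤ c * n ∧ logOrder n ^ (2 - 1 / √(Real.log (logOrder n))) ≤ c * n := by
  filter_upwards [tendsto_logOrder.eventually (eventually_rpow_le 8 13 (c / 324) (by norm_num)
    (by norm_num) (by positivity)), eventually_ge_atTop 1] with n h hn
  have := h _ (sq_logOrder_le hn)
  convert this using 2 <;> ring

/-! ### The lower bound -/

/-- With N = exp(x), the power N^(x^(1-δ)) is exp(x · x^(1-δ)); this turns the claimed exponent 1 -
δ into 2 - δ in terms of x = log N. -/
theorem rpow_order (n : ℕ) : ((2 ^ orderExp n : ℕ) : ℝ) ^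
    (Real.log ((2 ^ orderExp n : ℕ) : ℝ) ^ (1 - exponentLoss (2 ^ orderExp n))) =
      Real.exp (logOrder n ^ (2 - 1 / √(Real.log (logOrder n)))) := by
  have h₀ : 0 < logOrder n := lt_of_lt_of_le (by exact_mod_cast one_le_gridSize n)
    (gridSize_le_logOrder n)
  rw [exponentLoss, log_order, Real.rpow_def_of_pos (by positivity), log_order]
  congr 1
  nth_rewrite 1 [← Real.rpow_one (logOrder n)]
  rw [← Real.rpow_add h₀]
  congr 1
  ring

/-- The time of the reduction followed by the counting of communities. -/
theorem exists_time_le {δ : ℝ} (hδ : 0 < δ) (C : ℝ) (c : ℕ) : ∃ B : ℝ, ∀ n : ℕ,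
    (((2 ^ orderExp n : ℕ) : ℝ) ^ 2 + 3) ^ c + |C * (((2 ^ orderExp n : ℕ) : ℝ) ^
      (Real.log ((2 ^ orderExp n : ℕ) : ℝ) ^ (1 - exponentLoss (2 ^ orderExp n))) + 1)| ≤
    B * (2 : ℝ) ^ (δ * n) := by
  have hη : 0 < δ * Real.log 2 := mul_pos hδ (Real.log_pos one_lt_two)
  have hpow : ∀ n : ℕ, (2 : ℝ) ^ (δ * n) = Real.exp (δ * Real.log 2 * n) := fun n => by
    rw [Real.rpow_def_of_pos two_pos]; ring_nf
  have hO : (fun n : ℕ => (((2 ^ orderExp n : ℕ) : ℝ) ^ 2 + 3) ^ c + |C * (((2 ^ orderExp n : ℕ) : ℝ)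
      ^ (Real.log ((2 ^ orderExp n : ℕ) : ℝ) ^ (1 - exponentLoss (2 ^ orderExp n))) + 1)|)
      =O[atTop] fun n : ℕ => (2 : ℝ) ^ (δ * n) := by
    -- The constants come from N² + 3 ≤ 4N² and from adding 1 to a quantity bounded by a number that
    -- is at least 1. The rate with denominator 2c + 1 ensures N^(2c) ≤ 2^(δn), also when c = 0.
    refine Asymptotics.IsBigO.of_bound (4 ^ c + |C| * 2) ?_
    filter_upwards [eventually_logOrder_le hη, eventually_logOrder_le (c := δ * Real.log 2 /
      (2 * c + 1)) (by positivity)] with n h₁ h₂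
    rw [Real.norm_of_nonneg (by positivity), Real.norm_of_nonneg (by positivity), rpow_order, hpow,
      add_mul]
    refine add_le_add ?_ ?_
    · have hx := h₂.1
      rw [div_mul_eq_mul_div, le_div_iff₀ (by positivity)] at hx
      have hx₀ : 0 ≤ logOrder n := le_trans (by positivity) (gridSize_le_logOrder n)
      have h1 := Real.one_le_exp hx₀
      rw [order_eq_exp]
      calc (Real.exp (logOrder n) ^ 2 + 3) ^ c ≤ (4 * Real.exp (logOrder n) ^ 2) ^ c := by
            gcongr; nlinarith
        _ = 4 ^ c * Real.exp (2 * c * logOrder n) := by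
            rw [mul_pow, ← pow_mul, ← Real.exp_nat_mul]; push_cast; rfl
        _ ≤ 4 ^ c * Real.exp (δ * Real.log 2 * n) := by
            exact mul_le_mul_of_nonneg_left (Real.exp_le_exp.2 (by nlinarith)) (by positivity)
    · rw [abs_mul, mul_assoc, abs_of_nonneg (a := _ + _) (by positivity)]
      have h := Real.exp_le_exp.2 h₁.2
      have : 1 ≤ Real.exp (δ * Real.log 2 * n) := Real.one_le_exp (by positivity)
      exact mul_le_mul_of_nonneg_left (by linarith) (abs_nonneg C)
  -- As 2^(δn) never vanishes, a larger constant covers the finitely many small n.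
  obtain ⟨B, -, hB⟩ := Asymptotics.bound_of_isBigO_nat_atTop hO
  refine ⟨B, fun n => ?_⟩
  have := hB (x := n) (by positivity)
  rwa [Real.norm_of_nonneg (by positivity), Real.norm_of_nonneg (by positivity)] at this

theorem SolvableInTime.mono {α : Type} {enc : α → List Bool} {f : α → ℕ} {T T' : α → ℝ}
    (h : SolvableInTime enc f T) (hT : ∀ a, T a ≤ T' a) : SolvableInTime enc f T' :=
  let ⟨M, hM⟩ := h
  ⟨M, fun a => let ⟨t, ht, e⟩ := hM a; ⟨t, ht.trans (hT a), e⟩⟩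

/-- There is `ε(n) = o(1)`, of the form `1 / k(n)` with `k(n)` computable in time polynomial in `n`,
such that, assuming the counting exponential time hypothesis, there is `δ(n) = o(1)` for which no
algorithm counts the `(1, ε(n))`-communities of `n`-vertex graphs in time
`O(n ^ ((log n) ^ (1 - δ(n))))`. -/
theorem theorem2 :
    ∃ ε : ℕ → ℝ, Tendsto ε atTop (𝓝 0) ∧
      (∃ k : ℕ → ℕ, PolyTimeInValue k ∧ ∀ n, 0 < k n ∧ ε n = 1 / (k n : ℝ)) ∧
      (SharpETH →
        ∃ δ : ℕ → ℝ, Tendsto δ atTop (𝓝 0) ∧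
          ∀ C : ℝ, ¬ SolvableInTime encodeGraph (fun G => communityCount G.2 1 (ε G.1))
            (fun G => C * ((G.1 : ℝ) ^ ((Real.log (G.1 : ℝ)) ^ (1 - δ G.1)) + 1))) := by
  refine ⟨fun N => 1 / (invThreshold N : ℝ), tendsto_one_div_invThreshold,
    ⟨invThreshold, polyTimeInValue_invThreshold, fun N => ⟨invThreshold_pos N, rfl⟩⟩, ?_⟩
  rintro ⟨δ, hδ, hETH⟩
  refine ⟨exponentLoss, tendsto_exponentLoss, fun C hC => ?_⟩
  obtain ⟨c, hc⟩ := exists_solvableInTime_satCount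
    (T := fun N => C * ((N : ℝ) ^ (Real.log (N : ℝ) ^ (1 - exponentLoss N)) + 1)) hC
  obtain ⟨B, hB⟩ := exists_time_le hδ C c
  -- The hypothesis uses one number both as the constant factor and as the exponent of the length,
  -- so it must dominate `B` and `c`.
  refine hETH (max c ⌈B⌉₊) (hc.mono fun φ => ?_)
  have hl : (1 : ℝ) ≤ (encodeCNF φ).length := by
    have : 1 ≤ (encodeCNF φ).length := by simp [encodeCNF]; omega
    exact_mod_cast this
  have hBφ := hB φ.1
  set l : ℝ := ((encodeCNF φ).length : ℝ) with hl'
  set N : ℝ := ((2 ^ orderExp φ.1 : ℕ) : ℝ) with hN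
  set X := C * (N ^ (Real.log N ^ (1 - exponentLoss (2 ^ orderExp φ.1))) + 1)
  have h₁ : (((encodeCNF φ).length + 2 ^ orderExp φ.1 * 2 ^ orderExp φ.1 + 2 : ℕ) : ℝ) ≤
      l * (N ^ 2 + 3) := by
    have : (((encodeCNF φ).length + 2 ^ orderExp φ.1 * 2 ^ orderExp φ.1 + 2 : ℕ) : ℝ) =
        l + N ^ 2 + 2 := by rw [hl', hN]; push_cast; ring
    rw [this]
    nlinarith [sq_nonneg N]
  have hlc : (1 : ℝ) ≤ l ^ c := one_le_pow₀ hl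
  -- The absolute value is taken because `C` may be negative. As the formula has length at least 1,
  -- its power can be factored out of both summands.
  calc _ ≤ (l * (N ^ 2 + 3)) ^ c + |X| := by
        gcongr
        exact le_abs_self X
    _ ≤ l ^ c * ((N ^ 2 + 3) ^ c + |X|) := by
        rw [mul_pow, mul_add]
        nlinarith [abs_nonneg X]
    _ ≤ l ^ c * (B * 2 ^ (δ * (φ.1 : ℝ))) := by gcongr
    _ ≤ l ^ (max c ⌈B⌉₊) * ((max c ⌈B⌉₊ : ℕ) * 2 ^ (δ * (φ.1 : ℝ))) := by
        gcongr
        · exact le_trans (by positivity) hBφ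
        · exact le_max_left _ _
        · exact (Nat.le_ceil B).trans (by exact_mod_cast le_max_right _ _)
    _ = _ := by ring
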